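/- **Theorem 1 (Scaling limits for multitime processes).** *Setting.* A point $(x,v,r)\in\mathbb R^3$ (space, velocity, mark) represents the line $\ell(x,v)=\{(x+vt,t):t\in\mathbb R\}$ of the space–time plane, with mark $r$. Its right half-plane is $\{(\tilde x,\tilde t):\tilde x\ge x+\tilde t v\}$ and its left half-plane is the complement. For $a,b\in\mathbb R^2$ let $ab_+$ (resp. $ab_-$) be the set of $(x,v,r)$ such that $a$ is in the left and $b$ in the right half-plane (resp. $a$ in the right and $b$ in the left one), and let $ab$ be the set of $(x,v,r)$ whose line intersects the closed segment $\overline{ab}$. Let $o=(0,0)$, $d\mu_2=r^2\,d\mu$, and let $\mathcal M$ be the set of Borel measures $\mu$ on $\mathbb R^3$ with $\mu(ab)+\mu_2(ab)<\infty$ for all $a,b$. Put $$H_\mu(b)=\int r\,\bigl(\mathbf 1_{ob_+}-\mathbf 1_{ob_-}\bigr)\,d\mu .$$ Let $\mu\in\mathcal M$; for $\varepsilon>0$ let $X^\varepsilon$ be a Poisson process of intensity $\varepsilon^{-1}\mu$, all on one probability space, $N^\varepsilon=\varepsilon\sum_{p\in X^\varepsilon}\delta_p$, and $$\eta^\varepsilon(b)=\varepsilon^{-1}\bigl(H_{N^{\varepsilon^2}}(b)-H_\mu(b)\bigr),\qquad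 \hat\eta^\varepsilon(b)=\varepsilon^{-3/2}\bigl(H_{N^{\varepsilon^2}}(\varepsilon b)-H_\mu(\varepsilon b)\bigr).$$ For a nonnegative function $d$ on $\mathbb R^2\times\mathbb R^2$, a Lévy–Chentsov field with distance $d$ is a centered Gaussian field $\eta$ on $\mathbb R^2$ with $\operatorname{Cov}(\eta(a),\eta(b))=\frac12\bigl(d(o,a)+d(o,b)-d(a,b)\bigr)$. The distance associated to $\mu_2$ is $d_\mu(a,b)=\mu_2(ab_+\cup ab_-)$; it equals $\mu_2(ab)$ whenever the sets of lines through $a$ and through $b$ are $\mu$-null. *Conclusions.* 1. For every $b\in\mathbb R^2$, $H_{N^\varepsilon}(b)\to H_\mu(b)$ almost surely: as $\varepsilon=1/n\to0$, $n\in\mathbb N$, whatever the joint law of the processes $X^\varepsilon$ is; and as $\varepsilon\to0$ through the positive reals when the $X^\varepsilon$ are coupled by superposition, that is, $X^\varepsilon$ consists of the points of level at most $\varepsilon^{-1}$ of a Poisson process on $\mathbb R^3\times(0,\infty)$ with intensity $d\mu\,ds$ (these $X^\varepsilon$ are Poisson processes of intensity $\varepsilon^{-1}\mu$). 2. The finite-dimensional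 distributions of $\eta^\varepsilon$ converge, as $\varepsilon\to0$, to those of a Lévy–Chentsov field $\eta$ with distance $d_\mu$. 3. Assume that $d\mu(x,v,r)=\rho(x)\,dx\,d\mu(v,r|x)$, with $\rho\ge0$ measurable and a measurable family of probability measures $\mu(\cdot|x)$ on $\mathbb R^2$, such that the measures $r^2\rho(x)\,d\mu(v,r|x)$ have finite mass at $x=0$ and are weakly continuous at $x=0$ (as $x\to0$, their integrals of every bounded continuous nonnegative function of $(v,r)$ converge to its integral at $x=0$), and such that for some real $K$ and some measurable $g:\mathbb R\to[0,\infty]$ with $\int_K^\infty g(u)\,du<\infty$, for almost every $x$, $$\rho(x)\int_{\{|v|\ge u\}}r^2\,d\mu(v,r|x)\le g(u)\qquad\text{for all }u>K,\ u\ge|x|.$$ Let $d\hat\mu_2(x,v,r)=\rho(0)\,dx\,r^2\,d\mu(v,r|0)$. Then $\hat\mu_2(ab)<\infty$ for all $a,b$, and the joint finite-dimensional distributions of $(\eta^\varepsilon,\hat\eta^\varepsilon)$ converge, as $\varepsilon\to0$, to those of $(\eta,\hat\eta)$, where $\eta$ and $\hat\eta$ are independent Lévy–Chentsov fields, with distances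 $d_\mu$ and $\hat d(a,b)=\hat\mu_2(ab)$ respectively. -/

import Mathlib

open MeasureTheory ProbabilityTheory Filter Topology
open scoped ENNReal NNReal BoundedContinuousFunction

noncomputable section

namespace Multitime

/-- Points `(x, t)` of the space-time plane. The origin `o` is `(0, 0)`, i.e. `0`. -/
abbrev SpaceTime : Type := ℝ × ℝ

/-- Points `(x, v, r)` of space-velocity-mark space. -/
abbrev Pt : Type := ℝ × ℝ × ℝ

/-- The line `ℓ(x, v) = {(x + v t, t) : t ∈ ℝ}`. -/
def line (p : Pt) : Set SpaceTime := Set.range fun t : ℝ => (p.1 + p.2.1 * t, t)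

/-- The (closed) right half-plane of the line, which contains the line. -/
def rightHalf (p : Pt) : Set SpaceTime := {q | p.1 + q.2 * p.2.1 ≤ q.1}

/-- The (open) left half-plane of the line. -/
def leftHalf (p : Pt) : Set SpaceTime := {q | q.1 < p.1 + q.2 * p.2.1}

/-- The set `ab` of marked lines that intersect the closed segment from `a` to `b`. -/
def crossing (a b : SpaceTime) : Set Pt := {p | (line p ∩ segment ℝ a b).Nonempty}

/-- `ab₊`: the lines with `a` on the left and `b` on the right. -/
def crossingPos (a b : SpaceTime) : Set Pt := {p | a ∈ leftHalf p ∧ b ∈ rightHalf p}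

/-- `ab₋`: the lines with `a` on the right and `b` on the left. -/
def crossingNeg (a b : SpaceTime) : Set Pt := {p | a ∈ rightHalf p ∧ b ∈ leftHalf p}

/-- The measure `dμ₂(x, v, r) = r² dμ(x, v, r)`. -/
def secondMoment (μ : Measure Pt) : Measure Pt :=
  μ.withDensity fun p => ENNReal.ofReal (p.2.2 ^ 2)

/-- The space `𝓜` of measures with `μ(ab) + μ₂(ab) < ∞` for all `a, b`. -/
def admissible : Set (Measure Pt) :=
  {μ | ∀ a b : SpaceTime, μ (crossing a b) + secondMoment μ (crossing a b) < ∞}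

open Classical in
/-- The height function `h_{x,v,r}(b) = r (1{(x,v,r) ∈ ob₊} - 1{(x,v,r) ∈ ob₋})`. -/
def stepHeight (p : Pt) (b : SpaceTime) : ℝ :=
  p.2.2 * ((if p ∈ crossingPos 0 b then 1 else 0) - (if p ∈ crossingNeg 0 b then 1 else 0))

/-- The surface `H_μ(b) = ∫ h_{x,v,r}(b) dμ(x,v,r)`; for a point measure this is a sum over
its points. -/
def height (μ : Measure Pt) (b : SpaceTime) : ℝ := ∫ p, stepHeight p b ∂μ

/-- A point measure: a countable sum of Dirac masses. -/
def IsPointMeasure {E : Type*} [MeasurableSpace E] (ν : Measure E) : Prop :=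
  ∃ (ι : Type) (_ : Countable ι) (x : ι → E), ν = Measure.sum fun i => Measure.dirac (x i)

/-- `N` is (the empirical measure of) a Poisson process with intensity measure `ν`: a random
point measure which gives Poisson mass of mean `ν A` to every measurable `A` with `ν A < ∞` and
gives independent masses to disjoint sets. (Points may be multiple if `ν` has atoms.) -/
structure IsPoissonProcess {Ω E : Type*} [MeasurableSpace Ω] [MeasurableSpace E]
    (N : Ω → Measure E) (ν : Measure E) (P : Measure Ω) : Prop where
  measurable : Measurable N
  isPointMeasure : ∀ ω, IsPointMeasure (N ω)
  hasLaw : ∀ A : Set E, MeasurableSet A → ν A < ∞ →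
    HasLaw (fun ω => N ω A)
      ((poissonMeasure (ν A).toNNReal).map (fun k : ℕ => (k : ℝ≥0∞))) P
  indep : ∀ (n : ℕ) (A : Fin n → Set E), (∀ i, MeasurableSet (A i)) →
    Pairwise (fun i j => Disjoint (A i) (A j)) → iIndepFun (fun i ω => N ω (A i)) P

/-- The Poisson process obtained by superposing layers: keep the points of a process on
`Pt × (0, ∞)` whose level is at most `1/ε`, and forget the level. If the process on
`Pt × (0, ∞)` has intensity `dμ ds`, this has intensity `ε⁻¹ μ`. -/
def superposed {Ω : Type*} (M : Ω → Measure (Pt × ℝ)) (ε : ℝ) (ω : Ω) : Measure Pt :=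
  ((M ω).restrict {q | q.2 ≤ ε⁻¹}).map Prod.fst

/-- The rescaled empirical measure `N^ε = ε ∑_{p ∈ X^ε} δ_p`, where `N ε` is the (unscaled)
empirical measure of `X^ε`. -/
def rescaled {Ω : Type*} (N : ℝ → Ω → Measure Pt) (ε : ℝ) (ω : Ω) : Measure Pt :=
  ENNReal.ofReal ε • N ε ω

/-- The macroscopic fluctuation field `η^ε(b) = ε⁻¹ (H_{N^{ε²}}(b) - H_μ(b))`. -/
def fluct {Ω : Type*} (μ : Measure Pt) (N : ℝ → Ω → Measure Pt) (ε : ℝ) (b : SpaceTime)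
    (ω : Ω) : ℝ :=
  ε⁻¹ * (height (rescaled N (ε ^ 2) ω) b - height μ b)

/-- The microscopic fluctuation field
`η̂^ε(b) = ε^{-1/2} ε⁻¹ (H_{N^{ε²}}(ε b) - H_μ(ε b))`. -/
def fluctHat {Ω : Type*} (μ : Measure Pt) (N : ℝ → Ω → Measure Pt) (ε : ℝ) (b : SpaceTime)
    (ω : Ω) : ℝ :=
  (Real.sqrt ε)⁻¹ * ε⁻¹ * (height (rescaled N (ε ^ 2) ω) (ε • b) - height μ (ε • b))

/-- The distance `μ₂(ab)`, where lines touching the segment at an endpoint are counted according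
to the convention that a line belongs to its right half-plane: `ab = ab₊ ∪ ab₋`.
See `levyDist_eq_crossing` for the comparison with the closed segment. -/
def levyDist (μ : Measure Pt) (a b : SpaceTime) : ℝ :=
  (secondMoment μ (crossingPos a b ∪ crossingNeg a b)).toReal

/-- `η` is a Lévy-Chentsov field associated to `d`: a centered Gaussian process with
covariances `(d(o,a) + d(o,b) - d(a,b)) / 2`. -/
structure IsLevyChentsov {Ω : Type*} [MeasurableSpace Ω] (η : SpaceTime → Ω → ℝ)
    (d : SpaceTime → SpaceTime → ℝ) (Q : Measure Ω) : Prop where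
  gaussian : IsGaussianProcess η Q
  centered : ∀ a, ∫ ω, η a ω ∂Q = 0
  covariance : ∀ a b, cov[η a, η b; Q] = (d 0 a + d 0 b - d a b) / 2

/-- `dμ(x, v, r) = ρ(x) dx dμ(v, r | x)` with conditional probabilities `κ x = μ(· | x)`. -/
structure HasSpaceDensity (μ : Measure Pt) (ρ : ℝ → ℝ≥0) (κ : Kernel ℝ (ℝ × ℝ)) : Prop where
  measurable : Measurable ρ
  eq_compProd : μ = (volume.withDensity fun x => (ρ x : ℝ≥0∞)) ⊗ₘ κ

/-- Regularity at the space coordinate `0` which gives a meaning to the conditioned law given the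
single space coordinate `0`: the measures `r² ρ(x) dμ(v, r | x)` are finite and weakly continuous
at `x = 0`, and their velocity tails `{|v| ≥ u}`, for `|x| ≤ u`, are dominated by an integrable
function of `u` (near infinity), so that few lines starting far away cross a small neighbourhood
of the origin. -/
structure RegularAtZero (ρ : ℝ → ℝ≥0) (κ : Kernel ℝ (ℝ × ℝ)) : Prop where
  finite : (ρ 0 : ℝ≥0∞) * ∫⁻ w, ENNReal.ofReal (w.2 ^ 2) ∂(κ 0) < ∞
  continuousAt : ∀ φ : (ℝ × ℝ) →ᵇ ℝ≥0,
    ContinuousAt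
      (fun x => (ρ x : ℝ≥0∞) * ∫⁻ w, (φ w : ℝ≥0∞) * ENNReal.ofReal (w.2 ^ 2) ∂(κ x)) 0
  tail : ∃ (K : ℝ) (g : ℝ → ℝ≥0∞), Measurable g ∧ ∫⁻ u in Set.Ioi K, g u < ∞ ∧
    ∀ᵐ x : ℝ, ∀ u : ℝ, K < u → |x| ≤ u →
      (ρ x : ℝ≥0∞) * ∫⁻ w in {w : ℝ × ℝ | u ≤ |w.1|}, ENNReal.ofReal (w.2 ^ 2) ∂(κ x) ≤ g u

/-- The space-homogeneous measure `dμ̂(x, v, r) = ρ(0) dx dμ(v, r | 0)`. -/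
def muHat (ρ : ℝ → ℝ≥0) (κ : Kernel ℝ (ℝ × ℝ)) : Measure Pt :=
  (ρ 0 : ℝ≥0∞) • (volume : Measure ℝ).prod (κ 0)

/-- The scaling parameters `ε > 0`. -/
abbrev Scale : Type := Set.Ioi (0 : ℝ)

/-- The filter `ε → 0` on the scaling parameters `ε > 0`. -/
def toZero : Filter Scale := comap (Subtype.val : Scale → ℝ) (𝓝 0)

lemma mem_line_iff (p : Pt) (q : SpaceTime) : q ∈ line p ↔ q.1 = p.1 + q.2 * p.2.1 := by
  constructor
  · rintro ⟨t, rfl⟩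
    simp [mul_comm]
  · intro h
    exact ⟨q.2, Prod.ext (by simp [h, mul_comm]) rfl⟩

/-- If the lines through `a` and the lines through `b` have `μ`-measure zero, then the distance is
`μ₂(ab)` with `ab` the set of lines intersecting the closed segment. -/
theorem levyDist_eq_crossing (μ : Measure Pt) (a b : SpaceTime)
    (ha : μ {p | a ∈ line p} = 0) (hb : μ {p | b ∈ line p} = 0) :
    levyDist μ a b = (secondMoment μ (crossing a b)).toReal := by
  have hab : μ ({p | a ∈ line p} ∪ {p | b ∈ line p}) = 0 := measure_union_null ha hb
  have h2 : secondMoment μ ({p | a ∈ line p} ∪ {p | b ∈ line p}) = 0 :=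
    withDensity_absolutelyContinuous _ _ hab
  unfold levyDist
  congr 1
  refine measure_congr ?_
  have hae : ∀ᵐ p ∂(secondMoment μ), p ∉ ({p | a ∈ line p} ∪ {p | b ∈ line p}) :=
    measure_eq_zero_iff_ae_notMem.mp h2
  filter_upwards [hae] with p hp
  simp only [Set.mem_union, Set.mem_ofPred_eq, mem_line_iff, not_or] at hp
  obtain ⟨hpa, hpb⟩ := hp
  refine propext ⟨?_, ?_⟩
  · intro h
    have key : ∀ s t : ℝ, 0 ≤ s → 0 ≤ t → s + t = 1 →
        s * (a.1 - (p.1 + a.2 * p.2.1)) + t * (b.1 - (p.1 + b.2 * p.2.1)) = 0 →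
        p ∈ crossing a b := by
      intro s t hs ht hst h0
      refine ⟨s • a + t • b, ?_, s, t, hs, ht, hst, rfl⟩
      rw [mem_line_iff]
      simp only [Prod.fst_add, Prod.smul_fst, Prod.snd_add, Prod.smul_snd, smul_eq_mul]
      linear_combination h0 + p.1 * hst
    set fa := a.1 - (p.1 + a.2 * p.2.1) with hfa
    set fb := b.1 - (p.1 + b.2 * p.2.1) with hfb
    rcases h with ⟨h1, h2⟩ | ⟨h1, h2⟩
    · simp only [leftHalf, rightHalf, Set.mem_ofPred_eq] at h1 h2
      have hd : 0 < fb - fa := by linarith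
      refine key (fb / (fb - fa)) (-fa / (fb - fa)) (div_nonneg (by linarith) hd.le)
        (div_nonneg (by linarith) hd.le) ?_ ?_
      · field_simp
        ring
      · field_simp
        ring
    · simp only [leftHalf, rightHalf, Set.mem_ofPred_eq] at h1 h2
      have hd : 0 < fa - fb := by linarith
      refine key (-fb / (fa - fb)) (fa / (fa - fb)) (div_nonneg (by linarith) hd.le)
        (div_nonneg (by linarith) hd.le) ?_ ?_
      · field_simp
        ring
      · field_simp
        ring
  · rintro ⟨q, hq, s, t, hs, ht, hst, rfl⟩
    rw [mem_line_iff] at hq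
    simp only [Prod.fst_add, Prod.smul_fst, Prod.snd_add, Prod.smul_snd, smul_eq_mul] at hq
    have h0 : s * (a.1 - (p.1 + a.2 * p.2.1)) + t * (b.1 - (p.1 + b.2 * p.2.1)) = 0 := by
      linear_combination hq - p.1 * hst
    rcases lt_or_gt_of_ne hpa with h1 | h1 <;> rcases lt_or_gt_of_ne hpb with h2 | h2
    · exfalso
      rcases hs.eq_or_lt with h | h
      · nlinarith
      · nlinarith [mul_pos h (sub_pos.2 h1), mul_nonneg ht (sub_pos.2 h2).le]
    · exact Or.inl ⟨h1, h2.le⟩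
    · exact Or.inr ⟨h1.le, h2⟩
    · exfalso
      rcases hs.eq_or_lt with h | h
      · nlinarith
      · nlinarith [mul_pos h (sub_pos.2 h1), mul_nonneg ht (sub_pos.2 h2).le]

end Multitime

end

open Multitime

/-! Everything is an integral of the step heights `stepHeight p b` against a Poisson process. The
difference of the heights of `p` at `a` and `b` is the mark up to sign when `p` separates `a` from
`b`, and zero otherwise. Hence the distance of `μ` is the squared L²(μ) distance between step
heights, and by polarization the Lévy–Chentsov covariance is their L² inner product
(`integral_stepHeight_mul`). The limit field is therefore the image of the step heights under an
isometry of L²(μ) into centered Gaussian variables (`exists_isonormal`, `exists_isLevyChentsov`).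

Law of large numbers: with an arbitrary joint law only Borel–Cantelli is available, so the error
probabilities must be summable, although only second moments are assumed. Truncating at a level
proportional to `n` achieves this: the expected numbers of points above the level are summable by
square integrability, and a Chernoff bound makes the deviations of the truncated integral O(n⁻²)
(`ae_eventually_abs_sub_lt`). Under superposition the processes increase with `1/ε`, so integrals of
nonnegative functions interpolate between integer values of `1/ε`.

Fluctuations: a compensated Poisson integral of `G` has characteristic function exp ∫ (e^{iG} - 1 -
iG) dν. A linear combination of both fields is one such integral, with G = εF + √ε F_ε at intensity
ε⁻²μ, where F_ε only sees lines crossing segments of size ε. By `levyExponent_add` the exponent is a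
macroscopic term, a microscopic term and a cross term. The macroscopic term tends to -½∫F² by
dominated convergence. The cross term lives on lines of μ₂-mass O(ε), so it is of order ε⁻² ·
ε^{3/2} · ε = √ε; its disappearance is the asymptotic independence.

The microscopic term needs convergence of ε⁻¹μ₂ on rescaled separating sets and a Lindeberg
condition on the marks (`SecondMomentBlowup`). After the substitution x = εy, weak continuity at 0
gives the limit for almost every y. A line starting at εy and meeting an ε-neighbourhood of the
origin has speed at least of order |y|, so the tail hypothesis provides an integrable majorant in y
(`RegularAtZero.exists_dominating`). -/

namespace Multitime

/-! ### Geometry of marked lines -/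

open Classical in
/-- The indicator that `q` lies in the right half-plane of the line `p`. -/
noncomputable def side (q : SpaceTime) (p : Pt) : ℝ := if p.1 + q.2 * p.2.1 ≤ q.1 then 1 else 0

/-- The marked lines with exactly one of `a` and `b` in their right half-plane. -/
def separating (a b : SpaceTime) : Set Pt := crossingPos a b ∪ crossingNeg a b

lemma side_eq_zero_or_one (q : SpaceTime) (p : Pt) : side q p = 0 ∨ side q p = 1 := by
  unfold side; split_ifs <;> simp

lemma measurableSet_rightHalf (q : SpaceTime) :
    MeasurableSet {p : Pt | p.1 + q.2 * p.2.1 ≤ q.1} :=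
  measurableSet_le (by fun_prop) (by fun_prop)

@[fun_prop]
lemma measurable_side (q : SpaceTime) : Measurable (side q) := by
  unfold side
  exact Measurable.ite (measurableSet_rightHalf q) measurable_const measurable_const

lemma mem_separating_iff (a b : SpaceTime) (p : Pt) : p ∈ separating a b ↔ side a p ≠ side b p := by
  simp only [separating, crossingPos, crossingNeg, leftHalf, rightHalf, side, Set.mem_union,
    Set.mem_ofPred_eq]
  split_ifs <;> simp_all

lemma measurableSet_separating (a b : SpaceTime) : MeasurableSet (separating a b) := by
  have : separating a b = {p | side a p = side b p}ᶜ := by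
    ext p; simp [mem_separating_iff]
  rw [this]
  exact (measurableSet_eq_fun (by fun_prop) (by fun_prop)).compl

/-- In this form the height is an increment of `side` from the origin, so the base point cancels in
differences of heights. -/
lemma stepHeight_eq (p : Pt) (b : SpaceTime) :
    stepHeight p b = p.2.2 * (side b p - side 0 p) := by
  by_cases h0 : p.1 ≤ 0 <;> by_cases hb : p.1 + b.2 * p.2.1 ≤ b.1 <;>
    simp [stepHeight, crossingPos, crossingNeg, leftHalf, rightHalf, side, h0, hb, not_lt.2,
      not_le.1]

@[fun_prop]
lemma measurable_stepHeight (b : SpaceTime) : Measurable (fun p => stepHeight p b) := by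
  simp_rw [stepHeight_eq]; fun_prop

lemma abs_side_sub (a b : SpaceTime) (p : Pt) :
    |side b p - side a p| = (separating a b).indicator (fun _ => (1 : ℝ)) p := by
  by_cases h : p ∈ separating a b
  · rw [Set.indicator_of_mem h]
    rw [mem_separating_iff] at h
    rcases side_eq_zero_or_one a p with h1 | h1 <;> rcases side_eq_zero_or_one b p with h2 | h2 <;>
      simp_all
  · rw [Set.indicator_of_notMem h]
    rw [mem_separating_iff, not_not] at h
    simp [h]

/-- The two sides differ by ±1 exactly on the separating set. This identity makes the distance a
squared L² norm. -/
lemma stepHeight_sub_sq (a b : SpaceTime) (p : Pt) :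
    (stepHeight p a - stepHeight p b) ^ 2 =
      (separating a b).indicator (fun p => p.2.2 ^ 2) p := by
  have : stepHeight p a - stepHeight p b = - (p.2.2 * (side b p - side a p)) := by
    simp only [stepHeight_eq]; ring
  rw [this, neg_sq, mul_pow, ← sq_abs (side b p - side a p), abs_side_sub]
  by_cases h : p ∈ separating a b <;> simp [h]

lemma stepHeight_zero (p : Pt) : stepHeight p 0 = 0 := by simp [stepHeight_eq]

lemma abs_stepHeight (b : SpaceTime) (p : Pt) :
    |stepHeight p b| = (separating 0 b).indicator (fun p => |p.2.2|) p := by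
  rw [stepHeight_eq, abs_mul, abs_side_sub]
  by_cases h : p ∈ separating 0 b <;> simp [h]

lemma stepHeight_eq_zero_of_notMem {b : SpaceTime} {p : Pt} (h : p ∉ separating 0 b) :
    stepHeight p b = 0 := by
  rw [← abs_eq_zero, abs_stepHeight, Set.indicator_of_notMem h]

/-- An affine function that changes sign between the endpoints vanishes somewhere on the segment. -/
lemma separating_subset_crossing (a b : SpaceTime) : separating a b ⊆ crossing a b := by
  intro p h
  have key : ∀ s t : ℝ, 0 ≤ s → 0 ≤ t → s + t = 1 →
      s * (a.1 - (p.1 + a.2 * p.2.1)) + t * (b.1 - (p.1 + b.2 * p.2.1)) = 0 →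
      p ∈ crossing a b := by
    intro s t hs ht hst h0
    refine ⟨s • a + t • b, ?_, s, t, hs, ht, hst, rfl⟩
    rw [mem_line_iff]
    simp only [Prod.fst_add, Prod.smul_fst, Prod.snd_add, Prod.smul_snd, smul_eq_mul]
    linear_combination h0 + p.1 * hst
  set fa := a.1 - (p.1 + a.2 * p.2.1) with hfa
  set fb := b.1 - (p.1 + b.2 * p.2.1) with hfb
  rcases h with ⟨h1, h2⟩ | ⟨h1, h2⟩
  · simp only [leftHalf, rightHalf, Set.mem_ofPred_eq] at h1 h2
    have hd : 0 < fb - fa := by linarith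
    -- These weights are the zero of the linear interpolation between the values `fa` and `fb`.
    refine key (fb / (fb - fa)) (-fa / (fb - fa)) (div_nonneg (by linarith) hd.le)
      (div_nonneg (by linarith) hd.le) ?_ ?_ <;> field_simp <;> ring
  · simp only [leftHalf, rightHalf, Set.mem_ofPred_eq] at h1 h2
    have hd : 0 < fa - fb := by linarith
    refine key (-fb / (fa - fb)) (fa / (fa - fb)) (div_nonneg (by linarith) hd.le)
      (div_nonneg (by linarith) hd.le) ?_ ?_ <;> field_simp <;> ring

/-- Scaling space and time by the same factor preserves slopes, so only the starting position of a
line is rescaled. -/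
lemma side_smul {ε : ℝ} (hε : 0 < ε) (q : SpaceTime) (y : ℝ) (w : ℝ × ℝ) :
    side (ε • q) (ε * y, w) = side q (y, w) := by
  simp only [side, Prod.smul_fst, Prod.smul_snd, smul_eq_mul]
  congr 1
  rw [mul_assoc, ← mul_add]
  exact propext (mul_le_mul_iff_right₀ hε)

lemma mem_separating_smul {ε : ℝ} (hε : 0 < ε) (a b : SpaceTime) (y : ℝ) (w : ℝ × ℝ) :
    (ε * y, w) ∈ separating (ε • a) (ε • b) ↔ (y, w) ∈ separating a b := by
  rw [mem_separating_iff, mem_separating_iff, side_smul hε, side_smul hε]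

/-- Lines crossing a segment are fast if they start far away from the origin. -/
lemma exists_abs_le_of_mem_crossing (a b : SpaceTime) :
    ∃ C : ℝ, 1 ≤ C ∧ ∀ p ∈ crossing a b, |p.1| ≤ C * (1 + |p.2.1|) := by
  -- Both coordinates of any point of the segment are at most ‖a‖ + ‖b‖; the additional 1 makes `1 ≤
  -- C`.
  refine ⟨1 + ‖a‖ + ‖b‖, by linarith [norm_nonneg a, norm_nonneg b], ?_⟩
  rintro p ⟨q, hq, hq'⟩
  rw [mem_line_iff] at hq
  have hqn : ‖q‖ ≤ ‖a‖ + ‖b‖ := by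
    obtain ⟨s, t, hs, ht, hst, rfl⟩ := hq'
    calc ‖s • a + t • b‖ ≤ ‖s • a‖ + ‖t • b‖ := norm_add_le _ _
      _ = s * ‖a‖ + t * ‖b‖ := by
        rw [norm_smul, norm_smul, Real.norm_of_nonneg hs, Real.norm_of_nonneg ht]
      _ ≤ ‖a‖ + ‖b‖ := by
        nlinarith [norm_nonneg a, norm_nonneg b]
  have h1 : |q.1| ≤ ‖q‖ := norm_fst_le q
  have h2 : |q.2| ≤ ‖q‖ := norm_snd_le q
  have hp : p.1 = q.1 - q.2 * p.2.1 := by linarith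
  calc |p.1| = |q.1 - q.2 * p.2.1| := by rw [hp]
    _ ≤ |q.1| + |q.2 * p.2.1| := abs_sub _ _
    _ = |q.1| + |q.2| * |p.2.1| := by rw [abs_mul]
    _ ≤ _ := by nlinarith [abs_nonneg p.2.1]

/-! ### Second moments of step heights -/

lemma secondMoment_apply (μ : Measure Pt) {A : Set Pt} (hA : MeasurableSet A) :
    secondMoment μ A = ∫⁻ p, A.indicator (fun p => ENNReal.ofReal (p.2.2 ^ 2)) p ∂μ := by
  rw [secondMoment, withDensity_apply _ hA, lintegral_indicator hA]

/-- Marked lines have finite second moments along segments. -/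
def FiniteSecondMoments (μ : Measure Pt) : Prop :=
  ∀ a b : SpaceTime, secondMoment μ (separating a b) < ∞

lemma FiniteSecondMoments.of_mem_admissible {μ : Measure Pt} (hμ : μ ∈ admissible) :
    FiniteSecondMoments μ := fun a b =>
  (measure_mono (separating_subset_crossing a b)).trans_lt
    (le_add_self.trans_lt (hμ a b))

lemma measure_separating_lt_top {μ : Measure Pt} (hμ : μ ∈ admissible) (a b : SpaceTime) :
    μ (separating a b) < ∞ :=
  (measure_mono (separating_subset_crossing a b)).trans_lt
    (le_self_add.trans_lt (hμ a b))

lemma lintegral_stepHeight_sub_sq (μ : Measure Pt) (a b : SpaceTime) :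
    ∫⁻ p, ENNReal.ofReal ((stepHeight p a - stepHeight p b) ^ 2) ∂μ =
      secondMoment μ (separating a b) := by
  rw [secondMoment_apply μ (measurableSet_separating a b)]
  refine lintegral_congr fun p => ?_
  rw [stepHeight_sub_sq]
  by_cases h : p ∈ separating a b <;> simp [h]

lemma memLp_stepHeight {μ : Measure Pt} (hμ : FiniteSecondMoments μ) (b : SpaceTime) :
    MemLp (fun p => stepHeight p b) 2 μ := by
  rw [memLp_two_iff_integrable_sq (by fun_prop)]
  refine ⟨by fun_prop, ?_⟩
  rw [hasFiniteIntegral_iff_ofReal (Eventually.of_forall fun p => sq_nonneg _)]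
  have := lintegral_stepHeight_sub_sq μ b 0
  simp only [stepHeight_zero, sub_zero] at this
  rw [this]
  exact hμ b 0

lemma integral_stepHeight_sub_sq (μ : Measure Pt) (a b : SpaceTime) :
    ∫ p, (stepHeight p a - stepHeight p b) ^ 2 ∂μ = levyDist μ a b := by
  rw [integral_eq_lintegral_of_nonneg_ae (Eventually.of_forall fun p => sq_nonneg _) (by fun_prop),
    lintegral_stepHeight_sub_sq]
  rfl

lemma levyDist_comm (μ : Measure Pt) (a b : SpaceTime) : levyDist μ a b = levyDist μ b a := by
  rw [← integral_stepHeight_sub_sq, ← integral_stepHeight_sub_sq]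
  congr 1; ext p; ring

/-- Polarization: 2uv = u² + v² - (u - v)², together with the vanishing of heights at the origin. -/
lemma integral_stepHeight_mul {μ : Measure Pt} (hμ : FiniteSecondMoments μ) (a b : SpaceTime) :
    ∫ p, stepHeight p a * stepHeight p b ∂μ =
      (levyDist μ 0 a + levyDist μ 0 b - levyDist μ a b) / 2 := by
  have ha := (memLp_stepHeight hμ a).integrable_sq
  have hb := (memLp_stepHeight hμ b).integrable_sq
  have hab := ((memLp_stepHeight hμ a).sub (memLp_stepHeight hμ b)).integrable_sq
  simp only [Pi.sub_apply] at hab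
  have e1 := integral_stepHeight_sub_sq μ a 0
  have e2 := integral_stepHeight_sub_sq μ b 0
  simp only [stepHeight_zero, sub_zero] at e1 e2
  rw [levyDist_comm] at e1 e2
  rw [← e1, ← e2, ← integral_stepHeight_sub_sq, ← integral_add ha hb,
    ← integral_sub (by exact ha.add hb) hab, ← integral_div]
  congr 1; ext p
  ring

/-- The quadratic form of the covariance of a Lévy-Chentsov field with distance `d`. -/
noncomputable def quadForm {ι : Type*} [Fintype ι] (d : SpaceTime → SpaceTime → ℝ) (θ : ι → ℝ)
    (a : ι → SpaceTime) : ℝ :=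
  ∑ i, ∑ j, θ i * θ j * ((d 0 (a i) + d 0 (a j) - d (a i) (a j)) / 2)

lemma integral_sum_stepHeight_sq {ι : Type*} [Fintype ι] {μ : Measure Pt}
    (hμ : FiniteSecondMoments μ) (θ : ι → ℝ) (a : ι → SpaceTime) :
    ∫ p, (∑ i, θ i * stepHeight p (a i)) ^ 2 ∂μ = quadForm (levyDist μ) θ a := by
  have hint (i j : ι) : Integrable (fun p => θ i * θ j * (stepHeight p (a i) * stepHeight p (a j)))
      μ := ((memLp_stepHeight hμ (a i)).integrable_mul (memLp_stepHeight hμ (a j))).const_mul _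
  simp_rw [quadForm, ← integral_stepHeight_mul hμ, ← integral_const_mul]
  simp_rw [← integral_finsetSum _ (fun j _ => hint _ j)]
  rw [← integral_finsetSum]
  · congr 1; ext p
    rw [sq, Finset.sum_mul_sum]
    refine Finset.sum_congr rfl fun i _ => Finset.sum_congr rfl fun j _ => by ring
  · exact fun i _ => integrable_finsetSum _ fun j _ => hint i j

end Multitime

/-! ### Integrals against Poisson processes -/

namespace ProbabilityTheory

lemma integrable_cexp_mul_poissonMeasure (r : ℝ≥0) (z : ℂ) :
    Integrable (fun k : ℕ => Complex.exp (z * k)) (poissonMeasure r) := by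
  rw [integrable_poissonMeasure_iff]
  have h := (Real.summable_pow_div_factorial (r * Real.exp z.re)).mul_left (Real.exp (-r))
  refine h.congr fun n => ?_
  have hre : (z * n).re = n * z.re := by simp [mul_comm]
  rw [Complex.norm_exp, hre, Real.exp_nat_mul, mul_pow]
  ring

lemma integral_cexp_mul_poissonMeasure (r : ℝ≥0) (z : ℂ) :
    ∫ k : ℕ, Complex.exp (z * k) ∂poissonMeasure r =
      Complex.exp (r * (Complex.exp z - 1)) := by
  rw [integral_poissonMeasure r]
  calc ∑' a : ℕ, (Real.exp (-r) * r ^ a / a.factorial : ℝ) • Complex.exp (z * a)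
  _ = ∑' a : ℕ, (Real.exp (-r)) * ((r * Complex.exp z) ^ a / a.factorial) := by
      congr with a
      rw [mul_pow, ← Complex.exp_nat_mul, Complex.real_smul]
      push_cast
      ring_nf
  _ = (Real.exp (-r)) * ∑' a : ℕ, ((r * Complex.exp z) ^ a / a.factorial) := tsum_mul_left
  _ = (Real.exp (-r)) * Complex.exp (r * Complex.exp z) := by
      rw [(NormedSpace.expSeries_div_hasSum_exp (r * Complex.exp z)).tsum_eq,
        Complex.exp_eq_exp_ℂ]
  _ = Complex.exp (r * (Complex.exp z - 1)) := by
      rw [Complex.ofReal_exp, ← Complex.exp_add]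
      push_cast
      ring_nf

lemma lintegral_natCast_poissonMeasure (r : ℝ≥0) :
    ∫⁻ k : ℕ, (k : ℝ≥0∞) ∂poissonMeasure r = r := by
  have hexp (f : ℕ → ℝ≥0∞) : ∫⁻ k : ℕ, f k ∂poissonMeasure r =
      ∑' n : ℕ, ENNReal.ofReal (Real.exp (-r) * r ^ n / n.factorial) * f n := by
    simp [poissonMeasure, lintegral_sum_measure]
  have hone := hexp fun _ => 1
  simp only [lintegral_const, measure_univ, mul_one] at hone
  have : ∀ n : ℕ, ENNReal.ofReal (Real.exp (-r) * r ^ (n + 1) / (n + 1).factorial) *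
      ((n + 1 : ℕ) : ℝ≥0∞) =
      r * ENNReal.ofReal (Real.exp (-r) * r ^ n / n.factorial) := fun n => by
    rw [← ENNReal.ofReal_natCast, ← ENNReal.ofReal_mul (by positivity), ← ENNReal.ofReal_coe_nnreal,
      ← ENNReal.ofReal_mul (by positivity), Nat.factorial_succ]
    congr 1
    push_cast
    field_simp
    ring
  rw [hexp, tsum_eq_zero_add' ENNReal.summable, Nat.cast_zero, mul_zero, zero_add, tsum_congr this,
    ENNReal.tsum_mul_left, ← hone, mul_one]

end ProbabilityTheory

namespace Multitime.IsPoissonProcess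

variable {Ω E : Type*} [MeasurableSpace Ω] [MeasurableSpace E] {N : Ω → Measure E}
  {ν : Measure E} {P : Measure Ω}

lemma lintegral_apply (hN : IsPoissonProcess N ν P) {A : Set E} (hA : MeasurableSet A)
    (hA' : ν A < ∞) : ∫⁻ ω, N ω A ∂P = ν A := by
  have := (hN.hasLaw A hA hA').lintegral_comp (f := fun x => x) aemeasurable_id
  rw [this, lintegral_map (f := fun x => x) measurable_id (by fun_prop),
    lintegral_natCast_poissonMeasure,
    ENNReal.coe_toNNReal hA'.ne]

lemma ae_apply_lt_top (hN : IsPoissonProcess N ν P) {A : Set E} (hA : MeasurableSet A)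
    (hA' : ν A < ∞) : ∀ᵐ ω ∂P, N ω A < ∞ := by
  refine ae_lt_top ((Measure.measurable_coe hA).comp hN.measurable) ?_
  rw [hN.lintegral_apply hA hA']
  exact hA'.ne

lemma hasLaw_real (hN : IsPoissonProcess N ν P) {A : Set E} (hA : MeasurableSet A)
    (hA' : ν A < ∞) : HasLaw (fun ω => (N ω).real A)
      ((poissonMeasure (ν A).toNNReal).map (fun k : ℕ => (k : ℝ))) P := by
  have h : HasLaw ENNReal.toReal ((poissonMeasure (ν A).toNNReal).map (fun k : ℕ => (k : ℝ)))
      ((poissonMeasure (ν A).toNNReal).map (fun k : ℕ => (k : ℝ≥0∞))) := by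
    refine ⟨by fun_prop, ?_⟩
    rw [Measure.map_map (by fun_prop) (by fun_prop)]
    congr 1
  exact h.fun_comp (hN.hasLaw A hA hA')

lemma integrable_cexp_mul (hN : IsPoissonProcess N ν P) {A : Set E} (hA : MeasurableSet A)
    (hA' : ν A < ∞) (z : ℂ) : Integrable (fun ω => Complex.exp (z * (N ω).real A)) P := by
  have h := hN.hasLaw_real hA hA'
  have h2 : Integrable (fun x : ℝ => Complex.exp (z * x)) (P.map fun ω => (N ω).real A) := by
    rw [h.map_eq, integrable_map_measure (by fun_prop) (by fun_prop)]
    exact integrable_cexp_mul_poissonMeasure _ z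
  exact h2.comp_aemeasurable h.aemeasurable

lemma integral_cexp_mul (hN : IsPoissonProcess N ν P) {A : Set E} (hA : MeasurableSet A)
    (hA' : ν A < ∞) (z : ℂ) : ∫ ω, Complex.exp (z * (N ω).real A) ∂P =
      Complex.exp (ν.real A * (Complex.exp z - 1)) := by
  have h := (hN.hasLaw_real hA hA').integral_comp (f := fun x : ℝ => Complex.exp (z * x))
    (by fun_prop)
  simp only [Function.comp_def] at h
  rw [h, integral_map (by fun_prop) (by fun_prop)]
  exact integral_cexp_mul_poissonMeasure _ z

/-- Independence over disjoint sets factorizes the expectation into one-dimensional Poisson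
transforms. -/
lemma integral_cexp_sum (hN : IsPoissonProcess N ν P) {ι : Type*} [Fintype ι] {A : ι → Set E}
    (hA : ∀ i, MeasurableSet (A i)) (hA' : ∀ i, ν (A i) < ∞)
    (hd : Pairwise fun i j => Disjoint (A i) (A j)) (c : ι → ℂ) :
    ∫ ω, Complex.exp (∑ i, c i * (N ω).real (A i)) ∂P =
      Complex.exp (∑ i, ν.real (A i) * (Complex.exp (c i) - 1)) := by
  let e := Fintype.equivFin ι
  have hind := hN.indep (Fintype.card ι) (fun k => A (e.symm k)) (fun _ => hA _)
    (fun i j hij => hd (e.symm.injective.ne hij))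
  have h := hind.integral_fun_prod_comp
    (f := fun k (x : ℝ≥0∞) => Complex.exp (c (e.symm k) * x.toReal))
    (fun i => ((Measure.measurable_coe (hA _)).comp hN.measurable).aemeasurable)
    (fun i => by
      apply Measurable.aestronglyMeasurable
      fun_prop)
  rw [Complex.exp_sum]
  simp_rw [Complex.exp_sum]
  rw [← e.symm.prod_comp]
  simp_rw [← e.symm.prod_comp (fun i => Complex.exp (c i * (N _).real (A i)))]
  refine h.trans (Finset.prod_congr rfl fun k _ => hN.integral_cexp_mul (hA _) (hA' _) _)

lemma ae_integrable_simpleFunc (hN : IsPoissonProcess N ν P) (f : SimpleFunc E ℝ)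
    (hf : ν {x | f x ≠ 0} < ∞) : ∀ᵐ ω ∂P, Integrable f (N ω) := by
  have hm : MeasurableSet {x | f x ≠ 0} :=
    (measurableSet_eq_fun f.measurable measurable_const).compl
  filter_upwards [hN.ae_apply_lt_top hm hf] with ω hω
  rw [SimpleFunc.integrable_iff_finMeasSupp, SimpleFunc.finMeasSupp_iff]
  exact fun y hy => (measure_mono fun x hx => by
    simp only [Set.mem_preimage, Set.mem_singleton_iff] at hx
    simp [hx, hy]).trans_lt hω

/-- The integral is a finite combination of masses of disjoint level sets. The level 0 is discarded:
it contributes nothing and may have infinite intensity. -/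
lemma integral_cexp_integral_simpleFunc (hN : IsPoissonProcess N ν P) (f : SimpleFunc E ℝ)
    (hf : ν {x | f x ≠ 0} < ∞) (z : ℂ) :
    ∫ ω, Complex.exp (z * ∫ x, f x ∂N ω) ∂P =
      Complex.exp (∫ x, (Complex.exp (z * f x) - 1) ∂ν) := by
  classical
  have hm : MeasurableSet {x | f x ≠ 0} :=
    (measurableSet_eq_fun f.measurable measurable_const).compl
  set s := {y ∈ f.range | y ≠ 0} with hs
  have hfin : ∀ y : s, ν (f ⁻¹' {(y : ℝ)}) < ∞ := fun y =>
    (measure_mono fun x hx => by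
      simp only [Set.mem_preimage, Set.mem_singleton_iff] at hx
      have := (Finset.mem_filter.1 y.2).2
      simp [hx, this]).trans_lt hf
  have hint : Integrable f ν := by
    rw [SimpleFunc.integrable_iff_finMeasSupp, SimpleFunc.finMeasSupp_iff]
    exact fun y hy => (measure_mono fun x hx => by
      simp only [Set.mem_preimage, Set.mem_singleton_iff] at hx
      simp [hx, hy]).trans_lt hf
  have key := hN.integral_cexp_sum (A := fun y : s => f ⁻¹' {(y : ℝ)})
    (fun _ => f.measurableSet_preimage _) hfin
    (fun i j hij => Disjoint.preimage _ (by simpa using fun h => hij (Subtype.ext h)))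
    (fun y => z * (y : ℝ))
  have h1 : ∀ᵐ ω ∂P, Complex.exp (z * ∫ x, f x ∂N ω) =
      Complex.exp (∑ y : s, z * (y : ℝ) * (N ω).real (f ⁻¹' {(y : ℝ)})) := by
    filter_upwards [hN.ae_integrable_simpleFunc f hf] with ω hω
    rw [← SimpleFunc.integral_eq_integral f hω, SimpleFunc.integral_eq_sum_filter,
      ← Finset.sum_coe_sort]
    push_cast
    rw [Finset.mul_sum]
    congr 1
    refine Finset.sum_congr rfl fun y _ => ?_
    simp only [smul_eq_mul]
    push_cast
    ring
  rw [integral_congr_ae h1, key]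
  congr 1
  have h2 := SimpleFunc.map_integral f (fun y : ℝ => Complex.exp (z * y) - 1) hint (by simp)
  have h3 : Integrable (f.map (fun y : ℝ => Complex.exp (z * y) - 1)) ν := by
    rw [SimpleFunc.integrable_iff_finMeasSupp] at hint ⊢
    exact hint.map (by simp)
  rw [SimpleFunc.integral_eq_integral _ h3] at h2
  simp only [SimpleFunc.map_apply] at h2
  rw [h2, Finset.sum_coe_sort s
    (fun y : ℝ => (ν.real (f ⁻¹' {y}) : ℂ) * (Complex.exp (z * y) - 1)), hs, Finset.sum_filter]
  refine Finset.sum_congr rfl fun y _ => ?_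
  split_ifs with hy
  · simp
  · simp only [ne_eq, not_not] at hy
    simp [hy]

/-- **Campbell's formula**, for functions whose support has finite intensity. -/
lemma lintegral_lintegral (hN : IsPoissonProcess N ν P) {S : Set E} (hS : MeasurableSet S)
    (hS' : ν S < ∞) {f : E → ℝ≥0∞} (hf : Measurable f) (hfS : ∀ x ∉ S, f x = 0) :
    ∫⁻ ω, ∫⁻ x, f x ∂N ω ∂P = ∫⁻ x, f x ∂ν := by
  -- The mean measure of the process is compared with `ν` only inside `S`, where every measurable
  -- set has finite intensity and hence a known law.
  have hrestr : (P.bind N).restrict S = ν.restrict S := by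
    ext A hA
    rw [Measure.restrict_apply hA, Measure.restrict_apply hA,
      Measure.bind_apply (hA.inter hS) hN.measurable.aemeasurable,
      hN.lintegral_apply (hA.inter hS) ((measure_mono Set.inter_subset_right).trans_lt hS')]
  have hsupp : Function.support f ⊆ S := fun x hx => by
    by_contra h
    exact hx (hfS x h)
  rw [← Measure.lintegral_bind hN.measurable.aemeasurable hf.aemeasurable,
    ← setLIntegral_eq_of_support_subset hsupp, hrestr, setLIntegral_eq_of_support_subset hsupp]

lemma ae_integrable (hN : IsPoissonProcess N ν P) {f : E → ℝ} (hf : Measurable f)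
    (hfin : ν {x | f x ≠ 0} < ∞) (hint : Integrable f ν) : ∀ᵐ ω ∂P, Integrable f (N ω) := by
  have hm : MeasurableSet {x | f x ≠ 0} := (measurableSet_eq_fun hf measurable_const).compl
  have h := hN.lintegral_lintegral hm hfin (f := fun x => ‖f x‖ₑ) (by fun_prop)
    (fun x hx => by simpa using hx)
  have hlt : ∀ᵐ ω ∂P, ∫⁻ x, ‖f x‖ₑ ∂N ω < ∞ := by
    refine ae_lt_top ((Measure.measurable_lintegral (by fun_prop)).comp hN.measurable) ?_
    rw [h]
    exact hint.2.ne
  filter_upwards [hlt] with ω hω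
  exact ⟨hf.aestronglyMeasurable, hω⟩

end Multitime.IsPoissonProcess

namespace MeasureTheory

/-- Bochner integrals depend measurably on the measure. -/
lemma measurable_integral_measure {Ω E : Type*} [MeasurableSpace Ω] [MeasurableSpace E]
    {N : Ω → Measure E} (hN : Measurable N) {f : E → ℝ} (hf : Measurable f) :
    Measurable fun ω => ∫ x, f x ∂N ω := by
  classical
  have hl (g : E → ℝ≥0∞) (hg : Measurable g) : Measurable fun ω => ∫⁻ x, g x ∂N ω :=
    (Measure.measurable_lintegral hg).comp hN
  have hset : MeasurableSet {ω | ∫⁻ x, ‖f x‖ₑ ∂N ω < ∞} :=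
    measurableSet_lt (hl _ (by fun_prop)) measurable_const
  have heq : (fun ω => ∫ x, f x ∂N ω) = fun ω => if ∫⁻ x, ‖f x‖ₑ ∂N ω < ∞ then
      (∫⁻ x, ENNReal.ofReal (f x) ∂N ω).toReal - (∫⁻ x, ENNReal.ofReal (-f x) ∂N ω).toReal
      else 0 := by
    ext ω
    split_ifs with h
    · exact integral_eq_lintegral_pos_part_sub_lintegral_neg_part ⟨hf.aestronglyMeasurable, h⟩
    · exact integral_undef fun hi => h hi.2
  rw [heq]
  exact Measurable.ite hset ((hl _ (by fun_prop)).ennreal_toReal.sub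
    (hl _ (by fun_prop)).ennreal_toReal) measurable_const

end MeasureTheory

/-! ### Exponential functionals of Poisson integrals. -/

namespace Multitime.IsPoissonProcess

variable {Ω E : Type*} [MeasurableSpace Ω] [MeasurableSpace E] {N : Ω → Measure E}
  {ν : Measure E} {P : Measure Ω}

/-- Passage from simple functions to `f` by dominated convergence on both sides. The majorants are
left abstract so that imaginary and real `z` are treated together; the factor 2 is the bound |F n x|
≤ 2|f x| for the approximating simple functions. -/
lemma integral_cexp_integral_of_dominated (hN : IsPoissonProcess N ν P) {f : E → ℝ}
    (hf : Measurable f) (hfin : ν {x | f x ≠ 0} < ∞) (hint : Integrable f ν) (z : ℂ) {B : Ω → ℝ}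
    (hB : Integrable B P) {C : ℝ}
    (hfB : ∀ g : E → ℝ, (∀ x, |g x| ≤ 2 * |f x|) →
      ∀ᵐ ω ∂P, ‖Complex.exp (z * ∫ x, g x ∂N ω)‖ ≤ B ω)
    (hfC : ∀ x y, |y| ≤ 2 * |f x| → ‖Complex.exp (z * y) - 1‖ ≤ C * |f x|) :
    ∫ ω, Complex.exp (z * ∫ x, f x ∂N ω) ∂P =
      Complex.exp (∫ x, (Complex.exp (z * f x) - 1) ∂ν) := by
  set F : ℕ → SimpleFunc E ℝ := SimpleFunc.approxOn f hf Set.univ 0 (Set.mem_univ 0) with hF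
  have hlim (x : E) : Tendsto (fun n => F n x) atTop (𝓝 (f x)) :=
    SimpleFunc.tendsto_approxOn hf _ (by simp)
  have hle (n : ℕ) (x : E) : |F n x| ≤ 2 * |f x| := by
    have := SimpleFunc.norm_approxOn_zero_le hf (Set.mem_univ (0 : ℝ)) x n
    rw [two_mul]
    exact this
  have hFfin (n : ℕ) : ν {x | F n x ≠ 0} < ∞ := by
    refine (measure_mono fun x hx => ?_).trans_lt hfin
    intro h0
    have := hle n x
    rw [h0, abs_zero, mul_zero, abs_nonpos_iff] at this
    exact hx this
  have hl : Tendsto (fun n => ∫ ω, Complex.exp (z * ∫ x, F n x ∂N ω) ∂P) atTop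
      (𝓝 (∫ ω, Complex.exp (z * ∫ x, f x ∂N ω) ∂P)) := by
    refine tendsto_integral_of_dominated_convergence B (fun n => ?_) hB
      (fun n => hfB _ (hle n)) ?_
    · have := measurable_integral_measure hN.measurable (F n).measurable
      exact Measurable.aestronglyMeasurable (by fun_prop)
    · filter_upwards [hN.ae_integrable hf hfin hint] with ω hω
      have : Tendsto (fun n => ∫ x, F n x ∂N ω) atTop (𝓝 (∫ x, f x ∂N ω)) :=
        tendsto_integral_of_dominated_convergence (fun x => 2 * |f x|)
          (fun n => (F n).measurable.aestronglyMeasurable) (hω.abs.const_mul 2)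
          (fun n => Eventually.of_forall fun x => hle n x) (Eventually.of_forall hlim)
      have hc : Continuous fun t : ℝ => Complex.exp (z * t) := by fun_prop
      exact (hc.tendsto _).comp this
  have hr : Tendsto (fun n => Complex.exp (∫ x, (Complex.exp (z * F n x) - 1) ∂ν)) atTop
      (𝓝 (Complex.exp (∫ x, (Complex.exp (z * f x) - 1) ∂ν))) := by
    refine (Complex.continuous_exp.tendsto _).comp ?_
    refine tendsto_integral_of_dominated_convergence (fun x => C * |f x|) (fun n => ?_)
      (hint.abs.const_mul C) (fun n => Eventually.of_forall fun x => hfC x _ (hle n x))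
      (Eventually.of_forall fun x => ?_)
    · have := (F n).measurable
      exact Measurable.aestronglyMeasurable (by fun_prop)
    · have hc : Continuous fun t : ℝ => Complex.exp (z * t) - 1 := by fun_prop
      exact (hc.tendsto _).comp (hlim x)
  simp_rw [fun n => hN.integral_cexp_integral_simpleFunc (F n) (hFfin n) z] at hl
  exact tendsto_nhds_unique hl hr

/-- The characteristic function of an integral against a Poisson process. -/
lemma integral_cexp_I_mul_integral [IsProbabilityMeasure P] (hN : IsPoissonProcess N ν P)
    {f : E → ℝ} (hf : Measurable f) (hfin : ν {x | f x ≠ 0} < ∞) (hint : Integrable f ν) :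
    ∫ ω, Complex.exp (Complex.I * ∫ x, f x ∂N ω) ∂P =
      Complex.exp (∫ x, (Complex.exp (Complex.I * f x) - 1) ∂ν) := by
  refine hN.integral_cexp_integral_of_dominated hf hfin hint _ (integrable_const (1 : ℝ)) (C := 2)
    (fun g _ => Eventually.of_forall fun ω => ?_) (fun x y hy => ?_)
  · rw [Complex.norm_exp_I_mul_ofReal]
  · exact (Real.norm_exp_I_mul_ofReal_sub_one_le).trans hy

/-- The moment generating function of an integral against a Poisson process. -/
lemma integral_exp_integral (hN : IsPoissonProcess N ν P)
    {f : E → ℝ} (hf : Measurable f) (hfin : ν {x | f x ≠ 0} < ∞) {M : ℝ}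
    (hM : ∀ x, |f x| ≤ M) (hint : Integrable f ν) (θ : ℝ) :
    ∫ ω, Real.exp (θ * ∫ x, f x ∂N ω) ∂P = Real.exp (∫ x, (Real.exp (θ * f x) - 1) ∂ν) := by
  have hm : MeasurableSet {x | f x ≠ 0} := (measurableSet_eq_fun hf measurable_const).compl
  -- An integrand bounded by 2M and vanishing off the support of `f` has integral at most 2M times
  -- the number of points there, a Poisson variable with all exponential moments.
  have h := hN.integral_cexp_integral_of_dominated hf hfin hint (θ : ℂ)
    (B := fun ω => Real.exp (|θ| * (2 * M * (N ω).real {x | f x ≠ 0})))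
    (C := |θ| * 2 * Real.exp (|θ| * (2 * M))) ?_ (fun g hg => ?_) (fun x y hy => ?_)
  · rw [← Complex.ofReal_inj, ← integral_complex_ofReal]
    push_cast
    rw [h, ← integral_complex_ofReal]
    push_cast
    rfl
  · have := (hN.integrable_cexp_mul hm hfin ((|θ| * (2 * M) : ℝ) : ℂ)).norm
    refine this.congr (Eventually.of_forall fun ω => ?_)
    simp only
    rw [← Complex.ofReal_mul, Complex.norm_exp_ofReal, mul_assoc]
  · filter_upwards [hN.ae_apply_lt_top hm hfin] with ω hω
    rw [← Complex.ofReal_mul, Complex.norm_exp_ofReal]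
    refine Real.exp_le_exp.2 ((le_abs_self _).trans ?_)
    rw [abs_mul]
    refine mul_le_mul_of_nonneg_left ?_ (abs_nonneg _)
    have hsupp : Function.support g ⊆ {x | f x ≠ 0} := fun x hx h0 => by
      have := hg x
      rw [h0, abs_zero, mul_zero, abs_nonpos_iff] at this
      exact hx this
    rw [← setIntegral_eq_integral_of_forall_compl_eq_zero (s := {x | f x ≠ 0})
      (fun x hx => by_contra fun h => hx (hsupp h))]
    exact norm_setIntegral_le_of_norm_le_const (f := g) (C := 2 * M) hω fun x _ =>
      (hg x).trans (mul_le_mul_of_nonneg_left (hM x) (by norm_num))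
  · have h1 := Complex.norm_exp_sub_sum_le_norm_mul_exp ((θ : ℂ) * y) 1
    simp only [Finset.range_one, Finset.sum_singleton, pow_zero, Nat.factorial_zero, Nat.cast_one,
      div_one, pow_one, norm_mul, Complex.norm_real, Real.norm_eq_abs] at h1
    refine h1.trans ?_
    have h2 : |y| ≤ 2 * M := hy.trans (mul_le_mul_of_nonneg_left (hM x) (by norm_num))
    calc |θ| * |y| * Real.exp (|θ| * |y|)
      _ ≤ |θ| * (2 * |f x|) * Real.exp (|θ| * (2 * M)) := by gcongr
      _ = _ := by ring

end Multitime.IsPoissonProcess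

/-! ### A strong law of large numbers for Poisson processes with arbitrary coupling -/

lemma Real.exp_sub_one_sub_le (u : ℝ) : Real.exp u - 1 - u ≤ u ^ 2 * Real.exp |u| := by
  have h := Complex.norm_exp_sub_sum_le_norm_mul_exp (u : ℂ) 2
  have h2 : Complex.exp u - ∑ m ∈ Finset.range 2, (u : ℂ) ^ m / m.factorial =
      ((Real.exp u - 1 - u : ℝ) : ℂ) := by
    simp [Finset.sum_range_succ]
    ring
  rw [h2, Complex.norm_real, Complex.norm_real, Real.norm_eq_abs, Real.norm_eq_abs, sq_abs] at h
  exact (le_abs_self _).trans h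

namespace Multitime.IsPoissonProcess

variable {Ω E : Type*} [MeasurableSpace Ω] [MeasurableSpace E] {N : Ω → Measure E}
  {ν : Measure E} {P : Measure Ω}

/-- Markov's inequality for an integer-valued mass whose mean is the intensity. -/
lemma measure_apply_ne_zero_le (hN : IsPoissonProcess N ν P) {A : Set E} (hA : MeasurableSet A) :
    P {ω | N ω A ≠ 0} ≤ ν A := by
  rcases lt_or_ge (ν A) ∞ with hA' | hA'
  swap
  · rw [top_le_iff.1 hA']; exact le_top
  have hm : MeasurableSet {x : ℝ≥0∞ | x ≠ 0} := (measurableSet_singleton 0).compl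
  rw [(hN.hasLaw A hA hA').measure_eq (p := fun x => x ≠ 0) hm, Measure.map_apply (by fun_prop) hm,
    ← lintegral_indicator_one MeasurableSet.of_discrete]
  refine le_trans (lintegral_mono fun k => ?_) (lintegral_natCast_poissonMeasure _).le |>.trans ?_
  · by_cases hk : k = 0
    · simp [hk]
    · refine (Set.indicator_le_self' (by simp) _).trans ?_
      simpa using Nat.one_le_iff_ne_zero.2 hk
  · rw [ENNReal.coe_toNNReal hA'.ne]

/-- A Chernoff bound for integrals of bounded functions against Poisson processes. -/
lemma measure_integral_ge_le [IsProbabilityMeasure P] {n : ℕ}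
    (hN : IsPoissonProcess N ((n : ℝ≥0∞) • ν) P) {g : E → ℝ} (hg : Measurable g)
    (hfin : ν {x | g x ≠ 0} < ∞) {M V : ℝ} (hM : ∀ x, |g x| ≤ M) (h2 : Integrable g ν)
    (h2' : Integrable (fun x => g x ^ 2) ν) (hV : ∫ x, g x ^ 2 ∂ν ≤ V) {θ : ℝ} (hθ : 0 ≤ θ)
    (δ : ℝ) :
    P.real {ω | n * ∫ x, g x ∂ν + n * δ ≤ ∫ x, g x ∂N ω} ≤
      Real.exp (n * (θ ^ 2 * V * Real.exp (θ * M)) - θ * (n * δ)) := by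
  have hfin' : ((n : ℝ≥0∞) • ν) {x | g x ≠ 0} < ∞ := by
    rw [Measure.smul_apply, smul_eq_mul]
    exact ENNReal.mul_lt_top (ENNReal.natCast_lt_top n) hfin
  have hmgf := hN.integral_exp_integral hg hfin' hM (h2.smul_measure (by simp)) θ
  -- A nonintegrable function would have integral 0 by convention, but the formula gives a positive
  -- exponential.
  have hint : Integrable (fun ω => Real.exp (θ * ∫ x, g x ∂N ω)) P := by
    by_contra h
    rw [integral_undef h] at hmgf
    exact (Real.exp_pos _).ne hmgf
  refine (measure_ge_le_exp_mul_mgf (X := fun ω => ∫ x, g x ∂N ω) _ hθ hint).trans ?_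
  rw [mgf, hmgf, integral_smul_measure, ← Real.exp_add, Real.exp_le_exp]
  -- The linear term yields the mean and the quadratic one the variance proxy `V`; the bound `M`
  -- enters only through the factor exp(θM).
  have hb (x : E) : Real.exp (θ * g x) - 1 ≤ θ * g x + θ ^ 2 * Real.exp (θ * M) * g x ^ 2 := by
    have h := Real.exp_sub_one_sub_le (θ * g x)
    have : Real.exp |θ * g x| ≤ Real.exp (θ * M) := by
      rw [abs_mul, abs_of_nonneg hθ]
      gcongr
      exact hM x
    have h3 : (θ * g x) ^ 2 * Real.exp |θ * g x| ≤ (θ * g x) ^ 2 * Real.exp (θ * M) := by gcongr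
    nlinarith
  have hle : ∫ x, (Real.exp (θ * g x) - 1) ∂ν ≤
      θ * ∫ x, g x ∂ν + θ ^ 2 * Real.exp (θ * M) * V := by
    calc ∫ x, (Real.exp (θ * g x) - 1) ∂ν
      _ ≤ ∫ x, (θ * g x + θ ^ 2 * Real.exp (θ * M) * g x ^ 2) ∂ν := by
        have hI : Integrable (fun x => θ * g x + θ ^ 2 * Real.exp (θ * M) * g x ^ 2) ν :=
          (h2.const_mul _).add (h2'.const_mul _)
        refine integral_mono (((h2.const_mul θ).abs.add
          (h2'.const_mul (θ ^ 2 * Real.exp (θ * M)))).mono' (by fun_prop)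
          (Eventually.of_forall fun x => ?_)) hI hb
        have := Real.add_one_le_exp (θ * g x)
        have hq : 0 ≤ θ ^ 2 * Real.exp (θ * M) * g x ^ 2 := by positivity
        rw [Real.norm_eq_abs, abs_le]
        simp only [Pi.add_apply]
        constructor
        · linarith [neg_abs_le (θ * g x)]
        · linarith [hb x, le_abs_self (θ * g x)]
      _ = θ * ∫ x, g x ∂ν + θ ^ 2 * Real.exp (θ * M) * ∫ x, g x ^ 2 ∂ν := by
        rw [integral_add (h2.const_mul _) (h2'.const_mul _), integral_const_mul,
          integral_const_mul]
      _ ≤ _ := by gcongr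
  have hn : (0 : ℝ) ≤ n := Nat.cast_nonneg n
  simp only [ENNReal.toReal_natCast, smul_eq_mul]
  nlinarith [mul_le_mul_of_nonneg_left hle hn]

/-- With k = ⌈X⌉ the sum is k(k - 1)/2. It vanishes if k ≤ 1; otherwise X > 1 and k < X + 1 give at
most X(X + 1)/2 ≤ X². -/
lemma _root_.ENNReal.tsum_natCast_indicator_le (X : ℝ) (hX : 0 ≤ X) :
    ∑' n : ℕ, (if (n : ℝ) < X then (n : ℝ≥0∞) else 0) ≤ ENNReal.ofReal (X ^ 2) := by
  have h0 : ∀ n ∉ Finset.range ⌈X⌉₊, (if (n : ℝ) < X then (n : ℝ≥0∞) else 0) = 0 := fun n hn => by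
    rw [if_neg]
    rw [Finset.mem_range, Nat.lt_ceil] at hn
    exact hn
  rw [tsum_eq_sum h0]
  have h1 : ∑ n ∈ Finset.range ⌈X⌉₊, (if (n : ℝ) < X then (n : ℝ≥0∞) else 0) ≤
      ∑ n ∈ Finset.range ⌈X⌉₊, (n : ℝ≥0∞) := Finset.sum_le_sum fun n _ => by split_ifs <;> simp
  refine h1.trans ?_
  rw [← Nat.cast_sum, ← ENNReal.ofReal_natCast]
  refine ENNReal.ofReal_le_ofReal ?_
  have hk := Nat.ceil_lt_add_one hX
  have h2 : ((∑ n ∈ Finset.range ⌈X⌉₊, n : ℕ) : ℝ) * 2 = (⌈X⌉₊ : ℝ) * ((⌈X⌉₊ - 1 : ℕ) : ℝ) := by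
    exact_mod_cast Finset.sum_range_id_mul_two _
  rcases le_or_gt ⌈X⌉₊ 1 with h | h
  · rw [Nat.sub_eq_zero_of_le h] at h2
    simp only [Nat.cast_zero, mul_zero, mul_eq_zero, OfNat.ofNat_ne_zero, or_false] at h2
    rw [h2]
    positivity
  · rw [Nat.cast_sub h.le, Nat.cast_one] at h2
    have h' : (2 : ℝ) ≤ ⌈X⌉₊ := by exact_mod_cast h
    nlinarith

/-- Truncation at a linear level is harmless for square integrable functions. -/
lemma _root_.MeasureTheory.tsum_mul_measure_lt_abs_ne_top {f : E → ℝ} (hf : Measurable f)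
    (h2 : Integrable (fun x => f x ^ 2) ν) {c : ℝ} (hc : 0 < c) :
    ∑' n : ℕ, (n : ℝ≥0∞) * ν {x | c * n < |f x|} ≠ ∞ := by
  have hm (n : ℕ) : MeasurableSet {x | c * n < |f x|} :=
    measurableSet_lt measurable_const (by fun_prop)
  have h1 (n : ℕ) : (n : ℝ≥0∞) * ν {x | c * n < |f x|} =
      ∫⁻ x, (if (n : ℝ) < |f x| / c then (n : ℝ≥0∞) else 0) ∂ν := by
    rw [← lintegral_indicator_const (hm n)]
    refine lintegral_congr fun x => ?_
    simp only [Set.indicator, Set.mem_ofPred_eq, lt_div_iff₀ hc, mul_comm c]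
  have hmeas (n : ℕ) : Measurable fun x => if (n : ℝ) < |f x| / c then (n : ℝ≥0∞) else 0 :=
    Measurable.ite (measurableSet_lt measurable_const (by fun_prop)) measurable_const
      measurable_const
  simp_rw [h1]
  -- After exchanging sum and integral, the inner sum at `x` is at most (|f x|/c)², which is
  -- integrable.
  rw [← lintegral_tsum fun n => (hmeas n).aemeasurable]
  refine ((lintegral_mono fun x => ENNReal.tsum_natCast_indicator_le _
    (div_nonneg (abs_nonneg (f x)) hc.le)).trans_lt ?_).ne
  have h3 : Integrable (fun x => (|f x| / c) ^ 2) ν := by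
    simp_rw [div_pow, sq_abs]
    exact h2.div_const _
  exact h3.lintegral_lt_top

end Multitime.IsPoissonProcess

/-! ### Truncation and Borel–Cantelli. -/

namespace Multitime.IsPoissonProcess

variable {Ω E : Type*} [MeasurableSpace Ω] [MeasurableSpace E] {N : ℕ → Ω → Measure E}
  {ν : Measure E} {P : Measure Ω}

/-- The choice θ = 2 log n/(nδ) makes the Chernoff gain 2 log n. At truncation level M = δn/4 one
has θM = (log n)/2, so exp(θM) = √n, and (log n)² ≤ 16√n keeps the variance term bounded.
Probabilities are thus O(n⁻²). -/
lemma chernoff_exponent_le {n : ℕ} (hn : 0 < n) {V δ : ℝ} (hV : 0 ≤ V) (hδ : 0 < δ) :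
    n * ((2 * Real.log n / (n * δ)) ^ 2 * V *
      Real.exp (2 * Real.log n / (n * δ) * (δ / 4 * n))) - 2 * Real.log n / (n * δ) * (n * δ) ≤
      64 * V / δ ^ 2 - 2 * Real.log n := by
  have hn' : (0 : ℝ) < n := Nat.cast_pos.2 hn
  set l := Real.log n with hl
  have hl0 : 0 ≤ l := Real.log_natCast_nonneg n
  have e1 : 2 * l / (n * δ) * (n * δ) = 2 * l := by field_simp
  have e2 : 2 * l / (n * δ) * (δ / 4 * n) = l / 2 := by field_simp; ring
  have e3 : Real.exp (l / 2) * Real.exp (l / 2) = n := by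
    rw [← Real.exp_add, add_halves, hl, Real.exp_log hn']
  have e4 : l ^ 2 ≤ 16 * Real.exp (l / 2) := by
    have h1 : l / 4 ≤ Real.exp (l / 4) := by linarith [Real.add_one_le_exp (l / 4)]
    have h2 : Real.exp (l / 2) = Real.exp (l / 4) ^ 2 := by
      rw [← Real.exp_nat_mul]; congr 1; push_cast; ring
    rw [h2]
    nlinarith
  have e5 : n * ((2 * l / (n * δ)) ^ 2 * V * Real.exp (l / 2)) =
      4 * V / δ ^ 2 * (l ^ 2 * Real.exp (l / 2) / n) := by field_simp; ring
  have e6 : l ^ 2 * Real.exp (l / 2) / n ≤ 16 := by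
    rw [div_le_iff₀ hn', ← e3]
    nlinarith [Real.exp_pos (l / 2)]
  rw [e1, e2, e5]
  have : 4 * V / δ ^ 2 * (l ^ 2 * Real.exp (l / 2) / n) ≤ 4 * V / δ ^ 2 * 16 := by gcongr
  have e7 : 64 * V / δ ^ 2 = 4 * V / δ ^ 2 * 16 := by ring
  linarith

/-- Values above δn/4 eventually do not occur, because Σ n ν(A n) is finite. The remaining bounded
part is within δ of its mean by two Chernoff bounds, and the truncated mean is eventually within δ
of the full one; hence 2δ. -/
lemma ae_eventually_abs_sub_lt [IsProbabilityMeasure P]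
    (hN : ∀ n : ℕ, 0 < n → IsPoissonProcess (N n) ((n : ℝ≥0∞) • ν) P) {f : E → ℝ}
    (hf : Measurable f) (hfin : ν {x | f x ≠ 0} < ∞) (hint : Integrable f ν)
    (h2 : Integrable (fun x => f x ^ 2) ν) {δ : ℝ} (hδ : 0 < δ) :
    ∀ᵐ ω ∂P, ∀ᶠ n : ℕ in atTop,
      |(n : ℝ)⁻¹ * ∫ x, f x ∂N n ω - ∫ x, f x ∂ν| < 2 * δ := by
  set A : ℕ → Set E := fun n => {x | δ / 4 * n < |f x|} with hA
  have hAm (n : ℕ) : MeasurableSet (A n) := measurableSet_lt measurable_const (by fun_prop)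
  set g : ℕ → E → ℝ := fun n => (A n)ᶜ.indicator f with hg
  have hgm (n : ℕ) : Measurable (g n) := hf.indicator (hAm n).compl
  have hgf (n : ℕ) (x : E) : |g n x| ≤ |f x| := by
    by_cases hx : x ∈ A n <;> simp [hg, hx]
  have hgM (n : ℕ) (x : E) : |g n x| ≤ δ / 4 * n := by
    by_cases hx : x ∈ A n
    · simp only [hg, Set.mem_compl_iff, hx, not_true_eq_false, not_false_eq_true,
        Set.indicator_of_notMem, abs_zero]
      positivity
    · simp only [hg, Set.mem_compl_iff, hx, not_false_eq_true, Set.indicator_of_mem]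
      simpa [hA] using hx
  have hgfin (n : ℕ) : ν {x | g n x ≠ 0} < ∞ := by
    refine (measure_mono (t := {x | f x ≠ 0}) fun x hx h0 => ?_).trans_lt hfin
    have := hgf n x
    rw [h0, abs_zero, abs_nonpos_iff] at this
    exact hx this
  have hgint (n : ℕ) : Integrable (g n) ν :=
    hint.mono (hgm n).aestronglyMeasurable (Eventually.of_forall (hgf n))
  have hgsq (n : ℕ) (x : E) : g n x ^ 2 ≤ f x ^ 2 := sq_le_sq.2 (hgf n x)
  have hgint2 (n : ℕ) : Integrable (fun x => g n x ^ 2) ν :=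
    h2.mono' (by fun_prop) (Eventually.of_forall fun x => by
      rw [Real.norm_of_nonneg (sq_nonneg _)]; exact hgsq n x)
  set V := ∫ x, f x ^ 2 ∂ν with hVdef
  have hV0 : 0 ≤ V := integral_nonneg fun x => sq_nonneg _
  have hgV (n : ℕ) : ∫ x, g n x ^ 2 ∂ν ≤ V := integral_mono (hgint2 n) h2 (hgsq n)
  have hbound (n : ℕ) (hn : 0 < n) (h : E → ℝ) (hh : h = g n ∨ h = fun x => - g n x) :
      P {ω | n * ∫ x, h x ∂ν + n * δ ≤ ∫ x, h x ∂N n ω} ≤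
        ENNReal.ofReal (Real.exp (64 * V / δ ^ 2) * ((n : ℝ) ^ 2)⁻¹) := by
    have hl0 : 0 ≤ Real.log n := Real.log_natCast_nonneg n
    have hn' : (0 : ℝ) < n := Nat.cast_pos.2 hn
    have key : P.real {ω | n * ∫ x, h x ∂ν + n * δ ≤ ∫ x, h x ∂N n ω} ≤
        Real.exp (n * ((2 * Real.log n / (n * δ)) ^ 2 * V *
          Real.exp (2 * Real.log n / (n * δ) * (δ / 4 * n))) -
          2 * Real.log n / (n * δ) * (n * δ)) := by
      rcases hh with rfl | rfl
      · exact (hN n hn).measure_integral_ge_le (hgm n) (hgfin n) (hgM n) (hgint n) (hgint2 n)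
          (hgV n) (θ := 2 * Real.log n / (n * δ)) (by positivity) δ
      · exact (hN n hn).measure_integral_ge_le (hgm n).neg (by simpa using hgfin n)
          (by simpa using hgM n) (hgint n).neg (by simpa using hgint2 n) (by simpa using hgV n)
          (θ := 2 * Real.log n / (n * δ)) (by positivity) δ
    have h3 := key.trans (Real.exp_le_exp.2 (chernoff_exponent_le hn hV0 hδ))
    have h4 : Real.exp (64 * V / δ ^ 2 - 2 * Real.log n) =
        Real.exp (64 * V / δ ^ 2) * ((n : ℝ) ^ 2)⁻¹ := by
      rw [sub_eq_add_neg, Real.exp_add, Real.exp_neg]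
      congr 2
      rw [two_mul, Real.exp_add, Real.exp_log hn', sq]
    rw [h4] at h3
    rw [← ofReal_measureReal]
    exact ENNReal.ofReal_le_ofReal h3
  have hsum : Summable fun n : ℕ => Real.exp (64 * V / δ ^ 2) * ((n : ℝ) ^ 2)⁻¹ :=
    (Real.summable_nat_pow_inv.2 one_lt_two).mul_left _
  -- Applied to the truncation and to its negative, for the upper and the lower deviations.
  have hbc (h : ℕ → E → ℝ) (hh : ∀ n, h n = g n ∨ h n = fun x => - g n x) :
      ∀ᵐ ω ∂P, ∀ᶠ n : ℕ in atTop,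
        ω ∉ {ω | 0 < n ∧ n * ∫ x, h n x ∂ν + n * δ ≤ ∫ x, h n x ∂N n ω} := by
    refine ae_eventually_notMem (ne_top_of_le_ne_top hsum.tsum_ofReal_ne_top
      (ENNReal.tsum_le_tsum fun n => ?_))
    rcases n.eq_zero_or_pos with rfl | hn
    · simp
    · simpa [hn] using hbound n hn (h n) (hh n)
  have hbc0 : ∀ᵐ ω ∂P, ∀ᶠ n : ℕ in atTop, ω ∉ {ω | 0 < n ∧ N n ω (A n) ≠ 0} := by
    refine ae_eventually_notMem (ne_top_of_le_ne_top
      (tsum_mul_measure_lt_abs_ne_top hf h2 (c := δ / 4) (by positivity))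
      (ENNReal.tsum_le_tsum fun n => ?_))
    rcases n.eq_zero_or_pos with rfl | hn
    · simp
    · simpa [hn] using (hN n hn).measure_apply_ne_zero_le (hAm n)
  have hlim : Tendsto (fun n => ∫ x, g n x ∂ν) atTop (𝓝 (∫ x, f x ∂ν)) := by
    refine tendsto_integral_of_dominated_convergence (fun x => |f x|)
      (fun n => (hgm n).aestronglyMeasurable) hint.abs
      (fun n => Eventually.of_forall (hgf n)) (Eventually.of_forall fun x => ?_)
    refine tendsto_const_nhds.congr' ?_
    have ht : Tendsto (fun n : ℕ => δ / 4 * (n : ℝ)) atTop atTop :=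
      tendsto_natCast_atTop_atTop.const_mul_atTop (by positivity)
    filter_upwards [ht.eventually_ge_atTop |f x|] with n hn
    have : x ∈ (A n)ᶜ := by simpa [hA] using hn
    simp [hg, this]
  have hlim' : ∀ᶠ n in atTop, |∫ x, g n x ∂ν - ∫ x, f x ∂ν| < δ := by
    have := Metric.tendsto_nhds.1 hlim δ hδ
    simpa [Real.dist_eq] using this
  filter_upwards [hbc g fun n => Or.inl rfl, hbc (fun n x => - g n x) fun n => Or.inr rfl, hbc0]
    with ω h₁ h₂ h₃
  filter_upwards [h₁, h₂, h₃, hlim', eventually_gt_atTop 0] with n k₁ k₂ k₃ k₄ hn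
  have hn' : (0 : ℝ) < n := Nat.cast_pos.2 hn
  simp only [hn, true_and, not_le, ne_eq, not_not, integral_neg] at k₁ k₂ k₃
  -- With no point in `A n`, truncation changes nothing on the realized process.
  have heq : ∫ x, f x ∂N n ω = ∫ x, g n x ∂N n ω := by
    refine integral_congr_ae ?_
    filter_upwards [measure_eq_zero_iff_ae_notMem.1 k₃] with x hx
    simp [hg, hx]
  rw [heq]
  have k₅ : |(n : ℝ)⁻¹ * ∫ x, g n x ∂N n ω - ∫ x, g n x ∂ν| < δ := by
    have : (n : ℝ)⁻¹ * ∫ x, g n x ∂N n ω - ∫ x, g n x ∂ν =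
        (n : ℝ)⁻¹ * (∫ x, g n x ∂N n ω - n * ∫ x, g n x ∂ν) := by field_simp
    rw [this, abs_mul, abs_of_pos (inv_pos.2 hn'), inv_mul_lt_iff₀ hn', abs_lt]
    constructor <;> linarith
  have := abs_sub_le ((n : ℝ)⁻¹ * ∫ x, g n x ∂N n ω) (∫ x, g n x ∂ν) (∫ x, f x ∂ν)
  linarith

/-- **Strong law of large numbers** for Poisson processes of intensity `n ν`, with an arbitrary
joint law. -/
theorem ae_tendsto_integral [IsProbabilityMeasure P]
    (hN : ∀ n : ℕ, 0 < n → IsPoissonProcess (N n) ((n : ℝ≥0∞) • ν) P) {f : E → ℝ}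
    (hf : Measurable f) (hfin : ν {x | f x ≠ 0} < ∞) (hint : Integrable f ν)
    (h2 : Integrable (fun x => f x ^ 2) ν) :
    ∀ᵐ ω ∂P, Tendsto (fun n : ℕ => (n : ℝ)⁻¹ * ∫ x, f x ∂N n ω) atTop (𝓝 (∫ x, f x ∂ν)) := by
  -- Countably many tolerances 1/(k + 1) suffice, so the exceptional sets can be united.
  have h := fun k : ℕ => ae_eventually_abs_sub_lt hN hf hfin hint h2
    (δ := 1 / ((k : ℝ) + 1)) (by positivity)
  filter_upwards [ae_all_iff.2 h] with ω hω
  refine Metric.tendsto_nhds.2 fun r hr => ?_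
  obtain ⟨k, hk⟩ := exists_nat_one_div_lt (half_pos hr)
  filter_upwards [hω k] with n hn
  rw [Real.dist_eq]
  linarith

end Multitime.IsPoissonProcess

/-! ### Height functions of rescaled and superposed processes -/

/-- On a support of finite measure L² embeds in L¹; `μ` itself may be infinite. -/
lemma MeasureTheory.MemLp.integrable_of_measure_ne_zero_lt_top {E : Type*} [MeasurableSpace E]
    {μ : Measure E} {f : E → ℝ} (hf : Measurable f) (h2 : MemLp f 2 μ)
    (hfin : μ {x | f x ≠ 0} < ∞) : Integrable f μ := by
  have hm : MeasurableSet {x | f x ≠ 0} := (measurableSet_eq_fun hf measurable_const).compl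
  have : f = {x | f x ≠ 0}.indicator f := by
    ext x; by_cases hx : f x = 0 <;> simp [Set.indicator, hx]
  rw [this, integrable_indicator_iff hm]
  have : IsFiniteMeasure (μ.restrict {x | f x ≠ 0}) := ⟨by simpa using hfin⟩
  exact (h2.restrict _).integrable one_le_two

namespace Multitime

lemma measure_stepHeight_ne_zero_lt_top {μ : Measure Pt} (hμ : μ ∈ admissible) (b : SpaceTime) :
    μ {p | stepHeight p b ≠ 0} < ∞ :=
  (measure_mono fun p (hp : stepHeight p b ≠ 0) =>
    by_contra fun h => hp (stepHeight_eq_zero_of_notMem h)).trans_lt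
    (measure_separating_lt_top hμ 0 b)

lemma integrable_stepHeight {μ : Measure Pt} (hμ : μ ∈ admissible) (b : SpaceTime) :
    Integrable (fun p => stepHeight p b) μ :=
  MemLp.integrable_of_measure_ne_zero_lt_top (by fun_prop)
    (memLp_stepHeight (.of_mem_admissible hμ) b) (measure_stepHeight_ne_zero_lt_top hμ b)

/-- The line of `p` is at position `p.1` at time 0, so the horizontal segments from (-n, 0) to (n,
0) meet all lines. This property is needed to form the product intensity with Lebesgue measure on
levels. -/
lemma sigmaFinite_of_mem_admissible {μ : Measure Pt} (hμ : μ ∈ admissible) : SigmaFinite μ := by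
  refine ⟨⟨⟨fun n : ℕ => crossing (-(n : ℝ), 0) ((n : ℝ), 0), fun _ => trivial,
    fun n => le_self_add.trans_lt (hμ _ _), ?_⟩⟩⟩
  refine Set.eq_univ_of_forall fun p => Set.mem_iUnion.2 ?_
  obtain ⟨n, hn⟩ := exists_nat_gt |p.1|
  have h := abs_le.1 hn.le
  have hn0 : (0 : ℝ) < n := (abs_nonneg _).trans_lt hn
  refine ⟨n, (p.1, 0), (mem_line_iff _ _).2 (by simp), (n - p.1) / (2 * n), (n + p.1) / (2 * n),
    div_nonneg (by linarith) (by linarith), div_nonneg (by linarith) (by linarith), ?_, ?_⟩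
  · field_simp; ring
  · ext
    · simp; field_simp; ring
    · simp

lemma height_rescaled {Ω : Type*} (N : ℝ → Ω → Measure Pt) {ε : ℝ} (hε : 0 ≤ ε) (ω : Ω)
    (b : SpaceTime) : height (rescaled N ε ω) b = ε * ∫ p, stepHeight p b ∂N ε ω := by
  rw [height, rescaled, integral_smul_measure, ENNReal.toReal_ofReal hε, smul_eq_mul]

theorem ae_tendsto_height {Ω : Type*} [MeasurableSpace Ω] {P : Measure Ω} [IsProbabilityMeasure P]
    {μ : Measure Pt} (hμ : μ ∈ admissible) {N : ℝ → Ω → Measure Pt}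
    (hN : ∀ ε : ℝ, 0 < ε → IsPoissonProcess (N ε) (ENNReal.ofReal ε⁻¹ • μ) P) (b : SpaceTime) :
    ∀ᵐ ω ∂P, Tendsto (fun n : ℕ => height (rescaled N (n : ℝ)⁻¹ ω) b) atTop
      (𝓝 (height μ b)) := by
  simp_rw [fun (n : ℕ) ω => height_rescaled N (inv_nonneg.2 (Nat.cast_nonneg' (α := ℝ) n)) ω b]
  refine IsPoissonProcess.ae_tendsto_integral (fun n hn => ?_) (by fun_prop)
    (measure_stepHeight_ne_zero_lt_top hμ b) (integrable_stepHeight hμ b)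
    (memLp_stepHeight (.of_mem_admissible hμ) b).integrable_sq
  have := hN (n : ℝ)⁻¹ (by positivity)
  rwa [inv_inv, ENNReal.ofReal_natCast] at this

/-! ### The superposition coupling -/

lemma IsPointMeasure.restrict {E : Type*} [MeasurableSpace E] {ν : Measure E}
    (h : IsPointMeasure ν) {S : Set E} (hS : MeasurableSet S) : IsPointMeasure (ν.restrict S) := by
  obtain ⟨ι, hι, x, rfl⟩ := h
  refine ⟨{i // x i ∈ S}, inferInstance, fun i => x i, ?_⟩
  ext A hA
  rw [Measure.restrict_apply hA, Measure.sum_apply _ (hA.inter hS), Measure.sum_apply _ hA]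
  refine Eq.trans (tsum_congr fun i => ?_)
    (tsum_subtype {i | x i ∈ S} fun i => Measure.dirac (x i) A).symm
  by_cases h1 : x i ∈ S <;> by_cases h2 : x i ∈ A <;>
    simp [h1, h2, Measure.dirac_apply' _ (hA.inter hS), Measure.dirac_apply' _ hA]

lemma IsPointMeasure.map {E F : Type*} [MeasurableSpace E] [MeasurableSpace F] {ν : Measure E}
    (h : IsPointMeasure ν) {f : E → F} (hf : Measurable f) : IsPointMeasure (ν.map f) := by
  obtain ⟨ι, hι, x, rfl⟩ := h
  refine ⟨ι, hι, fun i => f (x i), ?_⟩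
  rw [Measure.map_sum hf.aemeasurable]
  congr 1; ext i : 1
  exact Measure.map_dirac' hf _

lemma superposed_apply {Ω : Type*} (M : Ω → Measure (Pt × ℝ)) (ε : ℝ) (ω : Ω) {A : Set Pt}
    (hA : MeasurableSet A) : superposed M ε ω A = M ω (A ×ˢ Set.Iic ε⁻¹) := by
  rw [superposed, Measure.map_apply measurable_fst hA,
    Measure.restrict_apply (measurable_fst hA)]
  congr 1

lemma superposed_mono {Ω : Type*} (M : Ω → Measure (Pt × ℝ)) {ε δ : ℝ} (h : ε⁻¹ ≤ δ⁻¹) (ω : Ω) :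
    superposed M ε ω ≤ superposed M δ ω := by
  refine Measure.le_iff.2 fun A hA => ?_
  rw [superposed_apply M _ _ hA, superposed_apply M _ _ hA]
  exact measure_mono (Set.prod_mono le_rfl (Set.Iic_subset_Iic.2 h))

section Superposed

variable {Ω : Type*} [MeasurableSpace Ω] {P : Measure Ω} {μ : Measure Pt}
  {M : Ω → Measure (Pt × ℝ)}

lemma prod_restrict_Ioi_apply [SFinite μ] (A : Set Pt) (T : ℝ) :
    μ.prod (volume.restrict (Set.Ioi (0 : ℝ))) (A ×ˢ Set.Iic T) = ENNReal.ofReal T * μ A := by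
  rw [Measure.prod_prod, Measure.restrict_apply measurableSet_Iic, Set.inter_comm,
    Set.Ioi_inter_Iic, Real.volume_Ioc, sub_zero, mul_comm]

/-- Counts of the projected points in `A` are counts in the strip over `A` up to the level ε⁻¹, and
strips over disjoint sets are disjoint. For ε ≤ 0 both intensities vanish. -/
theorem isPoissonProcess_superposed [SFinite μ]
    (hM : IsPoissonProcess M (μ.prod (volume.restrict (Set.Ioi (0 : ℝ)))) P) (ε : ℝ) :
    IsPoissonProcess (superposed M ε) (ENNReal.ofReal ε⁻¹ • μ) P where
  measurable := by
    refine Measure.measurable_of_measurable_coe _ fun A hA => ?_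
    simp_rw [superposed_apply M ε _ hA]
    exact (Measure.measurable_coe (hA.prod measurableSet_Iic)).comp hM.measurable
  isPointMeasure ω :=
    ((hM.isPointMeasure ω).restrict (measurableSet_le measurable_snd measurable_const)).map
      measurable_fst
  hasLaw A hA hA' := by
    have h := hM.hasLaw (A ×ˢ Set.Iic ε⁻¹) (hA.prod measurableSet_Iic)
      (by rwa [prod_restrict_Ioi_apply])
    rw [prod_restrict_Ioi_apply] at h
    simp_rw [superposed_apply M ε _ hA]
    exact h
  indep n A hA hd := by
    simp_rw [fun ω i => superposed_apply M ε ω (hA i)]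
    exact hM.indep n (fun i => A i ×ˢ Set.Iic ε⁻¹) (fun i => (hA i).prod measurableSet_Iic)
      fun i j hij => Set.Disjoint.set_prod_left (hd hij) _ _

/-- For f ≥ 0 the integral is nondecreasing in 1/ε, hence lies between its values at n = ⌊1/ε⌋ and n
+ 1. The law of large numbers along integers applies to both, and εn and ε(n + 1) tend to 1. -/
lemma ae_tendsto_integral_superposed_of_nonneg [IsProbabilityMeasure P] [SFinite μ]
    (hM : IsPoissonProcess M (μ.prod (volume.restrict (Set.Ioi (0 : ℝ)))) P) {f : Pt → ℝ}
    (hf : Measurable f) (h0 : 0 ≤ f) (hfin : μ {x | f x ≠ 0} < ∞) (hint : Integrable f μ)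
    (h2 : Integrable (fun x => f x ^ 2) μ) :
    ∀ᵐ ω ∂P, (∀ ε : ℝ, Integrable f (superposed M ε ω)) ∧
      Tendsto (fun ε : ℝ => ε * ∫ x, f x ∂superposed M ε ω) (𝓝[>] 0) (𝓝 (∫ x, f x ∂μ)) := by
  have hN (n : ℕ) : IsPoissonProcess (superposed M (n : ℝ)⁻¹) ((n : ℝ≥0∞) • μ) P := by
    have := isPoissonProcess_superposed hM (n : ℝ)⁻¹
    rwa [inv_inv, ENNReal.ofReal_natCast] at this
  have hint' : ∀ᵐ ω ∂P, ∀ n : ℕ, Integrable f (superposed M (n : ℝ)⁻¹ ω) := by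
    refine ae_all_iff.2 fun n => (hN n).ae_integrable hf ?_ (hint.smul_measure (by simp))
    rw [Measure.smul_apply, smul_eq_mul]
    exact ENNReal.mul_lt_top (ENNReal.natCast_lt_top n) hfin
  filter_upwards [hint', IsPoissonProcess.ae_tendsto_integral (fun n _ => hN n) hf hfin hint h2]
    with ω hω hlim
  have hI (ε : ℝ) : Integrable f (superposed M ε ω) := by
    obtain ⟨n, hn⟩ := exists_nat_ge ε⁻¹
    exact (hω n).mono_measure (superposed_mono M (by rwa [inv_inv]) ω)
  refine ⟨hI, ?_⟩
  have hfl : Tendsto (fun ε : ℝ => ⌊ε⁻¹⌋₊) (𝓝[>] 0) atTop :=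
    tendsto_nat_floor_atTop.comp tendsto_inv_nhdsGT_zero
  have hid : Tendsto (fun ε : ℝ => ε) (𝓝[>] 0) (𝓝 0) :=
    tendsto_nhdsWithin_of_tendsto_nhds tendsto_id
  have hlow : Tendsto (fun ε : ℝ => ε * ⌊ε⁻¹⌋₊) (𝓝[>] 0) (𝓝 1) := by
    refine tendsto_of_tendsto_of_tendsto_of_le_of_le' (g := fun ε : ℝ => 1 - ε) (h := fun _ => 1)
      (by simpa using hid.const_sub 1) tendsto_const_nhds ?_ ?_
    all_goals
      filter_upwards [self_mem_nhdsWithin] with ε (hε : 0 < ε)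
    · have := Nat.lt_floor_add_one ε⁻¹
      have h1 : ε * ε⁻¹ = 1 := mul_inv_cancel₀ hε.ne'
      nlinarith
    · have := Nat.floor_le (inv_nonneg.2 hε.le)
      have h1 : ε * ε⁻¹ = 1 := mul_inv_cancel₀ hε.ne'
      nlinarith
  have hup : Tendsto (fun ε : ℝ => ε * ((⌊ε⁻¹⌋₊ + 1 : ℕ) : ℝ)) (𝓝[>] 0) (𝓝 1) := by
    have := hlow.add hid
    rw [add_zero] at this
    refine this.congr fun ε => ?_
    push_cast; ring
  have hl := hlow.mul (hlim.comp hfl)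
  have hu := hup.mul ((hlim.comp (tendsto_add_atTop_nat 1)).comp hfl)
  rw [one_mul] at hl hu
  refine tendsto_of_tendsto_of_tendsto_of_le_of_le' hl hu ?_ ?_
  all_goals
    filter_upwards [self_mem_nhdsWithin, hfl.eventually_gt_atTop 0] with ε (hε : 0 < ε) hk
    simp only [Function.comp_apply]
  · have hk' : ((⌊ε⁻¹⌋₊ : ℕ) : ℝ) ≠ 0 := by exact_mod_cast hk.ne'
    rw [mul_assoc, mul_inv_cancel_left₀ hk']
    refine mul_le_mul_of_nonneg_left ?_ hε.le
    refine integral_mono_measure (superposed_mono M ?_ ω) (Eventually.of_forall h0) (hI ε)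
    rw [inv_inv]
    exact Nat.floor_le (inv_nonneg.2 hε.le)
  · have hk' : ((⌊ε⁻¹⌋₊ + 1 : ℕ) : ℝ) ≠ 0 := by positivity
    rw [mul_assoc, mul_inv_cancel_left₀ hk']
    refine mul_le_mul_of_nonneg_left ?_ hε.le
    refine integral_mono_measure (superposed_mono M ?_ ω) (Eventually.of_forall h0) (hI _)
    rw [inv_inv]
    push_cast
    exact (Nat.lt_floor_add_one _).le

theorem ae_tendsto_height_superposed [IsProbabilityMeasure P] (hμ : μ ∈ admissible)
    (hM : IsPoissonProcess M (μ.prod (volume.restrict (Set.Ioi (0 : ℝ)))) P) (b : SpaceTime) :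
    ∀ᵐ ω ∂P, Tendsto (fun ε : ℝ => height (rescaled (superposed M) ε ω) b) (𝓝[>] 0)
      (𝓝 (height μ b)) := by
  have := sigmaFinite_of_mem_admissible hμ
  -- The monotone sandwich requires a sign; s = 1 and s = -1 give the positive and negative parts of
  -- the height.
  have hmain (s : ℝ) := ae_tendsto_integral_superposed_of_nonneg hM
    (f := fun p => max (s * stepHeight p b) 0) (by fun_prop) (fun p => le_max_right _ _)
    ((measure_mono fun p (hp : _ ≠ _) (h : stepHeight p b = 0) => hp (by simp [h])).trans_lt
      (measure_stepHeight_ne_zero_lt_top hμ b))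
    (((integrable_stepHeight hμ b).const_mul s).pos_part)
    ((((memLp_stepHeight (.of_mem_admissible hμ) b).const_mul s).pos_part).integrable_sq)
  have hdec (p : Pt) : stepHeight p b =
      max (1 * stepHeight p b) 0 - max (-1 * stepHeight p b) 0 := by
    rcases le_total (stepHeight p b) 0 with h | h
    · rw [max_eq_right (by linarith), max_eq_left (by linarith)]; ring
    · rw [max_eq_left (by linarith), max_eq_right (by linarith)]; ring
  filter_upwards [hmain 1, hmain (-1)] with ω h1 h2
  have hlim := h1.2.sub h2.2
  rw [← integral_sub (((integrable_stepHeight hμ b).const_mul _).pos_part)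
    (((integrable_stepHeight hμ b).const_mul _).pos_part)] at hlim
  simp_rw [← hdec] at hlim
  refine hlim.congr' ?_
  filter_upwards [self_mem_nhdsWithin] with ε (hε : 0 < ε)
  rw [height_rescaled _ hε.le, ← mul_sub, ← integral_sub (h1.1 ε) (h2.1 ε)]
  simp_rw [← hdec]

end Superposed

end Multitime

/-! ### Isonormal Gaussian processes and Lévy-Chentsov fields -/

lemma Complex.norm_exp_I_mul_sub_le (a b : ℝ) :
    ‖Complex.exp (Complex.I * a) - Complex.exp (Complex.I * b)‖ ≤ |a - b| := by
  have : Complex.exp (Complex.I * a) - Complex.exp (Complex.I * b) =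
      Complex.exp (Complex.I * b) * (Complex.exp (Complex.I * ((a - b : ℝ) : ℂ)) - 1) := by
    rw [mul_sub, ← Complex.exp_add, mul_one]
    push_cast
    ring_nf
  rw [this, norm_mul, Complex.norm_exp_I_mul_ofReal, one_mul]
  exact Real.norm_exp_I_mul_ofReal_sub_one_le

namespace ProbabilityTheory

/-- The map is 1-Lipschitz because u ↦ e^{iu} is and the L¹ norm is at most the L² norm. This allows
the characteristic functional to be computed on a dense set of finite sums. -/
lemma continuous_integral_cexp_Lp {Ω : Type*} [MeasurableSpace Ω] (Q : Measure Ω)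
    [IsProbabilityMeasure Q] :
    Continuous fun f : Lp ℝ 2 Q => ∫ ω, Complex.exp (Complex.I * f ω) ∂Q := by
  refine (LipschitzWith.of_dist_le_mul (K := 1) fun f g => ?_).continuous
  have hi (f : Lp ℝ 2 Q) : Integrable (fun ω => Complex.exp (Complex.I * f ω)) Q := by
    refine Integrable.of_bound ?_ 1 (Eventually.of_forall fun ω => ?_)
    · have := (Lp.stronglyMeasurable f).measurable
      exact Measurable.aestronglyMeasurable (by fun_prop)
    · rw [Complex.norm_exp_I_mul_ofReal]
  have h2 : MemLp (fun ω => f ω - g ω) 2 Q := (Lp.memLp f).sub (Lp.memLp g)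
  rw [dist_eq_norm, ← integral_sub (hi f) (hi g), NNReal.coe_one, one_mul, dist_eq_norm]
  calc ‖∫ ω, (Complex.exp (Complex.I * f ω) - Complex.exp (Complex.I * g ω)) ∂Q‖
    _ ≤ ∫ ω, ‖f ω - g ω‖ ∂Q := by
      refine (norm_integral_le_integral_norm _).trans
        (integral_mono ((hi f).sub (hi g)).norm (h2.integrable one_le_two).norm fun ω => ?_)
      exact Complex.norm_exp_I_mul_sub_le _ _
    _ = (eLpNorm (fun ω => f ω - g ω) 1 Q).toReal := by
      rw [eLpNorm_one_eq_lintegral_enorm, integral_norm_eq_lintegral_enorm h2.aestronglyMeasurable]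
    _ ≤ (eLpNorm (fun ω => f ω - g ω) 2 Q).toReal :=
      ENNReal.toReal_mono h2.eLpNorm_ne_top
        (eLpNorm_le_eLpNorm_of_exponent_le one_le_two h2.aestronglyMeasurable)
    _ = ‖f - g‖ := by
      rw [Lp.norm_def, eLpNorm_congr_ae (Lp.coeFn_sub f g)]
      rfl

lemma integral_cexp_gaussianReal (c : ℝ) :
    ∫ x, Complex.exp (Complex.I * (c * x : ℝ)) ∂gaussianReal 0 1 =
      Complex.exp (-(c ^ 2 : ℝ) / 2) := by
  have := charFun_gaussianReal (μ := 0) (v := 1) c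
  rw [charFun_apply_real] at this
  simp only [Complex.ofReal_mul, mul_comm Complex.I]
  rw [this]
  congr 1
  push_cast
  ring

/-- Every real Hilbert space embeds isometrically into a space of centered Gaussian variables. -/
theorem exists_isonormal (H : Type) [NormedAddCommGroup H] [InnerProductSpace ℝ H]
    [CompleteSpace H] :
    ∃ (Ω : Type) (_ : MeasurableSpace Ω) (Q : Measure Ω) (_ : IsProbabilityMeasure Q)
      (W : H →ₗᵢ[ℝ] Lp ℝ 2 Q), ∀ h : H, Q.map (W h) = gaussianReal 0 (‖h‖ ^ 2).toNNReal := by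
  classical
  -- A Hilbert basis is sent to independent standard Gaussian coordinates, which are orthonormal in
  -- L².
  obtain ⟨w, b, -⟩ := exists_hilbertBasis ℝ H
  set Q : Measure (w → ℝ) := Measure.infinitePi fun _ => gaussianReal 0 1 with hQ
  have hmp (i : w) : MeasurePreserving (fun ω : w → ℝ => ω i) Q (gaussianReal 0 1) :=
    measurePreserving_eval_infinitePi _ i
  have hξ (i : w) : MemLp (fun ω : w → ℝ => ω i) 2 Q :=
    (memLp_id_gaussianReal 2).comp_measurePreserving (hmp i)
  have hind : iIndepFun (fun (i : w) (ω : w → ℝ) => ω i) Q :=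
    iIndepFun_infinitePi (X := fun _ x => x) (by fun_prop)
  set e : w → Lp ℝ 2 Q := fun i => (hξ i).toLp _ with he
  have hcoe (i : w) : e i =ᵐ[Q] fun ω => ω i := MemLp.coeFn_toLp _
  have hmean (i : w) : ∫ ω, ω i ∂Q = 0 := by
    have := integral_map (μ := Q) (hmp i).measurable.aemeasurable (f := fun x : ℝ => x)
      (by fun_prop)
    rw [← this, (hmp i).map_eq, integral_id_gaussianReal]
  have hsq (i : w) : ∫ ω, ω i * ω i ∂Q = 1 := by
    have := integral_map (μ := Q) (hmp i).measurable.aemeasurable (f := fun x : ℝ => x * x)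
      (by fun_prop)
    rw [← this, (hmp i).map_eq]
    have hv := variance_id_gaussianReal (μ := 0) (v := 1)
    rw [variance_eq_integral aemeasurable_id] at hv
    simpa [sq] using hv
  have horth : Orthonormal ℝ e := by
    rw [orthonormal_iff_ite]
    intro i j
    have : inner ℝ (e i) (e j) = ∫ ω, ω i * ω j ∂Q := by
      rw [L2.inner_def]
      refine integral_congr_ae ?_
      filter_upwards [hcoe i, hcoe j] with ω h1 h2
      rw [h1, h2]
      simp [mul_comm]
    rw [this]
    split_ifs with hij
    · rw [← hij, hsq]
    · rw [(hind.indepFun hij).integral_fun_mul_eq_mul_integral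
        (measurable_pi_apply i).aestronglyMeasurable (measurable_pi_apply j).aestronglyMeasurable,
        hmean, zero_mul]
  have hV := horth.orthogonalFamily
  let W : H →ₗᵢ[ℝ] Lp ℝ 2 Q := hV.linearIsometry.comp b.repr.toLinearIsometry
  have hsum (s : Finset w) (c : w → ℝ) :
      ∫ ω, Complex.exp (Complex.I * (∑ i ∈ s, c i • e i : Lp ℝ 2 Q) ω) ∂Q =
        Complex.exp (-(‖∑ i ∈ s, c i • e i‖ ^ 2 : ℝ) / 2) := by
    have h1 : (∑ i ∈ s, c i • e i : Lp ℝ 2 Q) =ᵐ[Q] fun ω => ∑ i ∈ s, c i * ω i := by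
      refine (Lp.coeFn_finsetSum _ _).trans ?_
      have : ∀ᵐ ω ∂Q, ∀ i ∈ s, (c i • e i : Lp ℝ 2 Q) ω = c i * ω i := by
        refine (Finset.eventually_all s).2 fun i _ => ?_
        filter_upwards [Lp.coeFn_smul (c i) (e i), hcoe i] with ω h1 h2
        rw [h1, Pi.smul_apply, h2, smul_eq_mul]
      filter_upwards [this] with ω hω
      simp only [Finset.sum_apply]
      exact Finset.sum_congr rfl hω
    have h2 : ‖∑ i ∈ s, c i • e i‖ ^ 2 = ∑ i ∈ s, c i ^ 2 := by
      rw [← real_inner_self_eq_norm_sq, horth.inner_sum]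
      exact Finset.sum_congr rfl fun i _ => by simp [sq]
    have h3 : ∀ᵐ ω ∂Q, Complex.exp (Complex.I * (∑ i ∈ s, c i • e i : Lp ℝ 2 Q) ω) =
        ∏ i : s, Complex.exp (Complex.I * (c i * ω i : ℝ)) := by
      filter_upwards [h1] with ω hω
      rw [hω, ← Complex.exp_sum, ← Finset.mul_sum,
        Finset.sum_coe_sort s (fun i => ((c i * ω i : ℝ) : ℂ)), Complex.ofReal_sum]
    rw [integral_congr_ae h3, h2]
    have hind' : iIndepFun (fun (i : s) (ω : w → ℝ) => ω i) Q :=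
      hind.precomp Subtype.val_injective
    rw [hind'.integral_fun_prod_comp
      (f := fun (i : s) (x : ℝ) => Complex.exp (Complex.I * (c i * x : ℝ)))
      (fun i => (measurable_pi_apply _).aemeasurable)
      (fun i => Measurable.aestronglyMeasurable (by fun_prop))]
    have h4 (i : s) : ∫ ω, Complex.exp (Complex.I * (c i * ω i : ℝ)) ∂Q =
        Complex.exp (-(c i ^ 2 : ℝ) / 2) := by
      have := integral_map (μ := Q) (hmp i).measurable.aemeasurable
        (f := fun x : ℝ => Complex.exp (Complex.I * (c i * x : ℝ)))
        (Measurable.aestronglyMeasurable (by fun_prop))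
      rw [← this, (hmp i).map_eq, integral_cexp_gaussianReal]
    rw [Finset.prod_congr rfl fun i _ => h4 i, ← Complex.exp_sum,
      Finset.sum_coe_sort s (fun i => (-(c i ^ 2 : ℝ) / 2 : ℂ)), ← Finset.sum_div,
      Finset.sum_neg_distrib, Complex.ofReal_sum]
  have hchar (h : H) : ∫ ω, Complex.exp (Complex.I * W h ω) ∂Q =
      Complex.exp (-(‖W h‖ ^ 2 : ℝ) / 2) := by
    -- The Gaussian formula is a closed condition on L², and `W h` is the limit of the finite sums
    -- treated in `hsum`.
    have hclosed : IsClosed {f : Lp ℝ 2 Q | ∫ ω, Complex.exp (Complex.I * f ω) ∂Q =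
        Complex.exp (-(‖f‖ ^ 2 : ℝ) / 2)} :=
      isClosed_eq (continuous_integral_cexp_Lp Q) (by fun_prop)
    have hs : HasSum (fun i => b.repr h i • e i) (W h) := hV.hasSum_linearIsometry (b.repr h)
    exact hclosed.mem_of_tendsto hs (Eventually.of_forall fun s => hsum s _)
  refine ⟨w → ℝ, inferInstance, Q, inferInstance, W, fun h => ?_⟩
  have hm : AEMeasurable (W h) Q := (Lp.stronglyMeasurable _).measurable.aemeasurable
  have := Measure.isProbabilityMeasure_map hm
  refine Measure.ext_of_charFun ?_
  ext t
  rw [charFun_gaussianReal, charFun_apply_real, integral_map hm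
    (Measurable.aestronglyMeasurable (by fun_prop))]
  -- By linearity of `W`, the functional at t • h is the characteristic function of `W h` at t.
  have hsc := hchar (t • h)
  rw [LinearIsometry.norm_map, norm_smul] at hsc
  have hae : ∀ᵐ ω ∂Q, Complex.exp (t * W h ω * Complex.I) =
      Complex.exp (Complex.I * W (t • h) ω) := by
    rw [W.map_smul]
    filter_upwards [Lp.coeFn_smul t (W h)] with ω hω
    rw [hω]
    simp only [Pi.smul_apply, smul_eq_mul, Complex.ofReal_mul]
    ring_nf
  rw [integral_congr_ae hae, hsc]
  congr 1
  rw [mul_pow, Real.norm_eq_abs, sq_abs, Real.coe_toNNReal _ (sq_nonneg _)]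
  push_cast
  ring

end ProbabilityTheory

namespace Multitime

/-- A Lévy-Chentsov field, together with the characteristic functions of its finite dimensional
distributions. -/
theorem exists_isLevyChentsov {μ : Measure Pt} (hμ : FiniteSecondMoments μ) :
    ∃ (Ω : Type) (_ : MeasurableSpace Ω) (Q : Measure Ω) (_ : IsProbabilityMeasure Q)
      (η : SpaceTime → Ω → ℝ), IsLevyChentsov η (levyDist μ) Q ∧ (∀ a, Measurable (η a)) ∧
      ∀ (m : ℕ) (θ : Fin m → ℝ) (a : Fin m → SpaceTime),
        ∫ ω, Complex.exp (Complex.I * (∑ i, θ i * η (a i) ω : ℝ)) ∂Q =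
          Complex.exp (-(quadForm (levyDist μ) θ a : ℝ) / 2) := by
  obtain ⟨Ω, mΩ, Q, hQ, W, hW⟩ := exists_isonormal (Lp ℝ 2 μ)
  -- The field at `a` is the Gaussian variable attached to the step height at `a`, so its covariance
  -- is the L² inner product.
  set F : SpaceTime → Lp ℝ 2 μ := fun a => (memLp_stepHeight hμ a).toLp _ with hF
  have hFc (a : SpaceTime) : F a =ᵐ[μ] fun p => stepHeight p a := MemLp.coeFn_toLp _
  set η : SpaceTime → Ω → ℝ := fun a => W (F a) with hη
  have hηm (a : SpaceTime) : Measurable (η a) := (Lp.stronglyMeasurable _).measurable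
  have hη2 (a : SpaceTime) : MemLp (η a) 2 Q := Lp.memLp _
  have hinner (a b : SpaceTime) : inner ℝ (F a) (F b) =
      (levyDist μ 0 a + levyDist μ 0 b - levyDist μ a b) / 2 := by
    rw [← integral_stepHeight_mul hμ, L2.inner_def]
    refine integral_congr_ae ?_
    filter_upwards [hFc a, hFc b] with p h1 h2
    rw [h1, h2]
    simp [mul_comm]
  have hcomb {ι : Type} (s : Finset ι) (θ : ι → ℝ) (a : ι → SpaceTime) :
      W (∑ i ∈ s, θ i • F (a i)) =ᵐ[Q] fun ω => ∑ i ∈ s, θ i * η (a i) ω := by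
    rw [map_sum]
    refine (Lp.coeFn_finsetSum _ _).trans ?_
    have : ∀ᵐ ω ∂Q, ∀ i ∈ s, W (θ i • F (a i)) ω = θ i * η (a i) ω := by
      refine (Finset.eventually_all s).2 fun i _ => ?_
      rw [W.map_smul]
      filter_upwards [Lp.coeFn_smul (θ i) (W (F (a i)))] with ω h1
      rw [h1, Pi.smul_apply, smul_eq_mul]
    filter_upwards [this] with ω hω
    simp only [Finset.sum_apply]
    exact Finset.sum_congr rfl hω
  have hmean (a : SpaceTime) : ∫ ω, η a ω ∂Q = 0 := by
    have h := integral_map (μ := Q) (hηm a).aemeasurable (f := fun x : ℝ => x) (by fun_prop)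
    rw [← h, hW, integral_id_gaussianReal]
  refine ⟨Ω, mΩ, Q, hQ, η, ⟨⟨fun I => ⟨?_⟩⟩, hmean, fun a b => ?_⟩, hηm, fun m θ a => ?_⟩
  -- Each linear functional of a marginal is almost surely `W` of the same combination of step
  -- heights, hence Gaussian; this is where linearity of `W` gives joint Gaussianity.
  · refine isGaussian_of_map_eq_gaussianReal fun L => ?_
    have hL (x : I → ℝ) : L x = ∑ i, L (Pi.single i 1) * x i := by
      conv_lhs => rw [pi_eq_sum_univ' x, map_sum]
      refine Finset.sum_congr rfl fun i _ => ?_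
      rw [map_smul, smul_eq_mul, mul_comm]
    refine ⟨0, (‖∑ i : I, L (Pi.single i 1) • F i‖ ^ 2).toNNReal, ?_⟩
    rw [Measure.map_map (by fun_prop) (by fun_prop),
      ← hW (∑ i : I, L (Pi.single i 1) • F i)]
    refine Measure.map_congr ?_
    filter_upwards [hcomb Finset.univ (fun i : I => L (Pi.single i 1)) fun i => i] with ω hω
    rw [hω, Function.comp_apply, hL]
    rfl
  · rw [covariance_eq_sub (hη2 a) (hη2 b), hmean, hmean, zero_mul, sub_zero, ← hinner,
      ← W.inner_map_map, L2.inner_def]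
    refine integral_congr_ae (Eventually.of_forall fun ω => ?_)
    simp [hη, mul_comm]
  · have hae : ∀ᵐ ω ∂Q, Complex.exp (Complex.I * (∑ i, θ i * η (a i) ω : ℝ)) =
        Complex.exp (Complex.I * W (∑ i, θ i • F (a i)) ω) := by
      filter_upwards [hcomb Finset.univ θ a] with ω hω
      rw [hω]
    have hnorm : ‖∑ i, θ i • F (a i)‖ ^ 2 = quadForm (levyDist μ) θ a := by
      rw [← real_inner_self_eq_norm_sq, sum_inner, quadForm]
      refine Finset.sum_congr rfl fun i _ => ?_
      rw [inner_sum]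
      refine Finset.sum_congr rfl fun j _ => ?_
      rw [real_inner_smul_left, real_inner_smul_right, hinner, mul_assoc]
    have hm : AEMeasurable (W (∑ i, θ i • F (a i))) Q :=
      (Lp.stronglyMeasurable _).measurable.aemeasurable
    have hc := charFun_gaussianReal (μ := 0) (v := (‖∑ i, θ i • F (a i)‖ ^ 2).toNNReal) 1
    rw [← hW, charFun_apply_real, integral_map hm
      (Measurable.aestronglyMeasurable (by fun_prop))] at hc
    rw [integral_congr_ae hae]
    simp only [Complex.ofReal_one, one_mul, mul_comm _ Complex.I] at hc
    rw [hc, hnorm.symm, Real.coe_toNNReal _ (sq_nonneg _)]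
    congr 1
    push_cast
    ring

end Multitime

/-! ### Convergence in distribution from characteristic functions -/

lemma MeasureTheory.charFun_map_toLp {ι Ω : Type*} [Fintype ι] [MeasurableSpace Ω] (P : Measure Ω)
    {Y : Ω → ι → ℝ} (hY : Measurable Y) (t : EuclideanSpace ℝ ι) :
    charFun (P.map fun ω => WithLp.toLp 2 (Y ω)) t =
      ∫ ω, Complex.exp (Complex.I * (∑ i, t i * Y ω i : ℝ)) ∂P := by
  have hm : AEMeasurable (fun ω => (WithLp.toLp 2 (Y ω) : EuclideanSpace ℝ ι)) P := by fun_prop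
  rw [charFun_apply, integral_map hm
    (Measurable.aestronglyMeasurable (by fun_prop))]
  refine integral_congr_ae (Eventually.of_forall fun ω => ?_)
  simp only [PiLp.inner_apply, mul_comm Complex.I]
  simp

/-- Lévy's continuity theorem, applied in `EuclideanSpace` for the sake of its inner product and
transported back by a continuous map. Countable generation of the filter reduces to sequences. -/
lemma MeasureTheory.tendstoInDistribution_of_tendsto_integral_cexp {ι α Ω Ω' : Type*} [Fintype ι]
    [MeasurableSpace Ω] [MeasurableSpace Ω'] {P : Measure Ω} [IsProbabilityMeasure P]
    {Q : Measure Ω'} [IsProbabilityMeasure Q] {l : Filter α} [l.IsCountablyGenerated]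
    {X : α → Ω → ι → ℝ} (hX : ∀ k, Measurable (X k)) {Z : Ω' → ι → ℝ} (hZ : Measurable Z)
    (h : ∀ θ : ι → ℝ, Tendsto (fun k => ∫ ω, Complex.exp (Complex.I * (∑ i, θ i * X k ω i : ℝ)) ∂P)
      l (𝓝 (∫ ω, Complex.exp (Complex.I * (∑ i, θ i * Z ω i : ℝ)) ∂Q))) :
    TendstoInDistribution X l Z (fun _ => P) Q := by
  have hm : Measurable (WithLp.toLp 2 : (ι → ℝ) → EuclideanSpace ℝ ι) := by fun_prop
  have key : TendstoInDistribution (fun k ω => WithLp.toLp 2 (X k ω)) l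
      (fun ω => WithLp.toLp 2 (Z ω)) (fun _ => P) Q := by
    refine ⟨fun k => (hm.comp (hX k)).aemeasurable, (hm.comp hZ).aemeasurable, ?_⟩
    refine tendsto_of_seq_tendsto fun u hu => ?_
    refine ProbabilityMeasure.tendsto_of_tendsto_charFun fun t => ?_
    change Tendsto (fun n => charFun (P.map fun ω => WithLp.toLp 2 (X (u n) ω)) t) atTop
      (𝓝 (charFun (Q.map fun ω => WithLp.toLp 2 (Z ω)) t))
    rw [charFun_map_toLp Q hZ]
    simp_rw [fun n => charFun_map_toLp P (hX (u n)) t]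
    exact (h fun i => t i).comp hu
  exact key.continuous_comp (g := fun x : EuclideanSpace ℝ ι => WithLp.ofLp x) (by fun_prop)

/-! ### Taylor estimates for the characteristic exponent -/

namespace Multitime

/-- The Lévy-Khintchine integrand `e^{iu} - 1 - iu` of a compensated Poisson integral. -/
noncomputable def levyExponent (u : ℝ) : ℂ :=
  Complex.exp (Complex.I * u) - 1 - Complex.I * u

@[fun_prop]
lemma measurable_levyExponent : Measurable levyExponent := by
  unfold levyExponent; fun_prop

/-- Third-order Taylor for small u, crude quadratic bounds for large u. The minimum replaces the
third moment, which need not exist. -/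
lemma norm_levyExponent_add_le (u : ℝ) :
    ‖levyExponent u + (u ^ 2 : ℝ) / 2‖ ≤ 4 * u ^ 2 * min |u| 1 := by
  rcases le_or_gt |u| 1 with hu | hu
  · rw [min_eq_left hu]
    have h := Complex.norm_exp_sub_sum_le_norm_mul_exp (Complex.I * u) 3
    have h2 : Complex.exp (Complex.I * u) -
        ∑ m ∈ Finset.range 3, (Complex.I * u) ^ m / m.factorial =
        levyExponent u + (u ^ 2 : ℝ) / 2 := by
      simp only [Finset.sum_range_succ, Finset.range_zero, Finset.sum_empty, levyExponent,
        mul_pow, Complex.I_sq]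
      simp
      ring
    rw [h2, norm_mul, Complex.norm_I, one_mul, Complex.norm_real, Real.norm_eq_abs] at h
    have h3 : Real.exp |u| ≤ 4 :=
      (Real.exp_le_exp.2 hu).trans (by linarith [Real.exp_one_lt_d9])
    calc _ ≤ |u| ^ 3 * Real.exp |u| := h
      _ ≤ |u| ^ 3 * 4 := by gcongr
      _ = 4 * |u| ^ 2 * |u| := by ring
      _ = _ := by rw [sq_abs]
  · rw [min_eq_right hu.le]
    have h1 : ‖Complex.exp (Complex.I * u) - 1‖ ≤ |u| := Real.norm_exp_I_mul_ofReal_sub_one_le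
    have h2 : ‖Complex.I * u‖ = |u| := by simp
    have h3 : ‖((u ^ 2 : ℝ) : ℂ) / 2‖ = u ^ 2 / 2 := by
      rw [norm_div, Complex.norm_real, Real.norm_of_nonneg (sq_nonneg u)]; simp
    calc ‖levyExponent u + (u ^ 2 : ℝ) / 2‖
      _ ≤ |u| + |u| + u ^ 2 / 2 := by
        refine (norm_add_le _ _).trans (add_le_add ((norm_sub_le _ _).trans ?_) h3.le)
        rw [h2]
        linarith
      _ ≤ 4 * u ^ 2 * 1 := by nlinarith [sq_abs u]

lemma norm_levyExponent_le (u : ℝ) : ‖levyExponent u‖ ≤ 5 * u ^ 2 := by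
  have h1 := norm_levyExponent_add_le u
  have h3 : ‖((u ^ 2 : ℝ) : ℂ) / 2‖ = u ^ 2 / 2 := by
    rw [norm_div, Complex.norm_real, Real.norm_of_nonneg (sq_nonneg u)]; simp
  have h2 : ‖levyExponent u‖ ≤ ‖levyExponent u + (u ^ 2 : ℝ) / 2‖ + ‖((u ^ 2 : ℝ) : ℂ) / 2‖ := by
    have := norm_sub_le (levyExponent u + (u ^ 2 : ℝ) / 2) (((u ^ 2 : ℝ) : ℂ) / 2)
    rwa [add_sub_cancel_right] at this
  have h4 : 4 * u ^ 2 * min |u| 1 ≤ 4 * u ^ 2 * 1 := by gcongr; exact min_le_right _ _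
  nlinarith [sq_nonneg u]

/-- The failure of additivity is a product, so the interaction of two integrands is confined to
points where both are nonzero. -/
lemma levyExponent_add (a b : ℝ) : levyExponent (a + b) = levyExponent a + levyExponent b +
    (Complex.exp (Complex.I * a) - 1) * (Complex.exp (Complex.I * b) - 1) := by
  simp only [levyExponent, Complex.ofReal_add, mul_add, Complex.exp_add]
  ring

lemma integrable_levyExponent {E : Type*} [MeasurableSpace E] {μ : Measure E} {G : E → ℝ}
    (hG : Measurable G) (hG2 : Integrable (fun x => G x ^ 2) μ) :
    Integrable (fun x => levyExponent (G x)) μ :=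
  (hG2.const_mul 5).mono' (Measurable.aestronglyMeasurable (by fun_prop))
    (Eventually.of_forall fun x => norm_levyExponent_le _)

/-- Dominated convergence: the rescaled integrand is at most 5F² and converges pointwise to -F²/2.
-/
lemma tendsto_integral_levyExponent_mul {E : Type*} [MeasurableSpace E] {μ : Measure E}
    {F : E → ℝ} (hF : Measurable F) (hF2 : Integrable (fun x => F x ^ 2) μ) :
    Tendsto (fun ε : ℝ => ((ε ^ 2)⁻¹ : ℝ) * ∫ x, levyExponent (ε * F x) ∂μ) (𝓝[>] 0)
      (𝓝 (-(∫ x, F x ^ 2 ∂μ : ℝ) / 2)) := by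
  have h : -((∫ x, F x ^ 2 ∂μ : ℝ) : ℂ) / 2 = ∫ x, (-((F x ^ 2 : ℝ) : ℂ) / 2) ∂μ := by
    rw [integral_div, integral_neg, integral_complex_ofReal]
  rw [h]
  simp_rw [← integral_const_mul]
  refine tendsto_integral_filter_of_dominated_convergence (fun x => 5 * F x ^ 2)
    (Eventually.of_forall fun ε => Measurable.aestronglyMeasurable (by fun_prop)) ?_
    (hF2.const_mul 5) (Eventually.of_forall fun x => ?_)
  · filter_upwards [self_mem_nhdsWithin] with ε (hε : 0 < ε)
    refine Eventually.of_forall fun x => ?_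
    rw [norm_mul, Complex.norm_real, Real.norm_of_nonneg (by positivity),
      inv_mul_le_iff₀ (by positivity)]
    exact (norm_levyExponent_le _).trans_eq (by ring)
  · rw [tendsto_iff_norm_sub_tendsto_zero]
    have hlim : Tendsto (fun ε : ℝ => 4 * F x ^ 2 * (ε * |F x|)) (𝓝[>] 0) (𝓝 0) := by
      have : Tendsto (fun ε : ℝ => 4 * F x ^ 2 * (ε * |F x|)) (𝓝 0)
          (𝓝 (4 * F x ^ 2 * (0 * |F x|))) := by
        refine Continuous.tendsto ?_ 0
        fun_prop
      rw [zero_mul, mul_zero] at this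
      exact tendsto_nhdsWithin_of_tendsto_nhds this
    refine squeeze_zero' (Eventually.of_forall fun _ => norm_nonneg _) ?_ hlim
    filter_upwards [self_mem_nhdsWithin] with ε (hε : 0 < ε)
    have h1 : (((ε ^ 2)⁻¹ : ℝ) : ℂ) * levyExponent (ε * F x) - -((F x ^ 2 : ℝ) : ℂ) / 2 =
        ((ε ^ 2)⁻¹ : ℝ) * (levyExponent (ε * F x) + ((ε * F x) ^ 2 : ℝ) / 2) := by
      have : (ε : ℂ) ≠ 0 := by exact_mod_cast hε.ne'
      push_cast
      field_simp
      ring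
    rw [h1, norm_mul, Complex.norm_real, Real.norm_of_nonneg (by positivity),
      inv_mul_le_iff₀ (by positivity)]
    refine (norm_levyExponent_add_le _).trans ?_
    calc 4 * (ε * F x) ^ 2 * min |ε * F x| 1
      _ ≤ 4 * (ε * F x) ^ 2 * |ε * F x| := by gcongr; exact min_le_left _ _
      _ = ε ^ 2 * (4 * F x ^ 2 * (ε * |F x|)) := by rw [abs_mul, abs_of_pos hε]; ring

/-- The characteristic function of a compensated Poisson integral. -/
lemma IsPoissonProcess.integral_cexp_compensated {Ω E : Type*} [MeasurableSpace Ω]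
    [MeasurableSpace E] {N : Ω → Measure E} {ν : Measure E} {P : Measure Ω}
    [IsProbabilityMeasure P] (hN : IsPoissonProcess N ν P)
    {G : E → ℝ} (hG : Measurable G) (hfin : ν {x | G x ≠ 0} < ∞) (hint : Integrable G ν) :
    ∫ ω, Complex.exp (Complex.I * (∫ x, G x ∂N ω - ∫ x, G x ∂ν : ℝ)) ∂P =
      Complex.exp (∫ x, levyExponent (G x) ∂ν) := by
  have h1 (ω : Ω) : Complex.exp (Complex.I * (∫ x, G x ∂N ω - ∫ x, G x ∂ν : ℝ)) =
      Complex.exp (Complex.I * ∫ x, G x ∂N ω) * Complex.exp (-(Complex.I * ∫ x, G x ∂ν)) := by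
    rw [← Complex.exp_add]
    push_cast
    ring_nf
  have hi : Integrable (fun x => Complex.exp (Complex.I * G x) - 1) ν :=
    hint.abs.mono' (Measurable.aestronglyMeasurable (by fun_prop))
      (Eventually.of_forall fun x => Real.norm_exp_I_mul_ofReal_sub_one_le)
  have hi2 : Integrable (fun x => Complex.I * (G x : ℂ)) ν := hint.ofReal.const_mul _
  simp_rw [h1]
  rw [integral_mul_const, hN.integral_cexp_I_mul_integral hG hfin hint, ← Complex.exp_add]
  congr 1
  rw [← sub_eq_add_neg, ← integral_complex_ofReal, ← integral_const_mul,
    ← integral_sub hi hi2]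
  rfl

end Multitime

/-! ### Characteristic functions of the fluctuation fields -/

namespace Multitime

/-- A linear combination of step heights. -/
noncomputable def heightSum {ι : Type*} [Fintype ι] (θ : ι → ℝ) (a : ι → SpaceTime) (p : Pt) : ℝ :=
  ∑ i, θ i * stepHeight p (a i)

section HeightSum

variable {ι : Type*} [Fintype ι] (θ : ι → ℝ) (a : ι → SpaceTime)

@[fun_prop]
lemma measurable_heightSum : Measurable (heightSum θ a) := by
  unfold heightSum; fun_prop

lemma memLp_heightSum {μ : Measure Pt} (hμ : FiniteSecondMoments μ) :
    MemLp (heightSum θ a) 2 μ :=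
  memLp_finsetSum _ fun i _ => (memLp_stepHeight hμ (a i)).const_mul (θ i)

lemma heightSum_eq_zero {p : Pt} (hp : ∀ i, p ∉ separating 0 (a i)) : heightSum θ a p = 0 :=
  Finset.sum_eq_zero fun i _ => by rw [stepHeight_eq_zero_of_notMem (hp i), mul_zero]

lemma measure_heightSum_ne_zero_lt_top {μ : Measure Pt} (hμ : μ ∈ admissible) :
    μ {p | heightSum θ a p ≠ 0} < ∞ := by
  refine (measure_mono (t := ⋃ i, separating 0 (a i))
    fun p (hp : heightSum θ a p ≠ 0) => ?_).trans_lt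
    ((measure_iUnion_fintype_le _ _).trans_lt
      (ENNReal.sum_lt_top.2 fun i _ => measure_separating_lt_top hμ 0 (a i)))
  by_contra h
  simp only [Set.mem_iUnion, not_exists] at h
  exact hp (heightSum_eq_zero θ a h)

lemma abs_heightSum_le (p : Pt) : |heightSum θ a p| ≤ (∑ i, |θ i|) * |p.2.2| := by
  rw [Finset.sum_mul]
  refine (Finset.abs_sum_le_sum_abs _ _).trans (Finset.sum_le_sum fun i _ => ?_)
  rw [abs_mul, abs_stepHeight]
  gcongr
  exact Set.indicator_le_self' (fun _ _ => abs_nonneg _) _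

end HeightSum

lemma fluct_eq {Ω : Type*} {μ : Measure Pt} (N : ℝ → Ω → Measure Pt) {ε : ℝ} (hε : 0 < ε)
    (b : SpaceTime) (ω : Ω) :
    fluct μ N ε b ω = ε * (∫ p, stepHeight p b ∂N (ε ^ 2) ω -
      (ε ^ 2)⁻¹ * ∫ p, stepHeight p b ∂μ) := by
  rw [fluct, height_rescaled N (sq_nonneg ε), height]
  field_simp

lemma fluctHat_eq {Ω : Type*} {μ : Measure Pt} (N : ℝ → Ω → Measure Pt) {ε : ℝ} (hε : 0 < ε)
    (b : SpaceTime) (ω : Ω) :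
    fluctHat μ N ε b ω = √ε * (∫ p, stepHeight p (ε • b) ∂N (ε ^ 2) ω -
      (ε ^ 2)⁻¹ * ∫ p, stepHeight p (ε • b) ∂μ) := by
  have hs : 0 < √ε := Real.sqrt_pos.2 hε
  have h2 : √ε ^ 2 = ε := Real.sq_sqrt hε.le
  rw [fluctHat, height_rescaled N (sq_nonneg ε), height]
  have : (√ε)⁻¹ * ε⁻¹ = √ε * (ε ^ 2)⁻¹ := by
    field_simp
    rw [h2]
  rw [this]
  field_simp

section CharacteristicFunction

variable {Ω : Type*} [MeasurableSpace Ω] {P : Measure Ω} {μ : Measure Pt} {N : ℝ → Ω → Measure Pt}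

lemma measurable_height_rescaled
    (hN : ∀ ε : ℝ, 0 < ε → IsPoissonProcess (N ε) (ENNReal.ofReal ε⁻¹ • μ) P) {ε : ℝ} (hε : 0 < ε)
    (b : SpaceTime) : Measurable fun ω => height (rescaled N ε ω) b := by
  simp_rw [height_rescaled N hε.le]
  exact (measurable_integral_measure (hN ε hε).measurable (by fun_prop)).const_mul _

lemma measurable_fluct
    (hN : ∀ ε : ℝ, 0 < ε → IsPoissonProcess (N ε) (ENNReal.ofReal ε⁻¹ • μ) P) {ε : ℝ} (hε : 0 < ε)
    (b : SpaceTime) : Measurable (fluct μ N ε b) :=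
  ((measurable_height_rescaled hN (pow_pos hε 2) b).sub_const _).const_mul _

lemma measurable_fluctHat
    (hN : ∀ ε : ℝ, 0 < ε → IsPoissonProcess (N ε) (ENNReal.ofReal ε⁻¹ • μ) P) {ε : ℝ} (hε : 0 < ε)
    (b : SpaceTime) : Measurable (fluctHat μ N ε b) :=
  ((measurable_height_rescaled hN (pow_pos hε 2) _).sub_const _).const_mul _

/-- Both fields are compensated integrals against the same process of intensity ε⁻²μ, so their
combination is the compensated integral of the single function `G`. -/
lemma integral_cexp_fluct_add_fluctHat [IsProbabilityMeasure P] (hμ : μ ∈ admissible)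
    (hN : ∀ ε : ℝ, 0 < ε → IsPoissonProcess (N ε) (ENNReal.ofReal ε⁻¹ • μ) P)
    {ι κ : Type*} [Fintype ι] [Fintype κ] (θ : ι → ℝ) (a : ι → SpaceTime) (τ : κ → ℝ)
    (b : κ → SpaceTime) {ε : ℝ} (hε : 0 < ε) :
    ∫ ω, Complex.exp (Complex.I * (∑ i, θ i * fluct μ N ε (a i) ω +
        ∑ j, τ j * fluctHat μ N ε (b j) ω : ℝ)) ∂P =
      Complex.exp (((ε ^ 2)⁻¹ : ℝ) * ∫ p, levyExponent (ε * heightSum θ a p +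
        √ε * heightSum τ (fun j => ε • b j) p) ∂μ) := by
  set G : Pt → ℝ := fun p => ε * heightSum θ a p + √ε * heightSum τ (fun j => ε • b j) p with hG
  have hP := hN (ε ^ 2) (by positivity)
  have hsm {f : Pt → ℝ} (hf : Integrable f μ) :
      Integrable f (ENNReal.ofReal (ε ^ 2)⁻¹ • μ) := hf.smul_measure (by simp)
  have hsf {A : Set Pt} (hA : μ A < ∞) : (ENNReal.ofReal (ε ^ 2)⁻¹ • μ) A < ∞ := by
    rw [Measure.smul_apply, smul_eq_mul]
    exact ENNReal.mul_lt_top ENNReal.ofReal_lt_top hA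
  have hGfin : μ {p | G p ≠ 0} < ∞ := by
    refine (measure_mono (t := {p | heightSum θ a p ≠ 0} ∪
      {p | heightSum τ (fun j => ε • b j) p ≠ 0}) fun p (hp : G p ≠ 0) => ?_).trans_lt
      ((measure_union_le _ _).trans_lt (ENNReal.add_lt_top.2
        ⟨measure_heightSum_ne_zero_lt_top θ a hμ, measure_heightSum_ne_zero_lt_top τ _ hμ⟩))
    by_contra h
    simp only [Set.mem_union, Set.mem_ofPred_eq, not_or, not_not] at h
    exact hp (by simp [hG, h.1, h.2])
  have hGint : Integrable G μ :=
    (((memLp_heightSum θ a (.of_mem_admissible hμ)).integrable_of_measure_ne_zero_lt_top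
      (by fun_prop) (measure_heightSum_ne_zero_lt_top θ a hμ)).const_mul ε).add
      (((memLp_heightSum τ _ (.of_mem_admissible hμ)).integrable_of_measure_ne_zero_lt_top
      (by fun_prop) (measure_heightSum_ne_zero_lt_top τ _ hμ)).const_mul √ε)
  have hlin {m : Measure Pt} (hm : ∀ i, Integrable (fun p => stepHeight p (a i)) m)
      (hm' : ∀ j, Integrable (fun p => stepHeight p (ε • b j)) m) :
      ∫ p, G p ∂m = ε * ∑ i, θ i * ∫ p, stepHeight p (a i) ∂m +
        √ε * ∑ j, τ j * ∫ p, stepHeight p (ε • b j) ∂m := by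
    have h1 : Integrable (heightSum θ a) m := integrable_finsetSum _ fun i _ => (hm i).const_mul _
    have h2 : Integrable (heightSum τ fun j => ε • b j) m :=
      integrable_finsetSum _ fun i _ => (hm' i).const_mul _
    rw [hG, integral_add (h1.const_mul _) (h2.const_mul _), integral_const_mul, integral_const_mul]
    unfold heightSum
    rw [integral_finsetSum _ fun i _ => (hm i).const_mul _,
      integral_finsetSum _ fun i _ => (hm' i).const_mul _]
    simp_rw [integral_const_mul]
  have key := hP.integral_cexp_compensated (G := G) (by fun_prop) (hsf hGfin) (hsm hGint)
  rw [integral_smul_measure (fun p => levyExponent (G p)), ENNReal.toReal_ofReal (by positivity),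
    Complex.real_smul] at key
  rw [← key]
  refine integral_congr_ae ?_
  have hi (c : SpaceTime) : ∀ᵐ ω ∂P, Integrable (fun p => stepHeight p c) (N (ε ^ 2) ω) :=
    hP.ae_integrable (by fun_prop) (hsf (measure_stepHeight_ne_zero_lt_top hμ c))
      (hsm (integrable_stepHeight hμ c))
  filter_upwards [ae_all_iff.2 fun i => hi (a i), ae_all_iff.2 fun j => hi (ε • b j)] with ω h1 h2
  congr 3
  rw [hlin h1 h2, integral_smul_measure, ENNReal.toReal_ofReal (by positivity), smul_eq_mul,
    hlin (fun i => integrable_stepHeight hμ _) (fun j => integrable_stepHeight hμ _)]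
  simp_rw [fluct_eq N hε, fluctHat_eq N hε, mul_sub, Finset.sum_sub_distrib, mul_add,
    Finset.mul_sum]
  simp only [mul_left_comm]
  ring

theorem tendsto_integral_cexp_fluct [IsProbabilityMeasure P] (hμ : μ ∈ admissible)
    (hN : ∀ ε : ℝ, 0 < ε → IsPoissonProcess (N ε) (ENNReal.ofReal ε⁻¹ • μ) P)
    {ι : Type*} [Fintype ι] (θ : ι → ℝ) (a : ι → SpaceTime) :
    Tendsto (fun ε : ℝ => ∫ ω, Complex.exp (Complex.I * (∑ i, θ i * fluct μ N ε (a i) ω : ℝ)) ∂P)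
      (𝓝[>] 0) (𝓝 (Complex.exp (-(quadForm (levyDist μ) θ a : ℝ) / 2))) := by
  have hμ2 := FiniteSecondMoments.of_mem_admissible hμ
  have h := tendsto_integral_levyExponent_mul (μ := μ) (F := heightSum θ a) (by fun_prop)
    (memLp_heightSum θ a hμ2).integrable_sq
  have hq : ∫ p, heightSum θ a p ^ 2 ∂μ = quadForm (levyDist μ) θ a :=
    integral_sum_stepHeight_sq hμ2 θ a
  rw [hq] at h
  refine ((Complex.continuous_exp.tendsto _).comp h).congr' ?_
  filter_upwards [self_mem_nhdsWithin] with ε (hε : 0 < ε)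
  -- The joint formula with an empty family of microscopic points.
  have key := integral_cexp_fluct_add_fluctHat hμ hN θ a (κ := Fin 0) 0 0 hε
  have h0 (c : Fin 0 → SpaceTime) (p : Pt) : heightSum (0 : Fin 0 → ℝ) c p = 0 := by
    simp [heightSum]
  simp only [h0, Finset.univ_eq_empty, Finset.sum_empty, add_zero, Pi.zero_apply, mul_zero] at key
  rw [key]
  rfl

end CharacteristicFunction

end Multitime

/-! ### Joint characteristic function of the two fluctuation fields -/

namespace Multitime

/-- Where the height sum is nonzero, some `c j` is separated from the origin, and the sum is at most
(Σ|τ j|)|r|. The majorant depends only on the mark and on these separating sets. -/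
lemma heightSum_sq_mul_min_le {κ : Type*} [Fintype κ] (τ : κ → ℝ) (c : κ → SpaceTime) (s : ℝ)
    (hs : 0 ≤ s) (p : Pt) :
    heightSum τ c p ^ 2 * min (s * |heightSum τ c p|) 1 ≤ (∑ j, |τ j|) ^ 2 *
      ∑ j, (separating 0 (c j)).indicator
        (fun p => p.2.2 ^ 2 * min (s * ((∑ j, |τ j|) * |p.2.2|)) 1) p := by
  set C := ∑ j, |τ j| with hC
  have hC0 : 0 ≤ C := Finset.sum_nonneg fun _ _ => abs_nonneg _
  have hnn (p : Pt) : 0 ≤ p.2.2 ^ 2 * min (s * (C * |p.2.2|)) 1 :=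
    mul_nonneg (sq_nonneg _) (le_min (by positivity) zero_le_one)
  by_cases h : ∀ j, p ∉ separating 0 (c j)
  · rw [heightSum_eq_zero τ c h]
    simp only [ne_eq, OfNat.ofNat_ne_zero, not_false_eq_true, zero_pow, zero_mul]
    exact mul_nonneg (sq_nonneg _) (Finset.sum_nonneg fun j _ => Set.indicator_nonneg
      (fun q _ => hnn q) _)
  · push Not at h
    obtain ⟨j, hj⟩ := h
    have h1 := abs_heightSum_le τ c p
    have h2 : heightSum τ c p ^ 2 ≤ C ^ 2 * p.2.2 ^ 2 := by
      rw [← sq_abs, ← sq_abs p.2.2, ← mul_pow]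
      gcongr
    calc heightSum τ c p ^ 2 * min (s * |heightSum τ c p|) 1
      _ ≤ C ^ 2 * p.2.2 ^ 2 * min (s * (C * |p.2.2|)) 1 := by
        refine mul_le_mul h2 (min_le_min_right _ ?_) (le_min (by positivity) zero_le_one)
          (by positivity)
        gcongr
      _ = C ^ 2 * (separating 0 (c j)).indicator
        (fun p => p.2.2 ^ 2 * min (s * (C * |p.2.2|)) 1) p := by
        rw [Set.indicator_of_mem hj, mul_assoc]
      _ ≤ _ := by
        refine mul_le_mul_of_nonneg_left ?_ (sq_nonneg _)
        exact Finset.single_le_sum (f := fun j => (separating 0 (c j)).indicator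
          (fun p => p.2.2 ^ 2 * min (s * (C * |p.2.2|)) 1) p)
          (fun j _ => Set.indicator_nonneg (fun q _ => hnn q) _) (Finset.mem_univ j)

/-- Only the second factor localizes the line; the first is bounded by a multiple of |r| everywhere.
-/
lemma abs_heightSum_mul_le {ι κ : Type*} [Fintype ι] [Fintype κ] (θ : ι → ℝ) (a : ι → SpaceTime)
    (τ : κ → ℝ) (c : κ → SpaceTime) (p : Pt) :
    |heightSum θ a p| * |heightSum τ c p| ≤ ((∑ i, |θ i|) * ∑ j, |τ j|) *
      ∑ j, (separating 0 (c j)).indicator (fun p => p.2.2 ^ 2 * 1) p := by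
  have hA : 0 ≤ ∑ i, |θ i| := Finset.sum_nonneg fun _ _ => abs_nonneg _
  have hC : 0 ≤ ∑ j, |τ j| := Finset.sum_nonneg fun _ _ => abs_nonneg _
  have hnn (j : κ) : 0 ≤ (separating 0 (c j)).indicator (fun p => p.2.2 ^ 2 * 1) p :=
    Set.indicator_nonneg (fun q _ => by positivity) _
  by_cases h : ∀ j, p ∉ separating 0 (c j)
  · rw [heightSum_eq_zero τ c h, abs_zero, mul_zero]
    exact mul_nonneg (mul_nonneg hA hC) (Finset.sum_nonneg fun j _ => hnn j)
  · push Not at h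
    obtain ⟨j, hj⟩ := h
    calc |heightSum θ a p| * |heightSum τ c p|
      _ ≤ ((∑ i, |θ i|) * |p.2.2|) * ((∑ j, |τ j|) * |p.2.2|) := by
        gcongr
        · exact abs_heightSum_le θ a p
        · exact abs_heightSum_le τ c p
      _ = ((∑ i, |θ i|) * ∑ j, |τ j|) *
          (separating 0 (c j)).indicator (fun p => p.2.2 ^ 2 * 1) p := by
        rw [Set.indicator_of_mem hj, ← sq_abs p.2.2]; ring
      _ ≤ _ := by
        refine mul_le_mul_of_nonneg_left ?_ (mul_nonneg hA hC)
        exact Finset.single_le_sum (fun j _ => hnn j) (Finset.mem_univ j)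

/-- An integral is small if its integrand is dominated on small crossing sets. -/
lemma enorm_integral_le_of_norm_le {κ : Type*} [Fintype κ] (μ : Measure Pt) {Φ : Pt → ℂ}
    {h : Pt → ℝ} (hm : Measurable h) (h0 : ∀ p, 0 ≤ h p) {K : ℝ} (hK : 0 ≤ K)
    (c : κ → SpaceTime)
    (hΦ : ∀ p, ‖Φ p‖ ≤ K * ∑ j, (separating 0 (c j)).indicator (fun p => p.2.2 ^ 2 * h p) p) :
    ‖∫ p, Φ p ∂μ‖ₑ ≤ ENNReal.ofReal K *
      ∑ j, ∫⁻ p in separating 0 (c j), ENNReal.ofReal (h p) ∂secondMoment μ := by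
  have hterm (j : κ) : ∫⁻ p in separating 0 (c j), ENNReal.ofReal (h p) ∂secondMoment μ =
      ∫⁻ p, ENNReal.ofReal ((separating 0 (c j)).indicator (fun p => p.2.2 ^ 2 * h p) p) ∂μ := by
    rw [secondMoment, setLIntegral_withDensity_eq_setLIntegral_mul _ (by fun_prop) (by fun_prop)
      (measurableSet_separating _ _), ← lintegral_indicator (measurableSet_separating _ _)]
    refine lintegral_congr fun p => ?_
    by_cases hp : p ∈ separating 0 (c j)
    · simp [hp, ENNReal.ofReal_mul (sq_nonneg p.2.2)]
    · simp [hp]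
  have hmeas (j : κ) : Measurable fun p =>
      ENNReal.ofReal ((separating 0 (c j)).indicator (fun p => p.2.2 ^ 2 * h p) p) :=
    ENNReal.measurable_ofReal.comp (Measurable.indicator (by fun_prop)
      (measurableSet_separating _ _))
  refine (enorm_integral_le_lintegral_enorm _).trans ?_
  simp_rw [hterm]
  rw [← lintegral_finsetSum _ fun j _ => hmeas j,
    ← lintegral_const_mul _ (Finset.measurable_fun_sum _ fun j _ => hmeas j)]
  refine lintegral_mono fun p => ?_
  have hnn (j : κ) : 0 ≤ (separating 0 (c j)).indicator (fun p => p.2.2 ^ 2 * h p) p :=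
    Set.indicator_nonneg (fun q _ => mul_nonneg (sq_nonneg _) (h0 q)) _
  rw [← ENNReal.ofReal_sum_of_nonneg fun j _ => hnn j, ← ENNReal.ofReal_mul hK,
    ← ofReal_norm]
  exact ENNReal.ofReal_le_ofReal (hΦ p)

/-- Convergence of the second moments around the origin, rescaled in space, to those of `μ'`,
together with a uniform integrability condition on the marks. -/
structure SecondMomentBlowup (μ μ' : Measure Pt) : Prop where
  finite : FiniteSecondMoments μ'
  tendsto : ∀ a b : SpaceTime,
    Tendsto (fun ε : ℝ => ENNReal.ofReal ε⁻¹ * secondMoment μ (separating (ε • a) (ε • b)))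
      (𝓝[>] 0) (𝓝 (secondMoment μ' (separating a b)))
  negligible : ∀ (b : SpaceTime) (C : ℝ), 0 ≤ C →
    Tendsto (fun ε : ℝ => ENNReal.ofReal ε⁻¹ * ∫⁻ p in separating 0 (ε • b),
      ENNReal.ofReal (min (√ε * (C * |p.2.2|)) 1) ∂secondMoment μ) (𝓝[>] 0) (𝓝 0)

/-! ### The microscopic and cross terms of the joint exponent. -/

namespace SecondMomentBlowup

variable {μ μ' : Measure Pt} {κ : Type*} [Fintype κ]

lemma tendsto_quadForm (h : SecondMomentBlowup μ μ') (τ : κ → ℝ) (b : κ → SpaceTime) :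
    Tendsto (fun ε : ℝ => ε⁻¹ * quadForm (levyDist μ) τ fun j => ε • b j) (𝓝[>] 0)
      (𝓝 (quadForm (levyDist μ') τ b)) := by
  have hd (x y : SpaceTime) : Tendsto (fun ε : ℝ => ε⁻¹ * levyDist μ (ε • x) (ε • y)) (𝓝[>] 0)
      (𝓝 (levyDist μ' x y)) := by
    refine ((ENNReal.tendsto_toReal (h.finite x y).ne).comp (h.tendsto x y)).congr' ?_
    filter_upwards [self_mem_nhdsWithin] with ε (hε : 0 < ε)
    rw [Function.comp_apply, ENNReal.toReal_mul, ENNReal.toReal_ofReal (by positivity)]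
    rfl
  have hsum : Tendsto (fun ε : ℝ => ∑ i, ∑ j, τ i * τ j *
      ((ε⁻¹ * levyDist μ (ε • 0) (ε • b i) + ε⁻¹ * levyDist μ (ε • 0) (ε • b j) -
        ε⁻¹ * levyDist μ (ε • b i) (ε • b j)) / 2)) (𝓝[>] 0)
      (𝓝 (quadForm (levyDist μ') τ b)) :=
    tendsto_finsetSum _ fun i _ => tendsto_finsetSum _ fun j _ =>
      ((((hd 0 (b i)).add (hd 0 (b j))).sub (hd (b i) (b j))).div_const 2).const_mul _
  refine hsum.congr fun ε => ?_
  simp_rw [quadForm, Finset.mul_sum, smul_zero]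
  refine Finset.sum_congr rfl fun i _ => Finset.sum_congr rfl fun j _ => by ring

/-- The quadratic part is -½ε⁻¹ times the quadratic form at the rescaled points, which converges by
`tendsto_quadForm`. The Taylor remainder `R` is controlled by `negligible`, a Lindeberg condition.
-/
lemma tendsto_micro (h : SecondMomentBlowup μ μ') (hμ : FiniteSecondMoments μ) (τ : κ → ℝ)
    (b : κ → SpaceTime) :
    Tendsto (fun ε : ℝ => ((ε ^ 2)⁻¹ : ℝ) *
      ∫ p, levyExponent (√ε * heightSum τ (fun j => ε • b j) p) ∂μ) (𝓝[>] 0)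
      (𝓝 (-(quadForm (levyDist μ') τ b : ℝ) / 2)) := by
  set C := ∑ j, |τ j| with hC
  have hC0 : 0 ≤ C := Finset.sum_nonneg fun _ _ => abs_nonneg _
  set F : ℝ → Pt → ℝ := fun ε => heightSum τ fun j => ε • b j with hF
  set R : ℝ → ℂ := fun ε => ∫ p, ((((ε ^ 2)⁻¹ : ℝ) : ℂ) *
    (levyExponent (√ε * F ε p) + ((√ε * F ε p) ^ 2 : ℝ) / 2)) ∂μ with hR
  have hRlim : Tendsto R (𝓝[>] 0) (𝓝 0) := by
    rw [tendsto_zero_iff_enorm_tendsto_zero]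
    have hlim : Tendsto (fun ε : ℝ => ENNReal.ofReal (4 * C ^ 2) * ∑ j, ENNReal.ofReal ε⁻¹ *
        ∫⁻ p in separating 0 (ε • b j), ENNReal.ofReal (min (√ε * (C * |p.2.2|)) 1)
          ∂secondMoment μ) (𝓝[>] 0) (𝓝 0) := by
      have := ENNReal.Tendsto.const_mul (a := ENNReal.ofReal (4 * C ^ 2))
        (tendsto_finsetSum Finset.univ fun j _ => h.negligible (b j) C hC0)
        (Or.inr ENNReal.ofReal_ne_top)
      simpa using this
    refine tendsto_of_tendsto_of_tendsto_of_le_of_le' tendsto_const_nhds hlim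
      (Eventually.of_forall fun _ => zero_le) ?_
    filter_upwards [self_mem_nhdsWithin] with ε (hε : 0 < ε)
    refine (enorm_integral_le_of_norm_le μ (h := fun p => min (√ε * (C * |p.2.2|)) 1)
      (K := 4 * C ^ 2 * ε⁻¹) (by fun_prop) (fun p => le_min (by positivity) zero_le_one)
      (by positivity) (fun j => ε • b j) fun p => ?_).trans_eq ?_
    · rw [norm_mul, Complex.norm_real, Real.norm_of_nonneg (by positivity)]
      have h1 := norm_levyExponent_add_le (√ε * F ε p)
      have h2 := heightSum_sq_mul_min_le τ (fun j => ε • b j) √ε (Real.sqrt_nonneg ε) p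
      rw [inv_mul_le_iff₀ (by positivity)]
      calc _ ≤ 4 * (√ε * F ε p) ^ 2 * min |√ε * F ε p| 1 := h1
        _ = 4 * ε * (F ε p ^ 2 * min (√ε * |F ε p|) 1) := by
          rw [abs_mul, abs_of_nonneg (Real.sqrt_nonneg ε), mul_pow, Real.sq_sqrt hε.le]; ring
        _ ≤ 4 * ε * (C ^ 2 * ∑ j, (separating 0 (ε • b j)).indicator
            (fun p => p.2.2 ^ 2 * min (√ε * (C * |p.2.2|)) 1) p) :=
          mul_le_mul_of_nonneg_left h2 (by positivity)
        _ = _ := by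
          have : ε ^ 2 * ε⁻¹ = ε := by field_simp
          linear_combination (-4 * C ^ 2 * ∑ j, (separating 0 (ε • b j)).indicator
            (fun p => p.2.2 ^ 2 * min (√ε * (C * |p.2.2|)) 1) p) * this
    · rw [ENNReal.ofReal_mul (by positivity), mul_assoc, ← Finset.mul_sum]
  have hmain : Tendsto
      (fun ε : ℝ => -((ε⁻¹ * quadForm (levyDist μ) τ fun j => ε • b j : ℝ) : ℂ) / 2)
      (𝓝[>] 0) (𝓝 (-(quadForm (levyDist μ') τ b : ℝ) / 2)) :=
    (((Complex.continuous_ofReal.tendsto _).comp (h.tendsto_quadForm τ b)).neg).div_const 2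
  have hsum := hmain.add hRlim
  rw [add_zero] at hsum
  refine hsum.congr' ?_
  filter_upwards [self_mem_nhdsWithin] with ε (hε : 0 < ε)
  have hF2 : Integrable (fun p => (√ε * F ε p) ^ 2) μ :=
    ((memLp_heightSum τ _ hμ).const_mul √ε).integrable_sq
  have hq : ∫ p, F ε p ^ 2 ∂μ = quadForm (levyDist μ) τ fun j => ε • b j :=
    integral_sum_stepHeight_sq hμ τ _
  have hi1 : Integrable (fun p => levyExponent (√ε * F ε p)) μ :=
    integrable_levyExponent (by fun_prop) hF2
  have hi2 : Integrable (fun p => (((√ε * F ε p) ^ 2 : ℝ) : ℂ) / 2) μ := hF2.ofReal.div_const 2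
  simp only [hR]
  rw [integral_const_mul, integral_add hi1 hi2, integral_div, integral_complex_ofReal]
  simp_rw [mul_pow, Real.sq_sqrt hε.le]
  rw [integral_const_mul, hq]
  have : (ε : ℂ) ≠ 0 := by exact_mod_cast hε.ne'
  push_cast
  field_simp
  ring

/-- The two factors are at most multiples of ε|r| and √ε|r|, and the product lives on lines crossing
segments of size ε, of μ₂-mass O(ε). Against ε⁻² this leaves order √ε. -/
lemma tendsto_cross (h : SecondMomentBlowup μ μ') {ι : Type*} [Fintype ι] (θ : ι → ℝ)
    (a : ι → SpaceTime) (τ : κ → ℝ) (b : κ → SpaceTime) :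
    Tendsto (fun ε : ℝ => ((ε ^ 2)⁻¹ : ℝ) *
      ∫ p, (Complex.exp (Complex.I * (ε * heightSum θ a p : ℝ)) - 1) *
        (Complex.exp (Complex.I * (√ε * heightSum τ (fun j => ε • b j) p : ℝ)) - 1) ∂μ)
      (𝓝[>] 0) (𝓝 0) := by
  set C := (∑ i, |θ i|) * ∑ j, |τ j| with hC
  have hC0 : 0 ≤ C := mul_nonneg (Finset.sum_nonneg fun _ _ => abs_nonneg _)
    (Finset.sum_nonneg fun _ _ => abs_nonneg _)
  simp_rw [← integral_const_mul]
  rw [tendsto_zero_iff_enorm_tendsto_zero]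
  have hlim : Tendsto (fun ε : ℝ => ENNReal.ofReal (C * √ε) * ∑ j, ENNReal.ofReal ε⁻¹ *
      secondMoment μ (separating (ε • 0) (ε • b j))) (𝓝[>] 0) (𝓝 0) := by
    have h1 : Tendsto (fun ε : ℝ => ENNReal.ofReal (C * √ε)) (𝓝[>] 0) (𝓝 0) := by
      have : Tendsto (fun ε : ℝ => ENNReal.ofReal (C * √ε)) (𝓝 0)
          (𝓝 (ENNReal.ofReal (C * √0))) :=
        (ENNReal.continuous_ofReal.comp (by fun_prop)).tendsto 0
      rw [Real.sqrt_zero, mul_zero, ENNReal.ofReal_zero] at this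
      exact tendsto_nhdsWithin_of_tendsto_nhds this
    have h2 := tendsto_finsetSum Finset.univ fun j _ => h.tendsto 0 (b j)
    have := ENNReal.Tendsto.mul h1
      (Or.inr (ENNReal.sum_ne_top.2 fun j _ => (h.finite 0 (b j)).ne)) h2
      (Or.inr ENNReal.zero_ne_top)
    rwa [zero_mul] at this
  refine tendsto_of_tendsto_of_tendsto_of_le_of_le' tendsto_const_nhds hlim
    (Eventually.of_forall fun _ => zero_le) ?_
  filter_upwards [self_mem_nhdsWithin] with ε (hε : 0 < ε)
  refine (enorm_integral_le_of_norm_le μ (h := fun _ => 1)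
    (K := C * √ε * ε⁻¹) (by fun_prop) (fun p => zero_le_one)
    (by positivity) (fun j => ε • b j) fun p => ?_).trans_eq ?_
  · rw [norm_mul, norm_mul, Complex.norm_real, Real.norm_of_nonneg (by positivity),
      inv_mul_le_iff₀ (by positivity)]
    have h2 := abs_heightSum_mul_le θ a τ (fun j => ε • b j) p
    calc _ ≤ |ε * heightSum θ a p| * |√ε * heightSum τ (fun j => ε • b j) p| := by
          gcongr <;> exact Real.norm_exp_I_mul_ofReal_sub_one_le
      _ = ε * √ε * (|heightSum θ a p| * |heightSum τ (fun j => ε • b j) p|) := by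
        rw [abs_mul, abs_mul, abs_of_pos hε, abs_of_nonneg (Real.sqrt_nonneg ε)]; ring
      _ ≤ ε * √ε * (C * ∑ j, (separating 0 (ε • b j)).indicator (fun p => p.2.2 ^ 2 * 1) p) :=
        mul_le_mul_of_nonneg_left h2 (by positivity)
      _ = _ := by
        have : ε ^ 2 * ε⁻¹ = ε := by field_simp
        linear_combination (-C * √ε * ∑ j, (separating 0 (ε • b j)).indicator
            (fun p => p.2.2 ^ 2 * 1) p) * this
  · simp only [ENNReal.ofReal_one, lintegral_const, one_mul, Measure.restrict_apply_univ, smul_zero]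
    rw [ENNReal.ofReal_mul (by positivity), mul_assoc, ← Finset.mul_sum]

theorem tendsto_integral_cexp_fluct_add_fluctHat {Ω : Type*} [MeasurableSpace Ω] {P : Measure Ω}
    [IsProbabilityMeasure P] {N : ℝ → Ω → Measure Pt} (h : SecondMomentBlowup μ μ')
    (hμ : μ ∈ admissible)
    (hN : ∀ ε : ℝ, 0 < ε → IsPoissonProcess (N ε) (ENNReal.ofReal ε⁻¹ • μ) P)
    {ι : Type*} [Fintype ι] (θ : ι → ℝ) (a : ι → SpaceTime) (τ : κ → ℝ) (b : κ → SpaceTime) :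
    Tendsto (fun ε : ℝ => ∫ ω, Complex.exp (Complex.I * (∑ i, θ i * fluct μ N ε (a i) ω +
        ∑ j, τ j * fluctHat μ N ε (b j) ω : ℝ)) ∂P) (𝓝[>] 0)
      (𝓝 (Complex.exp (-(quadForm (levyDist μ) θ a : ℝ) / 2) *
        Complex.exp (-(quadForm (levyDist μ') τ b : ℝ) / 2))) := by
  have hμ2 := FiniteSecondMoments.of_mem_admissible hμ
  have h1 := tendsto_integral_levyExponent_mul (μ := μ) (F := heightSum θ a) (by fun_prop)
    (memLp_heightSum θ a hμ2).integrable_sq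
  have hq : ∫ p, heightSum θ a p ^ 2 ∂μ = quadForm (levyDist μ) θ a :=
    integral_sum_stepHeight_sq hμ2 θ a
  rw [hq] at h1
  have hsum := (h1.add (h.tendsto_micro hμ2 τ b)).add (h.tendsto_cross θ a τ b)
  rw [add_zero] at hsum
  rw [← Complex.exp_add]
  refine ((Complex.continuous_exp.tendsto _).comp hsum).congr' ?_
  filter_upwards [self_mem_nhdsWithin] with ε (hε : 0 < ε)
  rw [integral_cexp_fluct_add_fluctHat hμ hN θ a τ b hε, Function.comp_apply, ← mul_add, ← mul_add]
  congr 2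
  have hF := (memLp_heightSum θ a hμ2).const_mul ε
  have hF' := (memLp_heightSum τ (fun j => ε • b j) hμ2).const_mul √ε
  have i1 := integrable_levyExponent (by fun_prop) hF.integrable_sq
  have i2 := integrable_levyExponent (by fun_prop) hF'.integrable_sq
  have i3 := integrable_levyExponent (by fun_prop) (hF.add hF').integrable_sq
  have i4 : Integrable (fun p => (Complex.exp (Complex.I * (ε * heightSum θ a p : ℝ)) - 1) *
      (Complex.exp (Complex.I * (√ε * heightSum τ (fun j => ε • b j) p : ℝ)) - 1)) μ := by
    refine ((i3.sub i1).sub i2).congr (Eventually.of_forall fun p => ?_)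
    simp only [Pi.sub_apply, Pi.add_apply, levyExponent_add]
    ring
  rw [← integral_add i1 i2, ← integral_add (by exact i1.add i2) i4]
  simp_rw [levyExponent_add]

end SecondMomentBlowup

end Multitime

/-! ### Blow-up of the second moments at the origin -/

lemma Real.lintegral_comp_mul_left (f : ℝ → ℝ≥0∞) {a : ℝ} (ha : a ≠ 0) :
    ∫⁻ x, f (a * x) = ENNReal.ofReal |a⁻¹| * ∫⁻ x, f x := by
  rw [← smul_eq_mul, ← lintegral_smul_measure, ← Real.map_volume_mul_left ha]
  exact (lintegral_map_equiv f (Homeomorph.mulLeft₀ a ha).toMeasurableEquiv).symm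

lemma Real.ae_comp_mul_left {p : ℝ → Prop} (hp : ∀ᵐ x, p x) {a : ℝ} (ha : a ≠ 0) :
    ∀ᵐ x, p (a * x) := by
  refine ae_of_ae_map (f := (a * ·)) (by fun_prop) ?_
  rw [Real.map_volume_mul_left ha]
  exact Measure.smul_absolutelyContinuous.ae_le hp

/-- The convergence of measures part of the portmanteau theorem, for measures which need not be
finite a priori. -/
lemma MeasureTheory.tendsto_measure_of_forall_tendsto_lintegral {X ι : Type*} [TopologicalSpace X]
    [MeasurableSpace X] [OpensMeasurableSpace X] [HasOuterApproxClosed X] {l : Filter ι}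
    {ν : ι → Measure X} {ν₀ : Measure X} [IsFiniteMeasure ν₀]
    (h : ∀ φ : X →ᵇ ℝ≥0, Tendsto (fun i => ∫⁻ x, φ x ∂ν i) l (𝓝 (∫⁻ x, φ x ∂ν₀)))
    {E : Set X} (hE : ν₀ (frontier E) = 0) : Tendsto (fun i => ν i E) l (𝓝 (ν₀ E)) := by
  refine tendsto_order.2 ⟨fun c hc => ?_, fun c hc => ?_⟩
  · rw [← measure_congr (interior_ae_eq_of_null_frontier hE)] at hc
    -- For the lower bound, the functions 1 - `apprSeq` are supported in the interior and tend to
    -- its indicator. No complement is taken under `ν i`, so `ν i` may be infinite.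
    have hcl : IsClosed (interior E)ᶜ := isOpen_interior.isClosed_compl
    have hlim : Tendsto (fun n => ∫⁻ x, ((1 - hcl.apprSeq n : X →ᵇ ℝ≥0) x : ℝ≥0∞) ∂ν₀) atTop
        (𝓝 (ν₀ (interior E))) := by
      refine measure_of_cont_bdd_of_tendsto_indicator (c := 1) ν₀ isOpen_interior.measurableSet _
        (fun n x => tsub_le_self) (tendsto_pi_nhds.2 fun x => ?_)
      have h1 := (tendsto_const_nhds (x := (1 : ℝ≥0))).sub
        (tendsto_pi_nhds.1 (HasOuterApproxClosed.tendsto_apprSeq hcl) x)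
      by_cases hx : x ∈ interior E <;> simpa [hx] using h1
    obtain ⟨n, hn⟩ := (hlim.eventually (lt_mem_nhds hc)).exists
    filter_upwards [(h (1 - hcl.apprSeq n)).eventually (lt_mem_nhds hn)] with i hi
    refine hi.trans_le ((lintegral_mono (g := (interior E).indicator 1) fun x => ?_).trans ?_)
    · by_cases hx : x ∈ interior E
      · simp [hx]
      · simp [hx, HasOuterApproxClosed.apprSeq_apply_eq_one hcl n (x := x) hx]
    · rw [lintegral_indicator_one isOpen_interior.measurableSet]
      exact measure_mono interior_subset
  · rw [← measure_congr (closure_ae_eq_of_null_frontier hE)] at hc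
    obtain ⟨n, hn⟩ := ((HasOuterApproxClosed.tendsto_lintegral_apprSeq
      (isClosed_closure (s := E)) ν₀).eventually (gt_mem_nhds hc)).exists
    filter_upwards [(h _).eventually (gt_mem_nhds hn)] with i hi
    exact (measure_mono subset_closure).trans_lt
      ((HasOuterApproxClosed.measure_le_lintegral isClosed_closure _ n).trans_lt hi)

namespace Multitime

/-- The measure `r² ρ(x) dμ(v, r | x)` on velocities and marks. -/
noncomputable def markMeasure (ρ : ℝ → ℝ≥0) (κ : Kernel ℝ (ℝ × ℝ)) (x : ℝ) : Measure (ℝ × ℝ) :=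
  (ρ x : ℝ≥0∞) • (κ x).withDensity fun w => ENNReal.ofReal (w.2 ^ 2)

variable {μ : Measure Pt} {ρ : ℝ → ℝ≥0} {κ : Kernel ℝ (ℝ × ℝ)}

lemma lintegral_markMeasure (x : ℝ) {h : ℝ × ℝ → ℝ≥0∞} (hh : Measurable h) :
    ∫⁻ w, h w ∂markMeasure ρ κ x = ρ x * ∫⁻ w, h w * ENNReal.ofReal (w.2 ^ 2) ∂κ x := by
  rw [markMeasure, lintegral_smul_measure, smul_eq_mul,
    lintegral_withDensity_eq_lintegral_mul _ (by fun_prop) hh]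
  simp_rw [Pi.mul_apply, mul_comm]

lemma measurable_lintegral_markMeasure [IsSFiniteKernel κ] (hρ : Measurable ρ) {s : ℝ → ℝ}
    (hs : Measurable s) {h : ℝ × ℝ × ℝ → ℝ≥0∞} (hh : Measurable h) :
    Measurable fun y => ∫⁻ w, h (y, w) ∂markMeasure ρ κ (s y) := by
  have (y : ℝ) := lintegral_markMeasure (ρ := ρ) (κ := κ) (s y) (h := fun w => h (y, w))
    (by fun_prop)
  simp_rw [this]
  have h1 : Measurable fun q : ℝ × ℝ × ℝ => h q * ENNReal.ofReal (q.2.2 ^ 2) := by fun_prop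
  have h2 := h1.lintegral_kernel_prod_right' (κ := κ.comap s hs)
  simp only [Kernel.comap_apply] at h2
  exact ((hρ.comp hs).coe_nnreal_ennreal).mul h2

lemma HasSpaceDensity.lintegral_secondMoment [IsSFiniteKernel κ] (hd : HasSpaceDensity μ ρ κ)
    {h : Pt → ℝ≥0∞} (hh : Measurable h) :
    ∫⁻ p, h p ∂secondMoment μ = ∫⁻ x, ∫⁻ w, h (x, w) ∂markMeasure ρ κ x := by
  have hρ := hd.measurable
  have (x : ℝ) := lintegral_markMeasure (ρ := ρ) (κ := κ) x (h := fun w => h (x, w))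
    (by fun_prop)
  simp_rw [this]
  rw [secondMoment, lintegral_withDensity_eq_lintegral_mul _ (by fun_prop) hh, hd.eq_compProd,
    Measure.lintegral_compProd (by fun_prop), lintegral_withDensity_eq_lintegral_mul _
      (by fun_prop) (Measurable.lintegral_kernel_prod_right' (κ := κ)
        (f := (fun p : Pt => ENNReal.ofReal (p.2.2 ^ 2)) * h) (by fun_prop))]
  simp_rw [Pi.mul_apply, mul_comm (h _)]

/-- Space rescaling of integrals against the second moment measure. -/
lemma HasSpaceDensity.lintegral_secondMoment_scale [IsSFiniteKernel κ]
    (hd : HasSpaceDensity μ ρ κ) {h : Pt → ℝ≥0∞} (hh : Measurable h) {ε : ℝ} (hε : 0 < ε) :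
    ENNReal.ofReal ε⁻¹ * ∫⁻ p, h p ∂secondMoment μ =
      ∫⁻ y, ∫⁻ w, h (ε * y, w) ∂markMeasure ρ κ (ε * y) := by
  rw [hd.lintegral_secondMoment hh, Real.lintegral_comp_mul_left
    (fun x => ∫⁻ w, h (x, w) ∂markMeasure ρ κ x) hε.ne', abs_of_pos (inv_pos.2 hε)]

lemma lintegral_secondMoment_muHat [IsSFiniteKernel κ] {h : Pt → ℝ≥0∞} (hh : Measurable h) :
    ∫⁻ p, h p ∂secondMoment (muHat ρ κ) = ∫⁻ y, ∫⁻ w, h (y, w) ∂markMeasure ρ κ 0 := by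
  have (x : ℝ) := lintegral_markMeasure (ρ := ρ) (κ := κ) 0 (h := fun w => h (x, w))
    (by fun_prop)
  simp_rw [this]
  rw [secondMoment, lintegral_withDensity_eq_lintegral_mul _ (by fun_prop) hh, muHat,
    lintegral_smul_measure, lintegral_prod _ (by fun_prop), lintegral_const_mul _ ?_]
  · simp_rw [Pi.mul_apply, mul_comm (h _), smul_eq_mul]
  · exact Measurable.lintegral_prod_right' (f := fun p : Pt => h p * ENNReal.ofReal (p.2.2 ^ 2))
      (by fun_prop)

/-! ### Domination and weak limits near the origin. -/

namespace RegularAtZero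

lemma isFiniteMeasure (hr : RegularAtZero ρ κ) : IsFiniteMeasure (markMeasure ρ κ 0) := by
  refine ⟨?_⟩
  rw [← lintegral_one, lintegral_markMeasure 0 measurable_const]
  simpa using hr.finite

lemma tendsto_lintegral (hr : RegularAtZero ρ κ) (φ : (ℝ × ℝ) →ᵇ ℝ≥0) {ι : Type*} {l : Filter ι}
    {x : ι → ℝ} (hx : Tendsto x l (𝓝 0)) :
    Tendsto (fun i => ∫⁻ w, φ w ∂markMeasure ρ κ (x i)) l
      (𝓝 (∫⁻ w, φ w ∂markMeasure ρ κ 0)) := by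
  have h (x : ℝ) := lintegral_markMeasure (ρ := ρ) (κ := κ) x (h := fun w => φ w)
    (by fun_prop)
  simp_rw [h]
  exact (hr.continuousAt φ).tendsto.comp hx

/-- For positions at distance of order `ε`, the mass of the lines which come close to the origin
is dominated by an integrable function of the position. -/
lemma exists_dominating (hr : RegularAtZero ρ κ) {C : ℝ} (hC : 1 ≤ C) :
    ∃ D : ℝ → ℝ≥0∞, ∫⁻ y, D y ≠ ∞ ∧ ∀ᶠ ε in 𝓝[>] (0 : ℝ), ∀ᵐ y : ℝ,
      markMeasure ρ κ (ε * y) {w | |y| ≤ C * (1 + |w.1|)} ≤ D y := by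
  have := hr.isFiniteMeasure
  have hC0 : 0 < C := by linarith
  obtain ⟨K, g, hg, hgK, htail⟩ := hr.tail
  set M : ℝ≥0∞ := markMeasure ρ κ 0 Set.univ + 1 with hM
  have hMtop : M ≠ ∞ := by simp [hM, measure_ne_top]
  have hmass : ∀ᶠ x in 𝓝 (0 : ℝ), markMeasure ρ κ x Set.univ < M := by
    have h1 := hr.tendsto_lintegral 1 tendsto_id
    simp only [BoundedContinuousFunction.coe_one, Pi.one_apply, ENNReal.coe_one, lintegral_one,
      id] at h1
    exact h1.eventually (gt_mem_nhds (ENNReal.lt_add_right (measure_ne_top _ _) one_ne_zero))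
  obtain ⟨δ, hδ, hmass⟩ := Metric.eventually_nhds_iff.1 hmass
  set Y : ℝ := C * (max K 0 + 3) with hY
  have hY0 : 0 ≤ Y := by positivity
  set G : ℝ → ℝ≥0∞ := (Set.Ioi K).indicator g with hG
  have hGm : Measurable G := hg.indicator measurableSet_Ioi
  have hGfin : ∫⁻ u, G u ≠ ∞ := by
    rw [hG, lintegral_indicator measurableSet_Ioi]; exact hgK.ne
  have hGaff (c : ℝ) (hc : c ≠ 0) : ∫⁻ y, G (c * y - 1) ≠ ∞ := by
    rw [Real.lintegral_comp_mul_left (fun z => G (z - 1)) hc, lintegral_sub_right_eq_self]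
    exact ENNReal.mul_ne_top ENNReal.ofReal_ne_top hGfin
  -- Total mass near 0 bounds the central part; the tail function at speed C⁻¹|y| - 1 bounds the
  -- rest. The two `G` terms serve the two signs of y.
  refine ⟨fun y => (Set.Icc (-Y) Y).indicator (fun _ => M) y +
    (G (C⁻¹ * y - 1) + G (-C⁻¹ * y - 1)), ?_, ?_⟩
  · rw [lintegral_add_left (measurable_const.indicator measurableSet_Icc),
      lintegral_add_left (by fun_prop), lintegral_indicator measurableSet_Icc, setLIntegral_const]
    refine ENNReal.add_ne_top.2 ⟨ENNReal.mul_ne_top hMtop (by simp), ENNReal.add_ne_top.2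
      ⟨hGaff _ (by positivity), hGaff _ (neg_ne_zero.2 (by positivity))⟩⟩
  · have h1 : ∀ᶠ ε in 𝓝[>] (0 : ℝ), ε < δ / (Y + 1) :=
      nhdsWithin_le_nhds (gt_mem_nhds (by positivity))
    have h2 : ∀ᶠ ε in 𝓝[>] (0 : ℝ), ε < 1 / (2 * C) :=
      nhdsWithin_le_nhds (gt_mem_nhds (by positivity))
    filter_upwards [h1, h2, self_mem_nhdsWithin] with ε h1 h2 (hε : 0 < ε)
    filter_upwards [Real.ae_comp_mul_left htail hε.ne'] with y hy
    rcases le_or_gt |y| Y with hyY | hyY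
    · refine le_trans ?_ le_self_add
      rw [Set.indicator_of_mem (s := Set.Icc (-Y) Y) (abs_le.1 hyY)]
      refine (measure_mono (Set.subset_univ _)).trans (hmass ?_).le
      rw [Real.dist_eq, sub_zero, abs_mul, abs_of_pos hε]
      rw [lt_div_iff₀ (by positivity)] at h1
      nlinarith
    · refine le_trans ?_ le_add_self
      have hy3 : max K 0 + 3 < C⁻¹ * |y| := by
        rw [← div_eq_inv_mul, lt_div_iff₀ hC0]; linarith
      have hu : K < C⁻¹ * |y| - 1 := by linarith [le_max_left K 0]
      -- For ε < 1/(2C) the position is at most half of C⁻¹|y|, which is below the speed threshold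
      -- since C⁻¹|y| > 2; the tail hypothesis, restricted to |x| ≤ u, then applies.
      have hεy : |ε * y| ≤ C⁻¹ * |y| - 1 := by
        rw [abs_mul, abs_of_pos hε]
        have : ε * |y| ≤ 1 / (2 * C) * |y| := by gcongr
        have h4 : 1 / (2 * C) * |y| = C⁻¹ * |y| / 2 := by field_simp
        linarith [le_max_right K 0]
      have hset : {w : ℝ × ℝ | |y| ≤ C * (1 + |w.1|)} = {w | C⁻¹ * |y| - 1 ≤ |w.1|} := by
        ext w
        simp only [Set.mem_ofPred_eq]
        rw [sub_le_iff_le_add, inv_mul_le_iff₀ hC0, add_comm |w.1|]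
      have hle : markMeasure ρ κ (ε * y) {w | |y| ≤ C * (1 + |w.1|)} ≤ G (C⁻¹ * |y| - 1) := by
        rw [hset, hG, Set.indicator_of_mem (Set.mem_Ioi.2 hu), markMeasure, Measure.smul_apply,
          withDensity_apply _ (measurableSet_le (by fun_prop) (by fun_prop))]
        exact hy _ hu hεy
      refine hle.trans ?_
      rcases abs_cases y with ⟨h, -⟩ | ⟨h, -⟩
      · rw [h]; exact le_self_add
      · rw [h, mul_neg, neg_mul]; exact le_add_self

/-- Dominated convergence in the rescaled position, with the majorant of `exists_dominating`. The
same majorant shows that the limit is finite. -/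
lemma tendsto_lintegral_lintegral [IsSFiniteKernel κ] (hr : RegularAtZero ρ κ) (hρ : Measurable ρ)
    {f : ℝ → Pt → ℝ≥0∞} (hf : ∀ ε, Measurable (f ε)) {C : ℝ} (hC : 1 ≤ C)
    (hle : ∀ ε y w, f ε (y, w) ≤ {w : ℝ × ℝ | |y| ≤ C * (1 + |w.1|)}.indicator 1 w)
    {L : ℝ → ℝ≥0∞} (hL : ∀ᵐ y, Tendsto (fun ε => ∫⁻ w, f ε (y, w) ∂markMeasure ρ κ (ε * y))
      (𝓝[>] 0) (𝓝 (L y))) :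
    Tendsto (fun ε => ∫⁻ y, ∫⁻ w, f ε (y, w) ∂markMeasure ρ κ (ε * y)) (𝓝[>] 0)
      (𝓝 (∫⁻ y, L y)) ∧ ∫⁻ y, L y < ∞ := by
  obtain ⟨D, hD, hdom⟩ := hr.exists_dominating hC
  have hdom' : ∀ᶠ ε in 𝓝[>] (0 : ℝ), ∀ᵐ y, ∫⁻ w, f ε (y, w) ∂markMeasure ρ κ (ε * y) ≤ D y := by
    filter_upwards [hdom] with ε h
    filter_upwards [h] with y hy
    refine (lintegral_mono (hle ε y)).trans ?_
    rwa [lintegral_indicator_one (measurableSet_le (by fun_prop) (by fun_prop))]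
  have hlim := tendsto_lintegral_filter_of_dominated_convergence D
    (Eventually.of_forall fun ε => measurable_lintegral_markMeasure hρ (s := fun y => ε * y)
      (by fun_prop) (hf ε)) hdom' hD hL
  refine ⟨hlim, (le_of_tendsto hlim ?_).trans_lt hD.lt_top⟩
  filter_upwards [hdom'] with ε h using lintegral_mono_ae h

lemma tendsto_lintegral_measure [IsSFiniteKernel κ] (hr : RegularAtZero ρ κ) (hρ : Measurable ρ)
    {S F : Set Pt} (hS : MeasurableSet S) (hF : MeasurableSet F) {C : ℝ} (hC : 1 ≤ C)
    (hSC : ∀ p ∈ S, |p.1| ≤ C * (1 + |p.2.1|))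
    (hSF : ∀ y : ℝ, frontier (Prod.mk y ⁻¹' S) ⊆ Prod.mk y ⁻¹' F)
    (hF0 : ∀ w : ℝ × ℝ, volume {y | (y, w) ∈ F} = 0) :
    Tendsto (fun ε => ∫⁻ y, markMeasure ρ κ (ε * y) (Prod.mk y ⁻¹' S)) (𝓝[>] 0)
      (𝓝 (∫⁻ y, markMeasure ρ κ 0 (Prod.mk y ⁻¹' S))) ∧
      ∫⁻ y, markMeasure ρ κ 0 (Prod.mk y ⁻¹' S) < ∞ := by
  have := hr.isFiniteMeasure
  have hint (x y : ℝ) : ∫⁻ w, S.indicator 1 (y, w) ∂markMeasure ρ κ x =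
      markMeasure ρ κ x (Prod.mk y ⁻¹' S) :=
    lintegral_indicator_one (measurable_prodMk_left hS)
  -- Fubini: for each (v, r) the boundary contains only a null set of positions, hence for almost
  -- every position the boundary is null for the limiting mark measure.
  have hnull : ∀ᵐ y, markMeasure ρ κ 0 (Prod.mk y ⁻¹' F) = 0 := by
    refine (Measure.measure_prod_null hF).1 ?_
    rw [Measure.prod_apply_symm hF]
    simp_rw [Set.preimage, hF0, lintegral_zero]
  have := hr.tendsto_lintegral_lintegral hρ (f := fun _ => S.indicator 1)
    (fun _ => measurable_one.indicator hS) hC (fun ε y w => ?_)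
    (L := fun y => markMeasure ρ κ 0 (Prod.mk y ⁻¹' S)) ?_
  · simpa only [hint] using this
  · by_cases h : (y, w) ∈ S
    · simp [h, hSC _ h]
    · simp [h]
  · filter_upwards [hnull] with y hy
    simp_rw [hint]
    refine tendsto_measure_of_forall_tendsto_lintegral (fun φ => hr.tendsto_lintegral φ ?_)
      (measure_mono_null (hSF y) hy)
    exact tendsto_nhdsWithin_of_tendsto_nhds (Continuous.tendsto' (by fun_prop) _ _ (by simp))

/-- Freezing √ε at 1/(n + 1) gives a bounded continuous test function, to which weak continuity
applies; its limiting integral is small for large n. For smaller √ε it dominates the integrand. -/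
lemma tendsto_lintegral_min_sqrt (hr : RegularAtZero ρ κ) {C : ℝ} (hC : 0 ≤ C) (y : ℝ) :
    Tendsto (fun ε => ∫⁻ w, ENNReal.ofReal (min (√ε * (C * |w.2|)) 1) ∂markMeasure ρ κ (ε * y))
      (𝓝[>] 0) (𝓝 0) := by
  have := hr.isFiniteMeasure
  let φ (n : ℕ) : (ℝ × ℝ) →ᵇ ℝ≥0 := (BoundedContinuousFunction.ofNormedAddCommGroup
    (fun w : ℝ × ℝ => min (1 / ((n : ℝ) + 1) * (C * |w.2|)) 1) (by fun_prop) 1 fun w => by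
      rw [Real.norm_of_nonneg (le_min (by positivity) zero_le_one)]
      exact min_le_right _ _).nnrealPart
  have hφ (n : ℕ) (w : ℝ × ℝ) : (φ n w : ℝ≥0∞) =
    ENNReal.ofReal (min (1 / ((n : ℝ) + 1) * (C * |w.2|)) 1) := rfl
  have hlim : Tendsto (fun n => ∫⁻ w, φ n w ∂markMeasure ρ κ 0) atTop (𝓝 0) := by
    rw [← lintegral_zero (α := ℝ × ℝ) (μ := markMeasure ρ κ 0)]
    refine tendsto_lintegral_of_dominated_convergence (fun _ => 1) (fun n => by fun_prop)
      (fun n => ae_of_all _ fun w => ?_) (by simp) (ae_of_all _ fun w => ?_)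
    · change (φ n w : ℝ≥0∞) ≤ 1
      rw [hφ]
      exact (ENNReal.ofReal_le_ofReal (min_le_right _ _)).trans_eq ENNReal.ofReal_one
    · simp_rw [hφ]
      have h1 := (((tendsto_one_div_add_atTop_nhds_zero_nat (𝕜 := ℝ)).mul_const
        (C * |w.2|)).min (tendsto_const_nhds (x := (1 : ℝ))))
      have h2 := (ENNReal.continuous_ofReal.tendsto _).comp h1
      rwa [zero_mul, min_eq_left zero_le_one, ENNReal.ofReal_zero] at h2
  refine ENNReal.tendsto_nhds_zero.2 fun c hc => ?_
  obtain ⟨n, hn⟩ := (hlim.eventually (gt_mem_nhds hc)).exists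
  have hx : Tendsto (fun ε : ℝ => ε * y) (𝓝[>] 0) (𝓝 0) :=
    tendsto_nhdsWithin_of_tendsto_nhds (Continuous.tendsto' (by fun_prop) _ _ (by simp))
  have hs : ∀ᶠ ε in 𝓝[>] (0 : ℝ), √ε < 1 / ((n : ℝ) + 1) := by
    refine nhdsWithin_le_nhds ((Real.continuous_sqrt.tendsto 0).eventually (gt_mem_nhds ?_))
    rw [Real.sqrt_zero]; positivity
  filter_upwards [(hr.tendsto_lintegral (φ n) hx).eventually (gt_mem_nhds hn), hs] with ε h1 h2
  refine (lintegral_mono fun w => ?_).trans h1.le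
  rw [hφ]
  gcongr

end RegularAtZero

lemma volume_setOf_add_eq_eq_zero (c d : ℝ) : volume {y : ℝ | y + c = d} = 0 := by
  refine measure_mono_null (t := {d - c}) (fun y hy => ?_) (measure_singleton _)
  exact eq_sub_of_add_eq hy

/-- At a fixed position, membership can change only at lines passing through `a` or `b`. -/
lemma frontier_preimage_separating (a b : SpaceTime) (y : ℝ) :
    frontier (Prod.mk y ⁻¹' separating a b) ⊆
      {w : ℝ × ℝ | y + a.2 * w.1 = a.1} ∪ {w | y + b.2 * w.1 = b.1} := by
  have hA (c : SpaceTime) : frontier {w : ℝ × ℝ | y + c.2 * w.1 ≤ c.1} ⊆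
      {w : ℝ × ℝ | y + c.2 * w.1 = c.1} := frontier_le_subset_eq (by fun_prop) (by fun_prop)
  set A := {w : ℝ × ℝ | y + a.2 * w.1 ≤ a.1} with hAdef
  set B := {w : ℝ × ℝ | y + b.2 * w.1 ≤ b.1} with hBdef
  have h : Prod.mk y ⁻¹' separating a b = (Aᶜ ∩ B) ∪ (A ∩ Bᶜ) := by
    ext w
    simp [separating, crossingPos, crossingNeg, leftHalf, rightHalf, A, B]
  rw [h]
  refine (frontier_union_subset _ _).trans (Set.union_subset ?_ ?_)
  · refine Set.inter_subset_left.trans ((frontier_inter_subset _ _).trans ?_)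
    rw [frontier_compl]
    exact Set.union_subset_union (Set.inter_subset_left.trans (hA a))
      (Set.inter_subset_right.trans (hA b))
  · refine Set.inter_subset_right.trans ((frontier_inter_subset _ _).trans ?_)
    rw [frontier_compl]
    exact Set.union_subset_union (Set.inter_subset_left.trans (hA a))
      (Set.inter_subset_right.trans (hA b))

/-- The second moments of `μ̂` are locally finite. -/
lemma RegularAtZero.secondMoment_crossing_lt_top [IsSFiniteKernel κ] (hr : RegularAtZero ρ κ)
    (hρ : Measurable ρ) (a b : SpaceTime) :
    secondMoment (muHat ρ κ) (crossing a b) < ∞ := by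
  obtain ⟨C, hC, hle⟩ := exists_abs_le_of_mem_crossing a b
  set S : Set Pt := {p | |p.1| ≤ C * (1 + |p.2.1|)} with hS
  have hSm : MeasurableSet S := measurableSet_le (by fun_prop) (by fun_prop)
  -- The whole cone of lines fast enough to approach the origin already has finite second moment;
  -- its boundary has at most two positions for each velocity.
  have key := (hr.tendsto_lintegral_measure hρ hSm
    (F := {p : Pt | |p.1| = C * (1 + |p.2.1|)}) (measurableSet_eq_fun (by fun_prop) (by fun_prop))
    hC (fun p hp => hp) (fun y => ?_) (fun w => ?_)).2
  · refine (measure_mono (show crossing a b ⊆ S from hle)).trans_lt ?_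
    rw [← lintegral_indicator_one hSm,
      lintegral_secondMoment_muHat (measurable_one.indicator hSm)]
    convert key using 3 with y
    exact lintegral_indicator_one (measurable_prodMk_left hSm)
  · exact frontier_le_subset_eq (f := fun _ : ℝ × ℝ => |y|) (g := fun w => C * (1 + |w.1|))
      (by fun_prop) (by fun_prop)
  · refine measure_mono_null (t := {C * (1 + |w.1|), -(C * (1 + |w.1|))}) (fun y hy => ?_)
      ((Set.toFinite _).measure_zero _)
    exact eq_or_eq_neg_of_abs_eq hy

/-- The substitution x = εy absorbs the factor ε⁻¹ and turns the shrinking separating set into a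
fixed one, leaving the ε-dependence in the mark measures at εy and, for `negligible`, in √ε. -/
lemma RegularAtZero.secondMomentBlowup [IsSFiniteKernel κ] (hr : RegularAtZero ρ κ)
    (hd : HasSpaceDensity μ ρ κ) : SecondMomentBlowup μ (muHat ρ κ) where
  finite a b := (measure_mono (separating_subset_crossing a b)).trans_lt
    (hr.secondMoment_crossing_lt_top hd.measurable a b)
  tendsto a b := by
    obtain ⟨C, hC, hle⟩ := exists_abs_le_of_mem_crossing a b
    have hSm := measurableSet_separating a b
    have key := (hr.tendsto_lintegral_measure hd.measurable hSm
      (F := {p : Pt | p.1 + a.2 * p.2.1 = a.1} ∪ {p | p.1 + b.2 * p.2.1 = b.1})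
      ((measurableSet_eq_fun (by fun_prop) (by fun_prop)).union
        (measurableSet_eq_fun (by fun_prop) (by fun_prop))) hC
      (fun p hp => hle p (separating_subset_crossing a b hp))
      (fun y => frontier_preimage_separating a b y) (fun w => measure_union_null
        (s := {y | y + a.2 * w.1 = a.1}) (t := {y | y + b.2 * w.1 = b.1})
        (volume_setOf_add_eq_eq_zero _ _) (volume_setOf_add_eq_eq_zero _ _))).1
    rw [← lintegral_indicator_one hSm,
      lintegral_secondMoment_muHat (measurable_one.indicator hSm)]
    have h0 (y : ℝ) : ∫⁻ w, (separating a b).indicator 1 (y, w) ∂markMeasure ρ κ 0 =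
        markMeasure ρ κ 0 (Prod.mk y ⁻¹' separating a b) :=
      lintegral_indicator_one (measurable_prodMk_left hSm)
    simp_rw [h0]
    refine key.congr' ?_
    filter_upwards [self_mem_nhdsWithin] with ε (hε : 0 < ε)
    have hεm := measurableSet_separating (ε • a) (ε • b)
    rw [← lintegral_indicator_one hεm,
      hd.lintegral_secondMoment_scale (measurable_one.indicator hεm) hε]
    refine lintegral_congr fun y => ?_
    rw [← lintegral_indicator_one (measurable_prodMk_left hSm)]
    refine lintegral_congr fun w => ?_
    classical
    simp only [Set.indicator_apply, Set.mem_preimage, mem_separating_smul hε]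
    rfl
  negligible b C hC := by
    obtain ⟨C', hC', hle⟩ := exists_abs_le_of_mem_crossing 0 b
    have hSm := measurableSet_separating 0 b
    have hfm (ε : ℝ) : Measurable fun p : Pt => ENNReal.ofReal (min (√ε * (C * |p.2.2|)) 1) := by
      fun_prop
    have key := (hr.tendsto_lintegral_lintegral hd.measurable
      (f := fun ε => (separating 0 b).indicator
        fun p => ENNReal.ofReal (min (√ε * (C * |p.2.2|)) 1))
      (fun ε => (hfm ε).indicator hSm) hC' (fun ε y w => ?_) (L := fun _ => 0)
      (ae_of_all _ fun y => ?_)).1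
    · rw [lintegral_zero] at key
      refine key.congr' ?_
      filter_upwards [self_mem_nhdsWithin] with ε (hε : 0 < ε)
      have hεm := measurableSet_separating 0 (ε • b)
      rw [← lintegral_indicator hεm, hd.lintegral_secondMoment_scale ((hfm ε).indicator hεm) hε]
      refine lintegral_congr fun y => lintegral_congr fun w => ?_
      have := mem_separating_smul hε 0 b y w
      rw [smul_zero] at this
      classical
      simp only [Set.indicator_apply, this]
    · by_cases h : (y, w) ∈ separating 0 b
      · have := hle _ (separating_subset_crossing 0 b h)
        simp only [h, Set.indicator_of_mem]
        rw [Set.indicator_of_mem (by exact this)]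
        exact (ENNReal.ofReal_le_ofReal (min_le_right _ _)).trans_eq ENNReal.ofReal_one
      · simp [h]
    · refine tendsto_of_tendsto_of_tendsto_of_le_of_le tendsto_const_nhds
        (hr.tendsto_lintegral_min_sqrt hC y) (fun _ => zero_le) fun ε => ?_
      exact lintegral_mono fun w => Set.indicator_le_self _ _ _

end Multitime

/-! ### Convergence in distribution -/

namespace Multitime

lemma tendsto_val_toZero : Tendsto (Subtype.val : Scale → ℝ) toZero (𝓝[>] 0) :=
  tendsto_nhdsWithin_iff.2 ⟨tendsto_comap, Eventually.of_forall fun ε => ε.2⟩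

instance : IsCountablyGenerated toZero := by unfold toZero; infer_instance

/-- Used to carry each field to a factor of a product space, where the two fields are independent.
-/
lemma IsLevyChentsov.comp_measurePreserving {Ω Ω' : Type*} [MeasurableSpace Ω]
    [MeasurableSpace Ω'] {P : Measure Ω} {Q : Measure Ω'} {η : SpaceTime → Ω → ℝ}
    {d : SpaceTime → SpaceTime → ℝ} (h : IsLevyChentsov η d P) (hη : ∀ a, Measurable (η a))
    {π : Ω' → Ω} (hπ : MeasurePreserving π Q P) :
    IsLevyChentsov (fun a ω => η a (π ω)) d Q where
  gaussian := ⟨fun I => ⟨by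
    have := (h.gaussian.hasGaussianLaw I).isGaussian_map
    rw [← hπ.map_eq, Measure.map_map (by fun_prop) hπ.measurable] at this
    exact this⟩⟩
  centered a := by
    rw [← h.centered a, ← hπ.map_eq, integral_map hπ.measurable.aemeasurable
      (hη a).aestronglyMeasurable]
  covariance a b := by
    rw [← h.covariance a b, ← hπ.map_eq]
    exact (covariance_map_fun (hη a).aestronglyMeasurable (hη b).aestronglyMeasurable
      hπ.measurable.aemeasurable).symm

theorem exists_tendstoInDistribution_fluct {Ω : Type*} [MeasurableSpace Ω] {P : Measure Ω}
    [IsProbabilityMeasure P] {μ : Measure Pt} (hμ : μ ∈ admissible) {N : ℝ → Ω → Measure Pt}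
    (hN : ∀ ε : ℝ, 0 < ε → IsPoissonProcess (N ε) (ENNReal.ofReal ε⁻¹ • μ) P) :
    ∃ (Ω' : Type) (_ : MeasurableSpace Ω') (Q : Measure Ω') (_ : IsProbabilityMeasure Q)
        (η : SpaceTime → Ω' → ℝ),
      IsLevyChentsov η (levyDist μ) Q ∧
      ∀ (m : ℕ) (a : Fin m → SpaceTime),
        TendstoInDistribution (fun (ε : Scale) (ω : Ω) (i : Fin m) => fluct μ N ε (a i) ω)
          toZero (fun (ω : Ω') (i : Fin m) => η (a i) ω) (fun _ => P) Q := by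
  obtain ⟨Ω', _, Q, _, η, hη, hηm, hchar⟩ := exists_isLevyChentsov (.of_mem_admissible hμ)
  refine ⟨Ω', _, Q, inferInstance, η, hη, fun m a => ?_⟩
  refine tendstoInDistribution_of_tendsto_integral_cexp
    (fun ε => measurable_pi_lambda _ fun i => measurable_fluct hN ε.2 (a i))
    (measurable_pi_lambda _ fun i => hηm (a i)) fun θ => ?_
  rw [hchar]
  exact (tendsto_integral_cexp_fluct hμ hN θ a).comp tendsto_val_toZero

theorem SecondMomentBlowup.exists_tendstoInDistribution {Ω : Type*} [MeasurableSpace Ω]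
    {P : Measure Ω} [IsProbabilityMeasure P] {μ μ' : Measure Pt} (h : SecondMomentBlowup μ μ')
    (hμ : μ ∈ admissible) {N : ℝ → Ω → Measure Pt}
    (hN : ∀ ε : ℝ, 0 < ε → IsPoissonProcess (N ε) (ENNReal.ofReal ε⁻¹ • μ) P) :
    ∃ (Ω' : Type) (_ : MeasurableSpace Ω') (Q : Measure Ω') (_ : IsProbabilityMeasure Q)
        (η ηHat : SpaceTime → Ω' → ℝ),
      IsLevyChentsov η (levyDist μ) Q ∧ IsLevyChentsov ηHat (levyDist μ') Q ∧
      IndepFun (fun (ω : Ω') (a : SpaceTime) => η a ω)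
        (fun (ω : Ω') (b : SpaceTime) => ηHat b ω) Q ∧
      ∀ (m n : ℕ) (a : Fin m → SpaceTime) (b : Fin n → SpaceTime),
        TendstoInDistribution
          (fun (ε : Scale) (ω : Ω) =>
            ((fun i : Fin m => fluct μ N ε (a i) ω), (fun j : Fin n => fluctHat μ N ε (b j) ω)))
          toZero
          (fun ω : Ω' => ((fun i : Fin m => η (a i) ω), (fun j : Fin n => ηHat (b j) ω)))
          (fun _ => P) Q := by
  obtain ⟨Ω₁, _, Q₁, _, η, hη, hηm, hchar⟩ := exists_isLevyChentsov (.of_mem_admissible hμ)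
  obtain ⟨Ω₂, _, Q₂, _, ξ, hξ, hξm, hchar'⟩ := exists_isLevyChentsov h.finite
  refine ⟨Ω₁ × Ω₂, _, Q₁.prod Q₂, inferInstance, fun a ω => η a ω.1, fun b ω => ξ b ω.2,
    hη.comp_measurePreserving hηm measurePreserving_fst,
    hξ.comp_measurePreserving hξm measurePreserving_snd,
    indepFun_prod (measurable_pi_lambda _ hηm) (measurable_pi_lambda _ hξm), fun m n a b => ?_⟩
  -- The two families form one vector indexed by a sum type; a continuous map then separates them
  -- into a pair.
  have key := tendstoInDistribution_of_tendsto_integral_cexp (l := toZero) (P := P)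
    (X := fun (ε : Scale) ω => Sum.elim (fun i : Fin m => fluct μ N ε (a i) ω)
      fun j : Fin n => fluctHat μ N ε (b j) ω)
    (Z := fun ω : Ω₁ × Ω₂ => Sum.elim (fun i => η (a i) ω.1) fun j => ξ (b j) ω.2)
    (Q := Q₁.prod Q₂)
    (fun ε => measurable_pi_lambda _ <| Sum.rec (fun i => measurable_fluct hN ε.2 (a i))
      fun j => measurable_fluctHat hN ε.2 (b j))
    (measurable_pi_lambda _ <| Sum.rec (fun i => (hηm (a i)).comp measurable_fst)
      fun j => (hξm (b j)).comp measurable_snd) fun θ => ?_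
  · exact key.continuous_comp (g := fun x : Fin m ⊕ Fin n → ℝ =>
      ((fun i => x (Sum.inl i)), fun j => x (Sum.inr j))) (by fun_prop)
  · simp only [Fintype.sum_sum_type, Sum.elim_inl, Sum.elim_inr]
    have hlim := (h.tendsto_integral_cexp_fluct_add_fluctHat hμ hN (fun i => θ (Sum.inl i)) a
      (fun j => θ (Sum.inr j)) b).comp tendsto_val_toZero
    -- The product of the two Gaussian transforms is the characteristic function of the independent
    -- pair under the product measure.
    rw [← hchar, ← hchar', ← integral_prod_mul] at hlim
    simp_rw [← Complex.exp_add, ← mul_add, ← Complex.ofReal_add] at hlim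
    exact hlim

end Multitime

/-! ### Assembly of the conclusions. -/

theorem theorem1 {Ω : Type*} [MeasurableSpace Ω] (P : Measure Ω) [IsProbabilityMeasure P]
    (μ : Measure Pt) (hμ : μ ∈ admissible)
    (N : ℝ → Ω → Measure Pt)
    (hN : ∀ ε : ℝ, 0 < ε → IsPoissonProcess (N ε) (ENNReal.ofReal ε⁻¹ • μ) P) :
    -- almost sure convergence, for an arbitrary joint law of the processes, along integer `1/ε`
    (∀ b : SpaceTime, ∀ᵐ ω ∂P,
      Tendsto (fun n : ℕ => height (rescaled N (n : ℝ)⁻¹ ω) b) atTop (𝓝 (height μ b))) ∧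
    -- almost sure convergence as `ε → 0` through the reals, for the superposition coupling
    (∀ M : Ω → Measure (Pt × ℝ),
      IsPoissonProcess M (μ.prod (volume.restrict (Set.Ioi (0 : ℝ)))) P →
      (∀ ε : ℝ, 0 < ε → IsPoissonProcess (superposed M ε) (ENNReal.ofReal ε⁻¹ • μ) P) ∧
      ∀ b : SpaceTime, ∀ᵐ ω ∂P,
        Tendsto (fun ε : ℝ => height (rescaled (superposed M) ε ω) b) (𝓝[>] 0)
          (𝓝 (height μ b))) ∧
    -- convergence in law of the macroscopic fluctuation field, for every admissible measure
    (∃ (Ω' : Type) (_ : MeasurableSpace Ω') (Q : Measure Ω') (_ : IsProbabilityMeasure Q)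
        (η : SpaceTime → Ω' → ℝ),
      IsLevyChentsov η (levyDist μ) Q ∧
      ∀ (m : ℕ) (a : Fin m → SpaceTime),
        TendstoInDistribution (fun (ε : Scale) (ω : Ω) (i : Fin m) => fluct μ N ε (a i) ω)
          toZero (fun (ω : Ω') (i : Fin m) => η (a i) ω) (fun _ => P) Q) ∧
    -- joint convergence in law of the two fluctuation fields to independent fields
    (∀ (ρ : ℝ → ℝ≥0) (κ : Kernel ℝ (ℝ × ℝ)) [IsMarkovKernel κ],
      HasSpaceDensity μ ρ κ → RegularAtZero ρ κ →
      ∃ (Ω' : Type) (_ : MeasurableSpace Ω') (Q : Measure Ω') (_ : IsProbabilityMeasure Q)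
        (η ηHat : SpaceTime → Ω' → ℝ),
        IsLevyChentsov η (levyDist μ) Q ∧
        IsLevyChentsov ηHat (levyDist (muHat ρ κ)) Q ∧
        (∀ a b : SpaceTime, secondMoment (muHat ρ κ) (crossing a b) < ∞) ∧
        IndepFun (fun (ω : Ω') (a : SpaceTime) => η a ω)
          (fun (ω : Ω') (b : SpaceTime) => ηHat b ω) Q ∧
        ∀ (m n : ℕ) (a : Fin m → SpaceTime) (b : Fin n → SpaceTime),
          TendstoInDistribution
            (fun (ε : Scale) (ω : Ω) =>
              ((fun i : Fin m => fluct μ N ε (a i) ω),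
                (fun j : Fin n => fluctHat μ N ε (b j) ω)))
            toZero
            (fun ω : Ω' => ((fun i : Fin m => η (a i) ω), (fun j : Fin n => ηHat (b j) ω)))
            (fun _ => P) Q) := by

  refine ⟨ae_tendsto_height hμ hN, fun M hM => ?_, exists_tendstoInDistribution_fluct hμ hN,
    fun ρ κ _ hd hr => ?_⟩
  · have := sigmaFinite_of_mem_admissible hμ
    exact ⟨fun ε _ => isPoissonProcess_superposed hM ε, ae_tendsto_height_superposed hμ hM⟩
  · obtain ⟨Ω', _, Q, _, η, ηHat, h1, h2, h3, h4⟩ :=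
      (hr.secondMomentBlowup hd).exists_tendstoInDistribution hμ hN
    exact ⟨Ω', _, Q, inferInstance, η, ηHat, h1, h2,
      hr.secondMoment_crossing_lt_top hd.measurable, h3, h4⟩
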